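/- **Setting.** Let $1\le p<\infty$, let $D\subset\mathbb R^d$ be open and connected, $U=\mathbb R^N$, and let $C_0(U^k)$ be the continuous functions on $U^k$ vanishing at infinity. Put $\mathcal H^k_0=L^1(D^k;C_0(U^k))$ and $\langle\nu^k,g\rangle_{\mathcal H^k}=\int_{D^k}\int_{U^k}g(x,\xi)\,d\nu^k_x(\xi)\,dx$. For $r>0$ let $$\omega^p_r(\nu^2)=\int_D\frac1{|B_r(x)\cap D|}\int_{B_r(x)\cap D}\int_{U^2}|\xi_1-\xi_2|^p\,d\nu^2_{x,y}(\xi)\,dy\,dx .$$ A *correlation measure*, written $\boldsymbol\nu\in\mathcal L^p(D;U)$, is a family $\boldsymbol\nu=(\nu^k)_{k\ge1}$ of maps $x\mapsto\nu^k_x$ from $D^k$ to the measures on $U^k$ (identified when equal a.e.) such that, for all $k$: * $\nu^k_x$ is a probability measure for a.e. $x$, and $x\mapsto\int f\,d\nu^k_x$ is measurable for every bounded continuous $f$; * (symmetry) for every permutation $\sigma$ of $\{1,\dots,k\}$, with $\sigma(z)=(z_{\sigma(1)},\dots,z_{\sigma(k)})$, and every $f\in C_0(U^k)$: $\int f(\xi)\,d\nu^k_{\sigma(x)}(\xi)=\int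 f(\sigma(\xi))\,d\nu^k_x(\xi)$ for a.e. $x\in D^k$; * (consistency) for every $f\in C_0(U^k)$: $\int f(\xi_1,\dots,\xi_k)\,d\nu^{k+1}_x(\xi)=\int f\,d\nu^k_{x_1,\dots,x_k}$ for a.e. $x\in D^{k+1}$; * $\langle\nu^1,|\xi|^p\rangle_{\mathcal H^1}<\infty$, and $\omega^p_r(\nu^2)\to0$ as $r\to0$. For $M>0$, the *support of $\boldsymbol\nu$ is bounded by $M$* if $$\limsup_{k\to\infty}\Big(\int_{D^k}\int_{U^k}|\xi_1|^p\cdots|\xi_k|^p\,d\nu^k_x(\xi)\,dx\Big)^{1/(kp)}\le M,$$ and $\mathcal L^p_b(D;U)$ is the set of $\boldsymbol\nu\in\mathcal L^p(D;U)$ with support bounded by some $M>0$. A Borel probability measure $\mu$ on $L^p(D;U)$ with $\int\|u\|_{L^p}^p\,d\mu<\infty$ is *dual* to $\boldsymbol\nu$ if $\langle\nu^k,g\rangle_{\mathcal H^k}=\int_{L^p}\int_{D^k}g(x,u(x_1),\dots,u(x_k))\,dx\,d\mu(u)$ for all $k$ and $g\in\mathcal H^k_0$. $\mathcal H^{k,p}$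 is the set of $g:D^k\times U^k\to\mathbb R$ that are continuous in $\xi$ for a.e. $x$, measurable in $x$ for every $\xi$, and satisfy $$|g(x,\xi)|\le\sum_{\alpha\in\{0,1\}^k}\phi_{k-|\alpha|}\big((x_i)_{\alpha_i=0}\big)\prod_{\alpha_i=1}|\xi_i|^p\qquad\forall\,x\in D^k,\ \xi\in U^k$$ for some nonnegative $\phi_i\in L^1(D^i)$, $0\le i\le k$ ($L^1(D^0)=\mathbb R$). For $k\ge1$, $\mathcal H^{k,p}_1\subset\mathcal H^{k,p}$ consists of those $g$ for which there are $r>0$ and a nonnegative $h\in\mathcal H^{k-1,p}$ with $$|g(x,\zeta)-g(y,\xi)|\le\sum_{i=1}^k|\zeta_i-\xi_i|\max(|\xi_i|,|\zeta_i|)^{p-1}h(\hat x^i,\hat\xi^i)$$ for all $x\in D^k$, $y\in B_r(x)\cap D^k$, $\xi,\zeta\in U^k$, where $\hat z^i$ is $z$ without its $i$-th component. **Theorem 2.5.** Let $\boldsymbol\nu_n\in\mathcal L^p(D;U)$, $n\in\mathbb N$, satisfy, for some $c>0$, $$\sup_n\langle\nu^1_n,|\xi|^p\rangle_{\mathcal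 H^1}\le c^p,\qquad \lim_{r\to0}\limsup_{n\to\infty}\omega^p_r(\nu^2_n)=0 .$$ Then there are a subsequence $(n_j)$ and $\boldsymbol\nu\in\mathcal L^p(D;U)$ such that: 1. $\langle\nu^k_{n_j},g\rangle_{\mathcal H^k}\to\langle\nu^k,g\rangle_{\mathcal H^k}$ for all $k$ and all $g\in\mathcal H^k_0$ (weak* convergence); 2. $\langle\nu^1,|\xi|^p\rangle_{\mathcal H^1}\le c^p$; 3. $\omega^p_r(\nu^2)\le\liminf_{j\to\infty}\omega^p_r(\nu^2_{n_j})$ for every $r>0$; 4. for all $k$ and all nonnegative $\phi\in L^1_{loc}(D^k)$, $\kappa\in C(U^k)$, with $g(x,\xi)=\phi(x)\kappa(\xi)$: $\langle\nu^k,g\rangle_{\mathcal H^k}\le\liminf_{j\to\infty}\langle\nu^k_{n_j},g\rangle_{\mathcal H^k}$ (values in $[0,\infty]$); 5. assume moreover that $D$ is bounded, and let $M>0$. If $\mu_n$ is dual to $\boldsymbol\nu_n$, then the support of $\boldsymbol\nu_n$ is bounded by $M$ if and only if $\|u\|_{L^p}\le M$ for $\mu_n$-a.e. $u$. If the support of every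 $\boldsymbol\nu_n$ is bounded by $M$, then for all $k\ge1$ and $g\in\mathcal H^{k,p}_1$ the pairings of $|g|$ with all $\nu^k_n$ and with $\nu^k$ are finite and $$\lim_{j\to\infty}\int_{D^k}\Big|\int g(x,\xi)\,d\nu^k_{n_j,x}(\xi)-\int g(x,\xi)\,d\nu^k_x(\xi)\Big|\,dx=0 .$$ In particular $\boldsymbol\nu\in\mathcal L^p_b(D;U)$ and $\langle\nu^k_{n_j},g\rangle_{\mathcal H^k}\to\langle\nu^k,g\rangle_{\mathcal H^k}$ for all such $g$; and if $\mu_n$ is dual to $\boldsymbol\nu_n$ for each $n$ and $\mu$ is dual to $\boldsymbol\nu$, then $\int F\,d\mu_{n_j}\to\int F\,d\mu$ for every bounded continuous $F:L^p(D;U)\to\mathbb R$. -/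

import Mathlib

open MeasureTheory Filter Topology Set
open scoped ENNReal BoundedContinuousFunction ZeroAtInfty

namespace CorrelationMeasures

/-- The physical space `ℝ^d`, with its Euclidean norm and Lebesgue measure. -/
abbrev X (d : ℕ) : Type := EuclideanSpace ℝ (Fin d)

/-- The phase space `U = ℝ^N`, with its Euclidean norm. -/
abbrev U (N : ℕ) : Type := EuclideanSpace ℝ (Fin N)

variable {d N : ℕ}

/-- The product domain `D^k ⊆ (ℝ^d)^k`. -/
def prodDom (D : Set (X d)) (k : ℕ) : Set (Fin k → X d) := Set.univ.pi fun _ => D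

/-- A family `ν = (ν^k)_k`, where `ν^k` assigns to points `x = (x_1, …, x_k)` a measure `ν^k_x`
on `U^k`. Only the values for almost every `x ∈ D^k` are ever used. The index `k = 0` is allowed;
since `D^0` and `U^0` are one-point spaces, it carries no information. -/
abbrev MeasFamily (d N : ℕ) : Type := (k : ℕ) → (Fin k → X d) → Measure (Fin k → U N)

/-- The duality pairing `∫_{D^k} ⟨ν^k_x, g(x)⟩ dx`. -/
noncomputable def pairing (D : Set (X d)) (ν : MeasFamily d N) {k : ℕ}
    (g : (Fin k → X d) → (Fin k → U N) → ℝ) : ℝ :=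
  ∫ x in prodDom D k, ∫ ξ, g x ξ ∂(ν k x)

/-- The pairing `∫_{D^k} ⟨ν^k_x, g(x)⟩ dx ∈ [0, ∞]` with a nonnegative observable. -/
noncomputable def lpairing (D : Set (X d)) (ν : MeasFamily d N) {k : ℕ}
    (g : (Fin k → X d) → (Fin k → U N) → ℝ≥0∞) : ℝ≥0∞ :=
  ∫⁻ x in prodDom D k, ∫⁻ ξ, g x ξ ∂(ν k x)

/-- The modulus of continuity
`ω_r^p(ν²) = ∫_D ⨍_{B_r(x)} ⟨ν²_{x,y}, |ξ_1 - ξ_2|^p⟩ dy dx`, where `B_r(x)` is the ball of the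
domain `D` (as `ν²_{x,y}` is given for `x, y ∈ D` only). -/
noncomputable def modCont (p : ℝ) (D : Set (X d)) (r : ℝ) (ν : MeasFamily d N) : ℝ≥0∞ :=
  ∫⁻ x in D, ⨍⁻ y in Metric.ball x r ∩ D, (∫⁻ ξ, ‖ξ 0 - ξ 1‖ₑ ^ p ∂(ν 2 ![x, y])) ∂volume

/-- Membership in `𝓛^p(D;U)`: the family is a correlation measure. -/
structure IsCorrelationMeasure (p : ℝ) (D : Set (X d)) (ν : MeasFamily d N) : Prop where
  /-- each `ν^k` is a Young measure -/
  prob : ∀ k, ∀ᵐ x ∂(volume.restrict (prodDom D k)), IsProbabilityMeasure (ν k x)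
  meas : ∀ k (f : (Fin k → U N) →ᵇ ℝ),
    AEMeasurable (fun x => ∫ ξ, f ξ ∂(ν k x)) (volume.restrict (prodDom D k))
  /-- symmetry: permuting the points permutes the components -/
  symm : ∀ k (σ : Equiv.Perm (Fin k)) (f : C₀(Fin k → U N, ℝ)),
    ∀ᵐ x ∂(volume.restrict (prodDom D k)),
      ∫ ξ, f ξ ∂(ν k (fun i => x (σ i))) = ∫ ξ, f (fun i => ξ (σ i)) ∂(ν k x)
  /-- consistency: forgetting the last component of `ν^(k+1)` gives `ν^k` -/
  consistent : ∀ k (f : C₀(Fin k → U N, ℝ)),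
    ∀ᵐ x ∂(volume.restrict (prodDom D (k + 1))),
      ∫ ξ, f (fun i => ξ i.castSucc) ∂(ν (k + 1) x) = ∫ ξ, f ξ ∂(ν k (fun i => x i.castSucc))
  /-- `L^p` integrability -/
  integrable : lpairing D ν (k := 1) (fun _ ξ => ‖ξ 0‖ₑ ^ p) < ∞
  /-- diagonal continuity -/
  diagCont : Tendsto (fun r => modCont p D r ν) (𝓝[>] 0) (𝓝 0)

/-- The support of `ν` is bounded by `M`:
`limsup_k (∫_{D^k} ⟨ν^k_x, |ξ_1|^p ⋯ |ξ_k|^p⟩ dx)^{1/(kp)} ≤ M`. -/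
def SupportBound (p : ℝ) (D : Set (X d)) (M : ℝ) (ν : MeasFamily d N) : Prop :=
  limsup (fun k : ℕ => (lpairing D ν (k := k) fun _ ξ => ∏ i, ‖ξ i‖ₑ ^ p) ^ (1 / ((k : ℝ) * p)))
    atTop ≤ ENNReal.ofReal M

/-- Membership in `𝓛^p_b(D;U)`: correlation measures with bounded support. -/
def IsBoundedCorrelationMeasure (p : ℝ) (D : Set (X d)) (ν : MeasFamily d N) : Prop :=
  IsCorrelationMeasure p D ν ∧ ∃ M : ℝ, 0 < M ∧ SupportBound p D M ν

/-- The class `𝓗^{k,p}(D;U)` of Carathéodory functions `g` on `D^k × U^k` with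
`|g(x,ξ)| ≤ ∑_α φ_{|ᾱ|}(x_ᾱ) |ξ^α|^p`. A multi-index `α ∈ {0,1}^k` is the finite set `S` of the
indices `i` with `α_i = 1`; `x_ᾱ` lists, in increasing order, the `x_i` with `i ∉ S`. -/
structure MemH (p : ℝ) (D : Set (X d)) (k : ℕ) (g : (Fin k → X d) → (Fin k → U N) → ℝ) :
    Prop where
  cont : ∀ᵐ x ∂(volume.restrict (prodDom D k)), Continuous (g x)
  meas : ∀ ξ, AEMeasurable (fun x => g x ξ) (volume.restrict (prodDom D k))
  bound : ∃ φ : (i : ℕ) → (Fin i → X d) → ℝ,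
    (∀ i ≤ k, (∀ x ∈ prodDom D i, 0 ≤ φ i x) ∧ IntegrableOn (φ i) (prodDom D i)) ∧
    ∀ x ∈ prodDom D k, ∀ ξ, |g x ξ| ≤ ∑ S : Finset (Fin k),
      φ Sᶜ.card (fun j => x (Sᶜ.orderEmbOfFin rfl j)) * ∏ i ∈ S, ‖ξ i‖ ^ p

/-- The subclass `𝓗^{k,p}_1(D;U)` of locally Lipschitz observables, for `k = m + 1`. Here
`i.removeNth x` is `x̂^i`, the vector `x` without its `i`-th component. -/
structure MemH1 (p : ℝ) (D : Set (X d)) (m : ℕ)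
    (g : (Fin (m + 1) → X d) → (Fin (m + 1) → U N) → ℝ) : Prop where
  memH : MemH p D (m + 1) g
  lipschitz : ∃ r > 0, ∃ h : (Fin m → X d) → (Fin m → U N) → ℝ,
    MemH p D m h ∧ (∀ x ∈ prodDom D m, ∀ ξ, 0 ≤ h x ξ) ∧
    ∀ x ∈ prodDom D (m + 1), ∀ y ∈ prodDom D (m + 1), dist y x < r → ∀ ζ ξ,
      |g x ζ - g y ξ| ≤ ∑ i, ‖ζ i - ξ i‖ * max ‖ξ i‖ ‖ζ i‖ ^ (p - 1)
        * h (i.removeNth x) (i.removeNth ξ)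

instance factOneLeOfReal {p : ℝ} [h : Fact (1 ≤ p)] : Fact (1 ≤ ENNReal.ofReal p) :=
  ⟨by simpa using h.out⟩

/-- The space `L^p(D;U)` for `1 ≤ p < ∞`. -/
abbrev LpSpace (N : ℕ) (p : ℝ) (D : Set (X d)) : Type :=
  Lp (U N) (ENNReal.ofReal p) (volume.restrict D)

/-- `L^p(D;U)` carries its Borel `σ`-algebra. -/
noncomputable instance borelLp (N : ℕ) (p : ℝ) [Fact (1 ≤ p)] (D : Set (X d)) :
    MeasurableSpace (LpSpace N p D) := borel _

instance borelSpaceLp (N : ℕ) (p : ℝ) [Fact (1 ≤ p)] (D : Set (X d)) :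
    BorelSpace (LpSpace N p D) := ⟨rfl⟩

/-- `μ` is a probability measure on `L^p(D;U)` with finite `p`-th moment that is dual to `ν`:
`∫_{D^k} ⟨ν^k_x, g(x)⟩ dx = ∫_{L^p} ∫_{D^k} g(x, u(x_1), …, u(x_k)) dx dμ(u)`
for all `k` and all `g ∈ 𝓗^k_0(D;U) = L^1(D^k; C_0(U^k))`. -/
structure IsDual (p : ℝ) [Fact (1 ≤ p)] (D : Set (X d)) (ν : MeasFamily d N)
    (μ : Measure (LpSpace N p D)) : Prop where
  prob : IsProbabilityMeasure μ
  moment : ∫⁻ u, ‖u‖ₑ ^ p ∂μ < ∞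
  dual : ∀ k (g : (Fin k → X d) → C₀(Fin k → U N, ℝ)), IntegrableOn g (prodDom D k) →
    pairing D ν (fun x ξ => g x ξ) = ∫ u, (∫ x in prodDom D k, g x (fun i => u (x i))) ∂μ

end CorrelationMeasures

open CorrelationMeasures

/-! Compactness. Up to null sets a correlation measure is a family of Markov kernels compatible with
every injective selection of points (`IsCorrelationMeasure.exists_regular`). Let ρ be a probability
measure on D with the null sets of Lebesgue measure and bounded density. The joint laws ρ^k ⊗ ν_n^k
have a fixed first marginal, and their values have uniformly bounded p-th moments, so they are
tight. Prokhorov's theorem, used for all k at once, gives one convergent subsequence, and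
disintegrating the limits gives the limit kernels (`exists_stable_subseq`). Because the first
marginal does not move, weak convergence improves to convergence against φ(x) f(ξ) for every
integrable φ and every bounded continuous f (`StableTendsto`). This implies the weak* convergence,
carries the compatibility relations to the limit, and by truncation makes nonnegative product
observables lower semicontinuous. The p-th moment and ω_r are such observables.

Strong convergence. The measure ν^{2k}_{x,y} is a coupling of ν^k_x and ν^k_y. Hence for bounded
uniformly continuous f the L¹ distance between x ↦ ⟨ν^k_x, f⟩ and its average over balls of radius r
is controlled by ω_r, uniformly along the sequence (`lintegral_average_osc_le`). The averages
themselves converge in L¹, since for fixed x the averaging weight is an integrable test function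
(`tendsto_lintegral_average`).

Uniform integrability. Observables with p-growth need control of products of |ξ_i|^p. On a domain of
finite volume, the values at independent uniform points form an exchangeable sequence. Conditional
independence suggests (E a(ξ_0) ∏_{l≤j} b(ξ_l))² ≤ E a(ξ_0) · E a(ξ_0) ∏_{l≤2j} b(ξ_l), and a direct
block argument proves it (`IsExchangeable.sq_mixedMoment_le`). With a = 1 it bounds the square of
the j-th moment by the 2j-th, so the asymptotic support bound controls every single moment
(`mom_le_of_supportBound`). With a the large part of |ξ|^p it reduces tails of products to the tail
of one factor. That tail is estimated by comparing the value at x with the value at a nearby point,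
at the cost of ω_r (`tail_le`).

Dual measures. The k-th moment equals ∫ ‖u‖^{pk} dμ, which identifies the support bound with an
essential bound on ‖u‖. For weak convergence, u is rebuilt from its values at m random points. A
bounded continuous functional of the reconstruction is an observable of class `MemH`, whose
expectations converge, and the mean reconstruction error is small uniformly along the sequence
(`IsDual.lintegral_edist_reconstructLp_le`). -/

namespace CorrelationMeasures

open ProbabilityTheory
open scoped NNReal

variable {d N : ℕ}

/-! ### Weakly measurable families as Markov kernels -/

section Kernels

variable {α Y : Type*} [MeasurableSpace α] [TopologicalSpace Y] [PolishSpace Y]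
  [MeasurableSpace Y] [BorelSpace Y]

omit [PolishSpace Y] in
lemma aemeasurable_measure_of_isClosed [HasOuterApproxClosed Y] {μ : Measure α}
    {ν : α → Measure Y}
    (hp : ∀ᵐ x ∂μ, IsProbabilityMeasure (ν x))
    (hm : ∀ f : Y →ᵇ ℝ, AEMeasurable (fun x => ∫ y, f y ∂(ν x)) μ)
    {F : Set Y} (hF : IsClosed F) : AEMeasurable (fun x => ν x F) μ := by
  have h1 : ∀ n, AEMeasurable (fun x => ∫⁻ y, hF.apprSeq n y ∂(ν x)) μ := by
    intro n
    have h2 := (hm ((hF.apprSeq n).comp NNReal.toReal (LipschitzWith.mk_one fun x y => le_rfl))).ennreal_ofReal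
    refine h2.congr ?_
    filter_upwards [hp] with x hx
    have h3 := BoundedContinuousFunction.toReal_lintegral_coe_eq_integral (hF.apprSeq n) (ν x)
    simp only [BoundedContinuousFunction.comp_apply]
    rw [← h3, ENNReal.ofReal_toReal]
    exact (BoundedContinuousFunction.lintegral_lt_top_of_nnreal (ν x) _).ne
  refine aemeasurable_of_tendsto_metrizable_ae atTop h1 ?_
  filter_upwards [hp] with x hx
  exact HasOuterApproxClosed.tendsto_lintegral_apprSeq hF (ν x)

/-- A family of probability measures that is weakly a.e.-measurable agrees almost everywhere
with a Markov kernel. -/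
theorem exists_markovKernel_ae_eq [Nonempty Y] {μ : Measure α} {ν : α → Measure Y}
    (hp : ∀ᵐ x ∂μ, IsProbabilityMeasure (ν x))
    (hm : ∀ f : Y →ᵇ ℝ, AEMeasurable (fun x => ∫ y, f y ∂(ν x)) μ) :
    ∃ κ : Kernel α Y, IsMarkovKernel κ ∧ ∀ᵐ x ∂μ, κ x = ν x := by
  have hall : ∀ s, MeasurableSet s → AEMeasurable (fun x => ν x s) μ := by
    intro s hs
    induction s, hs using MeasurableSpace.induction_on_inter
      ((BorelSpace.measurable_eq (α := Y)).trans borel_eq_generateFrom_isClosed)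
      isPiSystem_isClosed with
    | empty => simp
    | basic t ht => exact aemeasurable_measure_of_isClosed hp hm ht
    | compl t ht ih =>
      refine ((aemeasurable_const (b := (1 : ℝ≥0∞))).sub ih).congr ?_
      filter_upwards [hp] with x hx
      simp [prob_compl_eq_one_sub ht]
    | iUnion f hd hf ih =>
      simp only [measure_iUnion hd hf]
      exact AEMeasurable.tsum ih
  -- Preimages of the rational half-lines under a Borel embedding in ℝ form a countable generating
  -- π-system, so only one null set has to be discarded.
  let e := embeddingReal Y
  have he : MeasurableEmbedding e := measurableEmbedding_embeddingReal Y
  let S : ℚ → Set Y := fun q => e ⁻¹' (Iic (q : ℝ))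
  have hS : ∀ q, MeasurableSet (S q) := fun q => he.measurable measurableSet_Iic
  have hgood : ∀ᵐ x ∂μ, IsProbabilityMeasure (ν x) ∧
      ∀ q, ν x (S q) = (hall (S q) (hS q)).mk _ x := by
    refine hp.and (ae_all_iff.2 fun q => (hall (S q) (hS q)).ae_eq_mk)
  obtain ⟨E, hEsub, hEm, hE0⟩ := exists_measurable_superset_of_null hgood
  classical
  let y₀ : Y := Classical.arbitrary Y
  let κ : α → Measure Y := fun x => if x ∈ E then Measure.dirac y₀ else ν x
  have hgx : ∀ x, x ∉ E → IsProbabilityMeasure (ν x) ∧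
      ∀ q, ν x (S q) = (hall (S q) (hS q)).mk _ x := by
    intro x hx
    by_contra h
    exact hx (hEsub h)
  have hκp : ∀ x, IsProbabilityMeasure (κ x) := by
    intro x
    by_cases hx : x ∈ E
    · simp only [κ, hx, if_true]; infer_instance
    · simp only [κ, hx, if_false]; exact (hgx x hx).1
  have hgen : (inferInstance : MeasurableSpace Y) = .generateFrom (range S) := by
    have hr : range S = preimage e '' (⋃ a : ℚ, {Iic (a : ℝ)}) := by
      rw [iUnion_singleton_eq_range, ← range_comp]
      rfl
    rw [hr, ← MeasurableSpace.comap_generateFrom, ← Real.borel_eq_generateFrom_Iic_rat,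
      ← BorelSpace.measurable_eq (α := ℝ), he.comap_eq]
  have hpi : IsPiSystem (range S) := by
    rintro _ ⟨q, rfl⟩ _ ⟨r, rfl⟩ -
    refine ⟨min q r, ?_⟩
    simp only [S, ← preimage_inter, Iic_inter_Iic, Rat.cast_min]
  have hκ : Measurable κ := by
    refine Measurable.measure_of_isPiSystem_of_isProbabilityMeasure hgen hpi ?_
    rintro _ ⟨q, rfl⟩
    have : (fun a => κ a (S q)) = fun a => if a ∈ E then Measure.dirac y₀ (S q)
        else (hall (S q) (hS q)).mk _ a := by
      ext a
      by_cases ha : a ∈ E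
      · simp [κ, ha]
      · simp only [κ, ha, if_false]; exact (hgx a ha).2 q
    rw [this]
    exact Measurable.ite hEm measurable_const (AEMeasurable.measurable_mk _)
  refine ⟨⟨κ, hκ⟩, ⟨hκp⟩, ?_⟩
  have : ∀ᵐ x ∂μ, x ∉ E := measure_eq_zero_iff_ae_notMem.1 hE0
  filter_upwards [this] with x hx
  simp [κ, hx]

end Kernels

lemma tendsto_of_forall_approx {a : ℕ → ℝ} {a₀ : ℝ}
    (h : ∀ ε > 0, ∃ (b : ℕ → ℝ) (b₀ : ℝ), (∀ᶠ n in atTop, |a n - b n| ≤ ε) ∧ |a₀ - b₀| ≤ ε ∧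
      Tendsto b atTop (𝓝 b₀)) : Tendsto a atTop (𝓝 a₀) := by
  rw [Metric.tendsto_nhds]
  intro ε hε
  obtain ⟨b, b₀, h1, h2, h3⟩ := h (ε / 4) (by positivity)
  filter_upwards [h1, Metric.tendsto_nhds.1 h3 (ε / 4) (by positivity)] with n hn1 hn2
  rw [Real.dist_eq] at hn2 ⊢
  rw [abs_le] at hn1 h2
  rw [abs_lt] at hn2 ⊢
  constructor <;> linarith

/-! ### Stable convergence of kernels -/

section Stable

variable {α α' Y Y' : Type*} [MeasurableSpace α] [MeasurableSpace α']
  [MetricSpace Y] [ProperSpace Y] [MeasurableSpace Y] [BorelSpace Y]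
  [MetricSpace Y'] [ProperSpace Y'] [MeasurableSpace Y'] [BorelSpace Y']

lemma measurable_integral_bcf (κ : Kernel α Y) (f : Y →ᵇ ℝ) :
    Measurable (fun x => ∫ y, f y ∂(κ x)) :=
  (f.continuous.stronglyMeasurable.integral_kernel).measurable

lemma abs_integral_bcf_le (κ : Kernel α Y) [IsMarkovKernel κ] (f : Y →ᵇ ℝ) (x : α) :
    |∫ y, f y ∂(κ x)| ≤ ‖f‖ := by
  simpa using BoundedContinuousFunction.norm_integral_le_norm (κ x) f

lemma integrable_mul_integral_bcf {μ : Measure α} (κ : Kernel α Y) [IsMarkovKernel κ]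
    {φ : α → ℝ} (hφ : Integrable φ μ) (f : Y →ᵇ ℝ) :
    Integrable (fun x => φ x * ∫ y, f y ∂(κ x)) μ :=
  hφ.mul_bdd (c := ‖f‖) (measurable_integral_bcf κ f).aestronglyMeasurable
    (ae_of_all _ fun x => by simpa using abs_integral_bcf_le κ f x)

/-- Two Markov kernels whose integrals against compactly supported functions agree on all sets
agree almost everywhere. -/
theorem kernel_ae_eq_of_setIntegral_eq {μ : Measure α} [IsFiniteMeasure μ]
    {κ η : Kernel α Y} [IsMarkovKernel κ] [IsMarkovKernel η]
    (h : ∀ A, MeasurableSet A → ∀ f : C₀(Y, ℝ),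
      ∫ x in A, ∫ y, f y ∂(κ x) ∂μ = ∫ x in A, ∫ y, f y ∂(η x) ∂μ) :
    ∀ᵐ x ∂μ, κ x = η x := by
  refine Kernel.ae_eq_of_compProd_eq ?_
  refine Measure.ext_prod fun {A B} hA hB => ?_
  -- For fixed A, equality on the rectangles A × B is equality of two finite measures on Y, and
  -- these are separated by compactly supported functions.
  have key : ((μ.restrict A) ⊗ₘ κ).snd = ((μ.restrict A) ⊗ₘ η).snd := by
    refine Measure.ext_of_integral_eq_on_compactlySupported fun f => ?_
    have hf : ∀ (ζ : Kernel α Y) [IsMarkovKernel ζ],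
        ∫ y, f y ∂((μ.restrict A) ⊗ₘ ζ).snd = ∫ x in A, ∫ y, f y ∂(ζ x) ∂μ := by
      intro ζ _
      rw [Measure.snd, integral_map measurable_snd.aemeasurable
        (f := fun y => f y) f.continuous.aestronglyMeasurable, Measure.integral_compProd]
      exact (f.continuous.integrable_of_hasCompactSupport
        (μ := ((μ.restrict A) ⊗ₘ ζ).snd) f.hasCompactSupport).comp_measurable measurable_snd
    rw [hf κ, hf η]
    exact h A hA ⟨f.toContinuousMap, f.hasCompactSupport.is_zero_at_infty⟩
  have h2 : ∀ (ζ : Kernel α Y) [IsMarkovKernel ζ],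
      (μ ⊗ₘ ζ) (A ×ˢ B) = ((μ.restrict A) ⊗ₘ ζ).snd B := by
    intro ζ _
    rw [Measure.compProd_apply_prod hA hB, Measure.snd_apply hB,
      Measure.compProd_apply (measurable_snd hB)]
    rfl
  rw [h2 κ, h2 η, key]

/-- An s-finite measure has the null sets of a finite one. The gain is a single exceptional set in
place of one for each f. -/
theorem kernel_ae_eq_of_ae_integral_eq {μ : Measure α} [SFinite μ]
    {κ η : Kernel α Y} [IsMarkovKernel κ] [IsMarkovKernel η]
    (h : ∀ f : C₀(Y, ℝ), ∀ᵐ x ∂μ, ∫ y, f y ∂(κ x) = ∫ y, f y ∂(η x)) :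
    ∀ᵐ x ∂μ, κ x = η x := by
  rw [← ae_toFinite]
  refine kernel_ae_eq_of_setIntegral_eq fun A hA f => ?_
  refine integral_congr_ae (ae_restrict_of_ae ?_)
  rw [ae_toFinite]
  exact h f

/-- Convergence of kernels against all products of integrable functions and bounded continuous
functions. -/
def StableTendsto (μ : Measure α) (κ : ℕ → Kernel α Y) (κ₀ : Kernel α Y) : Prop :=
  ∀ φ : α → ℝ, Integrable φ μ → ∀ f : Y →ᵇ ℝ,
    Tendsto (fun n => ∫ x, φ x * ∫ y, f y ∂(κ n x) ∂μ) atTop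
      (𝓝 (∫ x, φ x * ∫ y, f y ∂(κ₀ x) ∂μ))

/-- All joint laws share the first marginal μ, so the integrals depend on φ continuously in L¹(μ),
uniformly over the kernels. Bounded continuous functions are dense there. -/
lemma StableTendsto.of_weak [TopologicalSpace α] [NormalSpace α] [SecondCountableTopology α]
    [BorelSpace α] {μ : Measure α} [IsFiniteMeasure μ] [μ.WeaklyRegular]
    {κ : ℕ → Kernel α Y} {κ₀ : Kernel α Y}
    [∀ n, IsMarkovKernel (κ n)] [IsMarkovKernel κ₀]
    (h : ∀ F : (α × Y) →ᵇ ℝ, Tendsto (fun n => ∫ z, F z ∂(μ ⊗ₘ κ n)) atTop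
      (𝓝 (∫ z, F z ∂(μ ⊗ₘ κ₀)))) : StableTendsto μ κ κ₀ := by
  intro φ hφ f
  refine tendsto_of_forall_approx fun ε hε => ?_
  obtain ⟨g, hg, hgi⟩ := hφ.exists_boundedContinuous_integral_sub_le
    (ε := ε / (‖f‖ + 1)) (by positivity)
  have hb : ∀ (ζ : Kernel α Y) [IsMarkovKernel ζ],
      |∫ x, φ x * ∫ y, f y ∂(ζ x) ∂μ - ∫ x, g x * ∫ y, f y ∂(ζ x) ∂μ| ≤ ε := by
    intro ζ _
    rw [← integral_sub (integrable_mul_integral_bcf ζ hφ f)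
      (integrable_mul_integral_bcf ζ hgi f)]
    calc |∫ x, (φ x * ∫ y, f y ∂(ζ x) - g x * ∫ y, f y ∂(ζ x)) ∂μ|
        ≤ ∫ x, ‖φ x * ∫ y, f y ∂(ζ x) - g x * ∫ y, f y ∂(ζ x)‖ ∂μ :=
          norm_integral_le_integral_norm (fun x => φ x * ∫ y, f y ∂(ζ x) - g x * ∫ y, f y ∂(ζ x))
      _ ≤ ∫ x, ‖φ x - g x‖ * ‖f‖ ∂μ := by
          refine integral_mono ((integrable_mul_integral_bcf ζ hφ f).sub
            (integrable_mul_integral_bcf ζ hgi f)).norm ((hφ.sub hgi).norm.mul_const _)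
            fun x => ?_
          simp only [← sub_mul, norm_mul]
          gcongr
          exact abs_integral_bcf_le ζ f x
      _ ≤ ε / (‖f‖ + 1) * ‖f‖ := by
          rw [integral_mul_const]
          gcongr
      _ ≤ ε := by
          rw [div_mul_eq_mul_div, div_le_iff₀ (by positivity)]
          nlinarith [norm_nonneg f]
  let F : (α × Y) →ᵇ ℝ :=
    (g.compContinuous ⟨Prod.fst, continuous_fst⟩) * (f.compContinuous ⟨Prod.snd, continuous_snd⟩)
  have hF : ∀ (ζ : Kernel α Y) [IsMarkovKernel ζ],
      ∫ z, F z ∂(μ ⊗ₘ ζ) = ∫ x, g x * ∫ y, f y ∂(ζ x) ∂μ := by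
    intro ζ _
    rw [Measure.integral_compProd (F.integrable _)]
    refine integral_congr_ae (ae_of_all _ fun x => ?_)
    exact integral_const_mul (g x) fun y => f y
  refine ⟨fun n => ∫ x, g x * ∫ y, f y ∂(κ n x) ∂μ, ∫ x, g x * ∫ y, f y ∂(κ₀ x) ∂μ,
    Eventually.of_forall fun n => hb (κ n), hb κ₀, ?_⟩
  simpa only [hF] using h F

/-- The Radon–Nikodym density is absorbed into the test function φ. -/
lemma StableTendsto.of_absolutelyContinuous {μ ρ : Measure α} [SigmaFinite μ] [SigmaFinite ρ]
    {κ : ℕ → Kernel α Y} {κ₀ : Kernel α Y} (h : StableTendsto ρ κ κ₀) (hμ : μ ≪ ρ) :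
    StableTendsto μ κ κ₀ := by
  intro φ hφ f
  have := h (fun x => (μ.rnDeriv ρ x).toReal • φ x) ((integrable_rnDeriv_smul_iff hμ).2 hφ) f
  simpa only [smul_eq_mul, mul_assoc, ← integral_rnDeriv_smul hμ] using this

/-- Marginal relations between kernels pass to stable limits. -/
theorem StableTendsto.map_eq_comap {μ : Measure α} {μ' : Measure α'} [IsFiniteMeasure μ]
    [SigmaFinite μ'] {κ : ℕ → Kernel α Y} {κ₀ : Kernel α Y} {κ' : ℕ → Kernel α' Y'}
    {κ₀' : Kernel α' Y'} [∀ n, IsMarkovKernel (κ n)] [IsMarkovKernel κ₀]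
    [∀ n, IsMarkovKernel (κ' n)] [IsMarkovKernel κ₀']
    (h : StableTendsto μ κ κ₀) (h' : StableTendsto μ' κ' κ₀')
    {T : α → α'} (hT : Measure.QuasiMeasurePreserving T μ μ') {S : Y → Y'} (hS : Continuous S)
    (hm : ∀ n, ∀ᵐ x ∂μ, (κ n x).map S = κ' n (T x)) :
    ∀ᵐ x ∂μ, (κ₀ x).map S = κ₀' (T x) := by
  have : IsMarkovKernel (κ₀.map S) := Kernel.IsMarkovKernel.map _ hS.measurable
  have hmap : ∀ x, (κ₀ x).map S = κ₀.map S x := fun x =>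
    (Kernel.map_apply _ hS.measurable x).symm
  simp only [hmap]
  refine kernel_ae_eq_of_setIntegral_eq (η := κ₀'.comap T hT.measurable) fun A hA f => ?_
  have hbS : ∀ y, f.toBCF (S y) = (f.toBCF.compContinuous ⟨S, hS⟩) y := fun y => rfl
  have key1 : Tendsto (fun n => ∫ x in A, ∫ y, f y ∂((κ n x).map S) ∂μ) atTop
      (𝓝 (∫ x in A, ∫ y, f y ∂((κ₀ x).map S) ∂μ)) := by
    have := h (A.indicator 1) ((integrable_const (1 : ℝ)).indicator hA)
      (f.toBCF.compContinuous ⟨S, hS⟩)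
    have e : ∀ ζ : Kernel α Y, ∫ x, A.indicator 1 x *
        ∫ y, (f.toBCF.compContinuous ⟨S, hS⟩) y ∂(ζ x) ∂μ
        = ∫ x in A, ∫ y, f y ∂((ζ x).map S) ∂μ := by
      intro ζ
      rw [← integral_indicator hA]
      refine integral_congr_ae (ae_of_all _ fun x => ?_)
      have hmp : ∫ y, f y ∂((ζ x).map S) = ∫ y, f (S y) ∂(ζ x) :=
        integral_map hS.measurable.aemeasurable f.continuous.aestronglyMeasurable
      by_cases hx : x ∈ A
      · simp only [hx, indicator_of_mem, hmp, Pi.one_apply, one_mul]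
        rfl
      · simp [hx]
    simpa only [e] using this
  have key2 : Tendsto (fun n => ∫ x in A, ∫ y, f y ∂(κ' n (T x)) ∂μ) atTop
      (𝓝 (∫ x in A, ∫ y, f y ∂(κ₀' (T x)) ∂μ)) := by
    -- The image of the restricted measure is only absolutely continuous with respect to μ', which
    -- is enough to transfer the convergence along T.
    have hac : (μ.restrict A).map T ≪ μ' :=
      (Measure.AbsolutelyContinuous.map (Measure.absolutelyContinuous_of_le Measure.restrict_le_self)
        hT.measurable).trans hT.absolutelyContinuous
    have := h'.of_absolutelyContinuous hac (fun _ => 1) (integrable_const _) f.toBCF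
    have e : ∀ ζ : Kernel α' Y', ∫ x, 1 * ∫ y, f.toBCF y ∂(ζ x) ∂(μ.restrict A).map T
        = ∫ x in A, ∫ y, f y ∂(ζ (T x)) ∂μ := by
      intro ζ
      simp only [one_mul]
      rw [integral_map hT.measurable.aemeasurable
        (measurable_integral_bcf ζ f.toBCF).aestronglyMeasurable]
      rfl
    simpa only [e] using this
  have e3 : ∀ n, ∫ x in A, ∫ y, f y ∂((κ n x).map S) ∂μ
      = ∫ x in A, ∫ y, f y ∂(κ' n (T x)) ∂μ := by
    intro n
    refine integral_congr_ae (ae_restrict_of_ae ?_)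
    filter_upwards [hm n] with x hx
    rw [hx]
  simp only [e3] at key1
  have := tendsto_nhds_unique key1 key2
  simpa only [← hmap, Kernel.comap_apply] using this

/-- Lower semicontinuity of nonnegative product observables under stable convergence. -/
theorem StableTendsto.lintegral_le_liminf {μ : Measure α} [SigmaFinite μ]
    {κ : ℕ → Kernel α Y} {κ₀ : Kernel α Y} [∀ n, IsMarkovKernel (κ n)] [IsMarkovKernel κ₀]
    (h : StableTendsto μ κ κ₀) {φ : α → ℝ≥0∞} (hφ : AEMeasurable φ μ) {f : Y → ℝ}
    (hf : Continuous f) (hf0 : ∀ y, 0 ≤ f y) :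
    ∫⁻ x, φ x * ∫⁻ y, ENNReal.ofReal (f y) ∂(κ₀ x) ∂μ ≤
      liminf (fun n => ∫⁻ x, φ x * ∫⁻ y, ENNReal.ofReal (f y) ∂(κ n x) ∂μ) atTop := by
  -- Both factors are truncated at height m, the weight also to a set of finite measure. The
  -- truncated integrals converge along n and lie below the full ones; monotone convergence in m
  -- then removes the truncation for the limit kernel.
  let fm : ℕ → Y →ᵇ ℝ := fun m => BoundedContinuousFunction.ofNormedAddCommGroup
    (fun y => min (f y) m) (hf.min continuous_const) m (fun y => by
      rw [Real.norm_of_nonneg (le_min (hf0 y) (Nat.cast_nonneg m))]; exact min_le_right _ _)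
  have hfm0 : ∀ m y, 0 ≤ fm m y := fun m y => le_min (hf0 y) (Nat.cast_nonneg m)
  let φm : ℕ → α → ℝ≥0∞ := fun m => (spanningSets μ m).indicator fun x => min (φ x) m
  have hφm : ∀ m, AEMeasurable (φm m) μ := fun m =>
    (hφ.min aemeasurable_const).indicator (measurableSet_spanningSets μ m)
  have hφm_top : ∀ m x, φm m x ≠ ∞ := by
    intro m x
    by_cases hx : x ∈ spanningSets μ m
    · simp only [φm, indicator_of_mem hx]
      exact ((min_le_right _ _).trans_lt (ENNReal.natCast_lt_top m)).ne
    · simp [φm, hx]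
  have hφi : ∀ m, Integrable (fun x => (φm m x).toReal) μ := by
    intro m
    refine integrable_toReal_of_lintegral_ne_top (hφm m) ?_
    rw [lintegral_indicator (measurableSet_spanningSets μ m)]
    refine ((lintegral_mono (fun x => min_le_right _ _)).trans_lt ?_).ne
    rw [setLIntegral_const]
    exact ENNReal.mul_lt_top (ENNReal.natCast_lt_top m) (measure_spanningSets_lt_top μ m)
  have hL : ∀ (ζ : Kernel α Y) [IsMarkovKernel ζ] (m : ℕ),
      ∫⁻ x, φm m x * ∫⁻ y, ENNReal.ofReal (fm m y) ∂(ζ x) ∂μ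
        = ENNReal.ofReal (∫ x, (φm m x).toReal * ∫ y, fm m y ∂(ζ x) ∂μ) := by
    intro ζ _ m
    rw [ofReal_integral_eq_lintegral_ofReal (integrable_mul_integral_bcf ζ (hφi m) _)
      (ae_of_all _ fun x => mul_nonneg ENNReal.toReal_nonneg
        (integral_nonneg (hfm0 m)))]
    refine lintegral_congr fun x => ?_
    rw [ENNReal.ofReal_mul ENNReal.toReal_nonneg, ENNReal.ofReal_toReal (hφm_top m x),
      ofReal_integral_eq_lintegral_ofReal ((fm m).integrable _) (ae_of_all _ (hfm0 m))]
  have hlim : Tendsto (fun m => ∫⁻ x, φm m x * ∫⁻ y, ENNReal.ofReal (fm m y) ∂(κ₀ x) ∂μ) atTop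
      (𝓝 (∫⁻ x, φ x * ∫⁻ y, ENNReal.ofReal (f y) ∂(κ₀ x) ∂μ)) := by
    have hmeas : ∀ m, Measurable fun x => ∫⁻ y, ENNReal.ofReal (fm m y) ∂(κ₀ x) := fun m =>
      Measurable.lintegral_kernel (fm m).continuous.measurable.ennreal_ofReal
    have hmonof : ∀ y, Monotone fun m => ENNReal.ofReal (fm m y) := fun y m m' hmm' =>
      ENNReal.ofReal_le_ofReal (min_le_min_left _ (Nat.cast_le.2 hmm'))
    have hmonoφ : ∀ x, Monotone fun m => φm m x := by
      intro x m m' hmm'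
      by_cases hx : x ∈ spanningSets μ m
      · have hx' := monotone_spanningSets μ hmm' hx
        simp only [φm, indicator_of_mem hx, indicator_of_mem hx']
        exact min_le_min_left _ (Nat.cast_le.2 hmm')
      · simp [φm, hx]
    refine lintegral_tendsto_of_tendsto_of_monotone
      (fun m => (hφm m).mul (hmeas m).aemeasurable) ?_ ?_
    · refine ae_of_all _ fun x m m' hmm' => ?_
      exact mul_le_mul' (hmonoφ x hmm') (lintegral_mono fun y => hmonof y hmm')
    · refine ae_of_all _ fun x => ?_
      have t1 : Tendsto (fun m => φm m x) atTop (𝓝 (φ x)) := by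
        have hmem : ∀ᶠ m in atTop, x ∈ spanningSets μ m := by
          filter_upwards [eventually_ge_atTop (spanningSetsIndex μ x)] with m hm
          exact mem_spanningSets_of_index_le μ x hm
        have : Tendsto (fun m : ℕ => min (φ x) (m : ℝ≥0∞)) atTop (𝓝 (min (φ x) ∞)) :=
          tendsto_const_nhds.min ENNReal.tendsto_nat_nhds_top
        rw [min_eq_left le_top] at this
        refine this.congr' ?_
        filter_upwards [hmem] with m hm
        simp [φm, hm]
      have e : ∀ m, φm m x * ∫⁻ y, ENNReal.ofReal (fm m y) ∂(κ₀ x)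
          = ∫⁻ y, φm m x * ENNReal.ofReal (fm m y) ∂(κ₀ x) := fun m =>
        (lintegral_const_mul _ (fm m).continuous.measurable.ennreal_ofReal).symm
      simp only [e]
      rw [← lintegral_const_mul _ hf.measurable.ennreal_ofReal]
      refine lintegral_tendsto_of_tendsto_of_monotone (fun m =>
        ((fm m).continuous.measurable.ennreal_ofReal.const_mul _).aemeasurable)
        (ae_of_all _ fun y m m' hmm' => mul_le_mul' (hmonoφ x hmm') (hmonof y hmm'))
        (ae_of_all _ fun y => ?_)
      refine (ENNReal.Tendsto.mul_const t1 (.inr ENNReal.ofReal_ne_top)).congr' ?_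
      filter_upwards [eventually_ge_atTop ⌈f y⌉₊] with m hm
      have : f y ≤ m := (Nat.le_ceil _).trans (Nat.cast_le.2 hm)
      simp [fm, this]
  refine le_of_tendsto' hlim fun m => ?_
  have ht : Tendsto (fun n => ∫⁻ x, φm m x * ∫⁻ y, ENNReal.ofReal (fm m y) ∂(κ n x) ∂μ) atTop
      (𝓝 (∫⁻ x, φm m x * ∫⁻ y, ENNReal.ofReal (fm m y) ∂(κ₀ x) ∂μ)) := by
    simp only [hL]
    exact (ENNReal.continuous_ofReal.tendsto _).comp (h _ (hφi m) (fm m))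
  rw [← ht.liminf_eq]
  refine liminf_le_liminf (Eventually.of_forall fun n => lintegral_mono fun x => ?_)
  refine mul_le_mul' ?_ (lintegral_mono fun y => ENNReal.ofReal_le_ofReal (min_le_left _ _))
  exact (indicator_le_self _ _ _).trans (min_le_left _ _)

end Stable

/-! ### Product measures and selections of coordinates -/

section Products

variable {Z : Type*} [MeasurableSpace Z]

lemma lintegral_pi_prod (μ : Measure Z) [SigmaFinite μ] :
    ∀ {k : ℕ} (f : Fin k → Z → ℝ≥0∞), (∀ i, Measurable (f i)) →
      ∫⁻ x, ∏ i, f i (x i) ∂(Measure.pi fun _ : Fin k => μ) = ∏ i, ∫⁻ z, f i z ∂μ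
  | 0, f, hf => by simp
  | k + 1, f, hf => by
    have hmp := (measurePreserving_piFinSuccAbove (fun _ : Fin (k + 1) => μ) 0).symm
    rw [← hmp.lintegral_comp_emb (MeasurableEquiv.measurableEmbedding _)]
    have h0 : Measurable fun x : Fin k → Z => ∏ i : Fin k, f i.succ (x i) :=
      Finset.measurable_prod _ fun i _ => (hf _).comp (measurable_pi_apply i)
    have : ∀ z : Z × (Fin k → Z), ∏ i, f i ((MeasurableEquiv.piFinSuccAbove
        (fun _ : Fin (k + 1) => Z) 0).symm z i) = f 0 z.1 * ∏ i : Fin k, f i.succ (z.2 i) := by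
      intro z
      rw [Fin.prod_univ_succ]
      simp [MeasurableEquiv.piFinSuccAbove, Fin.insertNthEquiv]
    simp only [this]
    rw [lintegral_prod_mul (hf 0).aemeasurable h0.aemeasurable, Fin.prod_univ_succ,
      ← lintegral_pi_prod μ (fun i => f i.succ) fun i => hf _]

lemma pi_withDensity (μ : Measure Z) [SigmaFinite μ] {w : Z → ℝ≥0∞} (hw : Measurable w)
    [SigmaFinite (μ.withDensity w)] (k : ℕ) :
    (Measure.pi fun _ : Fin k => μ.withDensity w)
      = (Measure.pi fun _ : Fin k => μ).withDensity fun x => ∏ i, w (x i) := by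
  refine Measure.pi_eq fun s hs => ?_
  rw [withDensity_apply _ (MeasurableSet.univ_pi hs), ← lintegral_indicator (MeasurableSet.univ_pi hs)]
  have : ∀ x : Fin k → Z, (univ.pi s).indicator (fun x => ∏ i, w (x i)) x
      = ∏ i, (s i).indicator w (x i) := by
    intro x
    by_cases hx : x ∈ univ.pi s
    · rw [indicator_of_mem hx]
      exact Finset.prod_congr rfl fun i _ => (indicator_of_mem (hx i (mem_univ i)) _).symm
    · rw [indicator_of_notMem hx]
      simp only [mem_univ_pi, not_forall] at hx
      obtain ⟨i, hi⟩ := hx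
      exact (Finset.prod_eq_zero (Finset.mem_univ i) (indicator_of_notMem hi _)).symm
  simp only [this]
  rw [lintegral_pi_prod μ _ fun i => hw.indicator (hs i)]
  exact Finset.prod_congr rfl fun i _ => by
    rw [lintegral_indicator (hs i), withDensity_apply _ (hs i)]

lemma measurable_comp_right {j k : ℕ} (e : Fin j → Fin k) :
    Measurable fun x : Fin k → Z => x ∘ e :=
  measurable_pi_lambda _ fun i => measurable_pi_apply (e i)

/-- The forgotten coordinates integrate to one because ρ is a probability measure. For Lebesgue
measure on D this fails. -/
lemma measurePreserving_comp (ρ : Measure Z) [IsProbabilityMeasure ρ] {j k : ℕ}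
    {e : Fin j → Fin k} (he : Function.Injective e) :
    MeasurePreserving (fun x : Fin k → Z => x ∘ e) (Measure.pi fun _ => ρ)
      (Measure.pi fun _ => ρ) := by
  classical
  refine ⟨measurable_comp_right e, ?_⟩
  symm
  refine Measure.pi_eq fun s hs => ?_
  rw [Measure.map_apply (measurable_comp_right e) (MeasurableSet.univ_pi hs)]
  let t : Fin k → Set Z := fun i => if h : ∃ l, e l = i then s h.choose else univ
  have hte : ∀ l, t (e l) = s l := by
    intro l
    have h : ∃ l', e l' = e l := ⟨l, rfl⟩
    simp only [t, h, dif_pos]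
    rw [he h.choose_spec]
  have htn : ∀ i, (¬ ∃ l, e l = i) → t i = univ := by
    intro i hi
    simp only [t, hi, dif_neg, not_false_eq_true]
  have : (fun x : Fin k → Z => x ∘ e) ⁻¹' univ.pi s = univ.pi t := by
    ext x
    simp only [mem_preimage, mem_univ_pi, Function.comp]
    constructor
    · intro h i
      by_cases hi : ∃ l, e l = i
      · obtain ⟨l, rfl⟩ := hi
        rw [hte]; exact h l
      · rw [htn i hi]; trivial
    · intro h l
      rw [← hte]; exact h _
  rw [this, Measure.pi_pi]
  refine (Finset.prod_of_injOn e he.injOn (fun _ _ => by simp) (fun i _ hi => ?_)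
    fun l _ => by rw [hte]).symm
  rw [htn i (by simpa using hi), measure_univ]

end Products

/-! ### Base measures on the domain and compactness of kernel families -/

/-- Lebesgue measure on `D^k`. -/
noncomputable abbrev lam (D : Set (X d)) (k : ℕ) : Measure (Fin k → X d) :=
  volume.restrict (prodDom D k)

lemma measurableSet_prodDom {D : Set (X d)} (hD : MeasurableSet D) (k : ℕ) :
    MeasurableSet (prodDom D k) := MeasurableSet.univ_pi fun _ => hD

lemma lam_eq_pi (D : Set (X d)) (k : ℕ) :
    lam D k = Measure.pi fun _ => volume.restrict D := by
  rw [lam, prodDom, volume_pi, Measure.restrict_pi_pi]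

/-- A strictly positive integrable function is cut at height 1, which makes it bounded, and then
normalised. Its integral is positive because D is open and nonempty. -/
lemma exists_base (D : Set (X d)) (hDo : IsOpen D) (hDn : D.Nonempty) :
    ∃ (w : X d → ℝ≥0∞) (C : ℝ≥0∞), Measurable w ∧ C ≠ ∞ ∧ (∀ x, 0 < w x) ∧ (∀ x, w x ≤ C) ∧
      IsProbabilityMeasure ((volume.restrict D).withDensity w) := by
  obtain ⟨g, hg0, hgm, hg1⟩ := exists_pos_lintegral_lt_of_sigmaFinite
    (volume.restrict D) (ε := 1) one_ne_zero
  let v : X d → ℝ≥0∞ := fun x => min (g x : ℝ≥0∞) 1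
  have hv : Measurable v := hgm.coe_nnreal_ennreal.min measurable_const
  have hv0 : ∀ x, 0 < v x := fun x => lt_min (by exact_mod_cast hg0 x) one_pos
  set I := ∫⁻ x in D, v x with hI
  have hIt : I ≠ ∞ := ((lintegral_mono fun x => min_le_left _ _).trans_lt
    (hg1.trans ENNReal.one_lt_top)).ne
  have hI0 : I ≠ 0 := by
    rw [hI, Ne, lintegral_eq_zero_iff hv]
    intro h
    have : (volume.restrict D) univ = 0 := by
      have h' : ∀ᵐ x ∂volume.restrict D, False := h.mono fun x hx => (hv0 x).ne' hx
      simpa [ae_iff] using h'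
    rw [Measure.restrict_apply_univ] at this
    exact (hDo.measure_pos volume hDn).ne' this
  refine ⟨fun x => I⁻¹ * v x, I⁻¹ * 1, hv.const_mul _, by simp [hI0],
    fun x => ENNReal.mul_pos (by simp [hIt]) (hv0 x).ne', fun x => ?_, ⟨?_⟩⟩
  · exact mul_le_mul_right (min_le_right _ _) _
  · rw [withDensity_apply _ MeasurableSet.univ, Measure.restrict_univ, lintegral_const_mul _ hv]
    exact ENNReal.inv_mul_cancel hI0 hIt

/-- A base probability measure on the domain, equivalent to Lebesgue measure, with bounded
density. -/
structure IsBase (D : Set (X d)) (ρ : Measure (X d)) : Prop where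
  prob : IsProbabilityMeasure ρ
  le : ∃ C : ℝ≥0∞, C ≠ ∞ ∧ (Measure.pi fun _ : Fin 1 => ρ) ≤ C • lam D 1
  ac : ∀ k, lam D k ≪ Measure.pi fun _ : Fin k => ρ
  ac' : ∀ k, (Measure.pi fun _ : Fin k => ρ) ≪ lam D k

lemma exists_isBase (D : Set (X d)) (hDo : IsOpen D) (hDn : D.Nonempty) :
    ∃ ρ, IsBase D ρ := by
  obtain ⟨w, C, hw, hC, hw0, hwC, hp⟩ := exists_base D hDo hDn
  have hk := fun k => pi_withDensity (volume.restrict D) hw k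
  have hm : ∀ k, Measurable fun x : Fin k → X d => ∏ i, w (x i) := fun k =>
    Finset.measurable_prod _ fun i _ => hw.comp (measurable_pi_apply i)
  refine ⟨_, hp, ⟨C, hC, ?_⟩, fun k => ?_, fun k => ?_⟩
  · rw [hk, ← withDensity_const, lam_eq_pi]
    exact withDensity_mono (ae_of_all _ fun x => by simpa using hwC _)
  · rw [hk, lam_eq_pi]
    exact withDensity_absolutelyContinuous' (hm k).aemeasurable
      (ae_of_all _ fun x => Finset.prod_ne_zero_iff.2 fun i _ => (hw0 _).ne')
  · rw [hk, lam_eq_pi]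
    exact withDensity_absolutelyContinuous _ _

/-- Only null sets are at stake, and those of Lebesgue measure on D^k are those of the product of a
base measure, which selections do preserve. -/
lemma quasiMeasurePreserving_comp {D : Set (X d)} (hDo : IsOpen D) (hDn : D.Nonempty) {j k : ℕ}
    {e : Fin j → Fin k} (he : Function.Injective e) :
    Measure.QuasiMeasurePreserving (fun x : Fin k → X d => x ∘ e) (lam D k) (lam D j) := by
  obtain ⟨ρ, hρ⟩ := exists_isBase D hDo hDn
  have := hρ.prob
  exact ((measurePreserving_comp ρ he).quasiMeasurePreserving.mono_left (hρ.ac k)).mono_right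
    (hρ.ac' j)

/-- Families of kernels. -/
abbrev KerFam (d N : ℕ) : Type := (k : ℕ) → Kernel (Fin k → X d) (Fin k → U N)

/-- The family of measures given by a family of kernels. -/
noncomputable def KerFam.toFam (κ : KerFam d N) : MeasFamily d N := fun k x => κ k x

/-- A family of Markov kernels that is compatible with all selections of components. -/
structure IsRegular (D : Set (X d)) (κ : KerFam d N) : Prop where
  markov : ∀ k, IsMarkovKernel (κ k)
  marg : ∀ {j k : ℕ} (e : Fin j → Fin k), Function.Injective e →
    ∀ᵐ x ∂(lam D k), (κ k x).map (fun ξ => ξ ∘ e) = κ j (x ∘ e)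

lemma IsRegular.lintegral_comp {D : Set (X d)} {κ : KerFam d N} (h : IsRegular D κ) {j k : ℕ}
    {e : Fin j → Fin k} (he : Function.Injective e) :
    ∀ᵐ x ∂(lam D k), ∀ f : (Fin j → U N) → ℝ≥0∞, Measurable f →
      ∫⁻ ξ, f (ξ ∘ e) ∂(κ k x) = ∫⁻ ξ, f ξ ∂(κ j (x ∘ e)) := by
  filter_upwards [h.marg e he] with x hx f hf
  rw [← hx, lintegral_map hf (measurable_comp_right e)]

/-- This is tightness in the values. A union bound reduces to one component, compatibility reduces
that component to `κ 1`, and Markov's inequality together with the bounded density of ρ leaves the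
p-th moment. -/
lemma tail_bound {D : Set (X d)} {ρ : Measure (X d)} (hρ : IsBase D ρ) {κ : KerFam d N}
    (hκ : IsRegular D κ) {p : ℝ} (hp : 0 < p) {C A : ℝ≥0∞}
    (hρC : (Measure.pi fun _ : Fin 1 => ρ) ≤ C • lam D 1)
    (hA : ∫⁻ x, ∫⁻ ξ, ‖ξ 0‖ₑ ^ p ∂(κ 1 x) ∂(lam D 1) ≤ A) (k : ℕ) {r : ℝ} (hr : 0 < r) :
    ((Measure.pi fun _ : Fin k => ρ) ⊗ₘ κ k).snd {ξ | r < ‖ξ‖}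
      ≤ k * (C * A / ENNReal.ofReal r ^ p) := by
  have := hρ.prob
  have := hκ.markov
  have hBi : ∀ i : Fin k, MeasurableSet {ξ : Fin k → U N | r < ‖ξ i‖} := fun i =>
    measurableSet_lt measurable_const (measurable_pi_apply i).norm
  have hB : MeasurableSet {ξ : Fin 1 → U N | r < ‖ξ 0‖} :=
    measurableSet_lt measurable_const (measurable_pi_apply 0).norm
  have h1 : ∀ i : Fin k, ((Measure.pi fun _ : Fin k => ρ) ⊗ₘ κ k).snd {ξ | r < ‖ξ i‖}
      ≤ C * A / ENNReal.ofReal r ^ p := by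
    intro i
    have he : Function.Injective (fun _ : Fin 1 => i) := Function.injective_of_subsingleton _
    rw [Measure.snd_apply (hBi i), Measure.compProd_apply (measurable_snd (hBi i))]
    calc ∫⁻ x, κ k x (Prod.mk x ⁻¹' (Prod.snd ⁻¹' {ξ | r < ‖ξ i‖})) ∂(Measure.pi fun _ => ρ)
        = ∫⁻ x, κ 1 (x ∘ fun _ : Fin 1 => i) {ξ | r < ‖ξ 0‖} ∂(Measure.pi fun _ => ρ) := by
          refine lintegral_congr_ae ((hρ.ac' k).ae_le ?_)
          filter_upwards [hκ.marg _ he] with x hx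
          rw [← hx, Measure.map_apply (measurable_comp_right _) hB]
          rfl
      _ = ∫⁻ x, κ 1 x {ξ | r < ‖ξ 0‖} ∂(Measure.pi fun _ => ρ) :=
          (measurePreserving_comp ρ he).lintegral_comp (Kernel.measurable_coe _ hB)
      _ ≤ ∫⁻ x, (∫⁻ ξ, ‖ξ 0‖ₑ ^ p ∂(κ 1 x)) / ENNReal.ofReal r ^ p ∂(Measure.pi fun _ => ρ) := by
          refine lintegral_mono fun x => ?_
          have hr0 : ENNReal.ofReal r ^ p ≠ 0 := by simp [hr, not_lt.2 hp.le]
          have hrt : ENNReal.ofReal r ^ p ≠ ∞ := by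
            simp [hp.le]
          refine le_trans (measure_mono fun ξ hξ => ?_) (meas_ge_le_lintegral_div
            ((measurable_pi_apply 0).enorm.pow_const p).aemeasurable hr0 hrt)
          simp only [mem_ofPred_eq] at hξ ⊢
          gcongr
          rw [← ofReal_norm]
          exact ENNReal.ofReal_le_ofReal hξ.le
      _ ≤ ∫⁻ x, (∫⁻ ξ, ‖ξ 0‖ₑ ^ p ∂(κ 1 x)) / ENNReal.ofReal r ^ p ∂(C • lam D 1) := by
          exact lintegral_mono' hρC le_rfl
      _ ≤ C * A / ENNReal.ofReal r ^ p := by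
          rw [lintegral_smul_measure, smul_eq_mul, mul_div_assoc]
          gcongr
          simp only [div_eq_mul_inv]
          rw [lintegral_mul_const'' _ (Measurable.lintegral_kernel
            ((measurable_pi_apply 0).enorm.pow_const p)).aemeasurable]
          gcongr
  calc ((Measure.pi fun _ : Fin k => ρ) ⊗ₘ κ k).snd {ξ | r < ‖ξ‖}
      ≤ ((Measure.pi fun _ : Fin k => ρ) ⊗ₘ κ k).snd (⋃ i, {ξ | r < ‖ξ i‖}) := by
        refine measure_mono fun ξ hξ => ?_
        by_contra h
        simp only [mem_iUnion, mem_ofPred_eq, not_exists, not_lt] at h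
        exact absurd hξ (not_lt.2 ((pi_norm_le_iff_of_nonneg hr.le).2 h))
    _ ≤ ∑ i, ((Measure.pi fun _ : Fin k => ρ) ⊗ₘ κ k).snd {ξ | r < ‖ξ i‖} :=
        measure_iUnion_fintype_le _ _
    _ ≤ ∑ _i : Fin k, C * A / ENNReal.ofReal r ^ p := Finset.sum_le_sum fun i _ => h1 i
    _ = k * (C * A / ENNReal.ofReal r ^ p) := by simp

/-- Sequential compactness of families of kernels with uniformly bounded moments. -/
theorem exists_stable_subseq {D : Set (X d)} (hDo : IsOpen D) (hDn : D.Nonempty)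
    {κ : ℕ → KerFam d N} (hκ : ∀ n, IsRegular D (κ n)) {p : ℝ} (hp : 0 < p) {A : ℝ≥0∞}
    (hA : A ≠ ∞) (hκA : ∀ n, ∫⁻ x, ∫⁻ ξ, ‖ξ 0‖ₑ ^ p ∂(κ n 1 x) ∂(lam D 1) ≤ A) :
    ∃ (s : ℕ → ℕ) (κ₀ : KerFam d N), StrictMono s ∧ IsRegular D κ₀ ∧
      ∀ k, StableTendsto (lam D k) (fun j => κ (s j) k) (κ₀ k) := by
  obtain ⟨ρ, hρ⟩ := exists_isBase D hDo hDn
  obtain ⟨C, hC, hρC⟩ := hρ.le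
  have := hρ.prob
  have hmk := fun n => (hκ n).markov
  let ρk : (k : ℕ) → Measure (Fin k → X d) := fun k => Measure.pi fun _ => ρ
  let J : ℕ → (k : ℕ) → ProbabilityMeasure ((Fin k → X d) × (Fin k → U N)) := fun n k =>
    ⟨ρk k ⊗ₘ κ n k, inferInstance⟩
  have htight : ∀ k, IsTightMeasureSet {((μ : ProbabilityMeasure
      ((Fin k → X d) × (Fin k → U N))) : Measure ((Fin k → X d) × (Fin k → U N))) |
      μ ∈ range fun n => J n k} := by
    intro k
    refine IsTightMeasureSet.prodMk ?_ ?_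
    · refine IsTightMeasureSet.subset (T := {ρk k}) isTightMeasureSet_singleton ?_
      rintro _ ⟨_, ⟨_, ⟨n, rfl⟩, rfl⟩, rfl⟩
      simp [J]
    · refine isTightMeasureSet_of_tendsto_measure_norm_gt ?_
      have hlim : Tendsto (fun r : ℝ => (k : ℝ≥0∞) * (C * A / ENNReal.ofReal r ^ p)) atTop
          (𝓝 0) := by
        have h1 : Tendsto (fun r : ℝ => C * A / ENNReal.ofReal r ^ p) atTop (𝓝 0) := by
          have h2 : Tendsto (fun r : ℝ => ENNReal.ofReal r ^ p) atTop (𝓝 ∞) :=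
            (ENNReal.tendsto_rpow_at_top hp).comp ENNReal.tendsto_ofReal_atTop
          simpa using ENNReal.Tendsto.const_div h2 (.inr (ENNReal.mul_ne_top hC hA))
        simpa using ENNReal.Tendsto.const_mul h1 (.inr (ENNReal.natCast_ne_top k))
      refine tendsto_of_tendsto_of_tendsto_of_le_of_le' tendsto_const_nhds hlim
        (Eventually.of_forall fun _ => bot_le) ?_
      filter_upwards [eventually_gt_atTop 0] with r hr
      simp only [iSup_le_iff]
      rintro _ ⟨_, ⟨_, ⟨n, rfl⟩, rfl⟩, rfl⟩
      exact tail_bound hρ (hκ n) hp hρC (hκA n) k hr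
  -- A countable product of compact sets in metrizable spaces is sequentially compact, so one
  -- subsequence serves all k.
  have hcomp : IsCompact (Set.univ.pi fun k => closure (range fun n => J n k)) :=
    isCompact_univ_pi fun k => isCompact_closure_of_isTightMeasureSet (htight k)
  obtain ⟨J₀, -, s, hs, hlim⟩ := hcomp.isSeqCompact (x := J)
    fun n k _ => subset_closure ⟨n, rfl⟩
  have hlimk : ∀ k, Tendsto (fun j => J (s j) k) atTop (𝓝 (J₀ k)) := fun k =>
    (tendsto_pi_nhds.1 hlim) k
  have hfst : ∀ k, (J₀ k : Measure ((Fin k → X d) × (Fin k → U N))).fst = ρk k := by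
    intro k
    have h1 := ((ProbabilityMeasure.continuous_map
      (f := (Prod.fst : (Fin k → X d) × (Fin k → U N) → _)) continuous_fst).tendsto (J₀ k)).comp
      (hlimk k)
    have h2 : ∀ j, (J (s j) k).map (f := Prod.fst) continuous_fst.measurable.aemeasurable
        = ⟨ρk k, inferInstance⟩ := by
      intro j
      exact Subtype.ext (Measure.fst_compProd (ρk k) (κ (s j) k))
    simp only [Function.comp_def, h2] at h1
    exact (congrArg (fun μ : ProbabilityMeasure (Fin k → X d) => (μ : Measure (Fin k → X d)))
      (tendsto_nhds_unique tendsto_const_nhds h1)).symm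
  -- The first marginal of the limit is still ρ^k, so its conditional kernel over ρ^k is the limit
  -- kernel.
  let κ₀ : KerFam d N := fun k => (J₀ k : Measure ((Fin k → X d) × (Fin k → U N))).condKernel
  have hJ₀ : ∀ k, (J₀ k : Measure ((Fin k → X d) × (Fin k → U N))) = ρk k ⊗ₘ κ₀ k := by
    intro k
    rw [← hfst k]
    exact ((J₀ k : Measure ((Fin k → X d) × (Fin k → U N))).disintegrate (κ₀ k)).symm
  have hst : ∀ k, StableTendsto (ρk k) (fun j => κ (s j) k) (κ₀ k) := by
    intro k
    refine StableTendsto.of_weak fun F => ?_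
    have := ProbabilityMeasure.tendsto_iff_forall_integral_tendsto.1 (hlimk k) F
    rwa [hJ₀ k] at this
  refine ⟨s, κ₀, hs, ⟨fun k => inferInstance, fun {j k} e he => (hρ.ac k).ae_le ?_⟩,
    fun k => (hst k).of_absolutelyContinuous (hρ.ac k)⟩
  exact (hst k).map_eq_comap (hst j) (measurePreserving_comp ρ he).quasiMeasurePreserving
    (by fun_prop) fun n => (hρ.ac' k).ae_le ((hκ (s n)).marg e he)

/-! ### Test functions in L¹ with values in C₀ -/

section Bochner

variable {α Y : Type*} [MeasurableSpace α] [MetricSpace Y] [ProperSpace Y] [MeasurableSpace Y]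
  [BorelSpace Y]

lemma stronglyMeasurable_uncurry_zeroAtInfty {g : α → C₀(Y, ℝ)} (hg : StronglyMeasurable g) :
    StronglyMeasurable fun z : α × Y => g z.1 z.2 := by
  have h1 : StronglyMeasurable fun z : α × Y => ((g z.1).toBCF, z.2) :=
    ((ZeroAtInftyContinuousMap.isometry_toBCF.continuous.comp_stronglyMeasurable
      (hg.comp_measurable measurable_fst))).prodMk measurable_snd.stronglyMeasurable
  exact (continuous_eval (F := Y →ᵇ ℝ)).comp_stronglyMeasurable h1

lemma aestronglyMeasurable_integral_zeroAtInfty {μ : Measure α} {g : α → C₀(Y, ℝ)}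
    (hg : AEStronglyMeasurable g μ) (κ : Kernel α Y) [IsMarkovKernel κ] :
    AEStronglyMeasurable (fun x => ∫ y, g x y ∂(κ x)) μ := by
  refine ⟨fun x => ∫ y, hg.mk g x y ∂(κ x), ?_, ?_⟩
  · exact (stronglyMeasurable_uncurry_zeroAtInfty hg.stronglyMeasurable_mk).integral_kernel_prod_right'
  · filter_upwards [hg.ae_eq_mk] with x hx
    rw [← hx]

lemma abs_integral_zeroAtInfty_le (m : Measure Y) [IsProbabilityMeasure m] (f : C₀(Y, ℝ)) :
    |∫ y, f y ∂m| ≤ ‖f‖ := by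
  simpa using BoundedContinuousFunction.norm_integral_le_norm m f.toBCF

lemma integrable_zeroAtInfty (m : Measure Y) [IsFiniteMeasure m] (f : C₀(Y, ℝ)) :
    Integrable (fun y => f y) m := f.toBCF.integrable m

lemma integrable_integral_zeroAtInfty {μ : Measure α} {g : α → C₀(Y, ℝ)}
    (hg : Integrable g μ) (κ : Kernel α Y) [IsMarkovKernel κ] :
    Integrable (fun x => ∫ y, g x y ∂(κ x)) μ :=
  hg.norm.mono' (aestronglyMeasurable_integral_zeroAtInfty hg.1 κ)
    (ae_of_all _ fun x => abs_integral_zeroAtInfty_le (κ x) (g x))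

/-- Stable convergence implies convergence against all Bochner integrable functions with values
in the space of continuous functions vanishing at infinity. -/
theorem StableTendsto.tendsto_zeroAtInfty {μ : Measure α} {κ : ℕ → Kernel α Y} {κ₀ : Kernel α Y}
    [∀ n, IsMarkovKernel (κ n)] [IsMarkovKernel κ₀] (h : StableTendsto μ κ κ₀)
    {g : α → C₀(Y, ℝ)} (hg : Integrable g μ) :
    Tendsto (fun n => ∫ x, ∫ y, g x y ∂(κ n x) ∂μ) atTop (𝓝 (∫ x, ∫ y, g x y ∂(κ₀ x) ∂μ)) := by
  refine hg.induction (P := fun g : α → C₀(Y, ℝ) => Tendsto (fun n => ∫ x, ∫ y, g x y ∂(κ n x) ∂μ) atTop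
    (𝓝 (∫ x, ∫ y, g x y ∂(κ₀ x) ∂μ))) ?_ ?_ ?_ ?_
  · intro c s hs hμs
    have e : ∀ ζ : Kernel α Y, ∫ x, ∫ y, (s.indicator (fun _ => c) x : C₀(Y, ℝ)) y ∂(ζ x) ∂μ
        = ∫ x, s.indicator (fun _ => (1 : ℝ)) x * ∫ y, c.toBCF y ∂(ζ x) ∂μ := by
      intro ζ
      refine integral_congr_ae (ae_of_all _ fun x => ?_)
      by_cases hx : x ∈ s <;> simp [hx]
    simp only [e]
    exact h _ ((integrable_indicator_iff hs).2 (integrableOn_const hμs.ne)) _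
  · intro f g _ hf hg hPf hPg
    have e : ∀ (ζ : Kernel α Y) [IsMarkovKernel ζ], ∫ x, ∫ y, (f + g) x y ∂(ζ x) ∂μ
        = ∫ x, ∫ y, f x y ∂(ζ x) ∂μ + ∫ x, ∫ y, g x y ∂(ζ x) ∂μ := by
      intro ζ _
      rw [← integral_add (integrable_integral_zeroAtInfty hf ζ)
        (integrable_integral_zeroAtInfty hg ζ)]
      refine integral_congr_ae (ae_of_all _ fun x => ?_)
      exact integral_add (integrable_zeroAtInfty _ (f x)) (integrable_zeroAtInfty _ (g x))
    simp only [e]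
    exact hPf.add hPg
  -- For every Markov kernel the pairing is 1-Lipschitz in g for the L¹ norm, so the class of
  -- admissible g is closed.
  · refine isClosed_of_closure_subset fun f hf => ?_
    refine tendsto_of_forall_approx fun ε hε => ?_
    obtain ⟨g, hgP, hfg⟩ := Metric.mem_closure_iff.1 hf ε hε
    have hb : ∀ (ζ : Kernel α Y) [IsMarkovKernel ζ],
        |∫ x, ∫ y, f x y ∂(ζ x) ∂μ - ∫ x, ∫ y, g x y ∂(ζ x) ∂μ| ≤ ε := by
      intro ζ _
      have hfi := L1.integrable_coeFn f
      have hgi := L1.integrable_coeFn g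
      rw [← integral_sub (integrable_integral_zeroAtInfty hfi ζ)
        (integrable_integral_zeroAtInfty hgi ζ)]
      refine (norm_integral_le_integral_norm (fun x => ∫ y, f x y ∂(ζ x) - ∫ y, g x y ∂(ζ x))).trans ?_
      calc ∫ x, ‖∫ y, f x y ∂(ζ x) - ∫ y, g x y ∂(ζ x)‖ ∂μ ≤ ∫ x, ‖f x - g x‖ ∂μ := by
            refine integral_mono ((integrable_integral_zeroAtInfty hfi ζ).sub
              (integrable_integral_zeroAtInfty hgi ζ)).norm (hfi.sub hgi).norm fun x => ?_
            rw [← integral_sub (integrable_zeroAtInfty _ (f x)) (integrable_zeroAtInfty _ (g x))]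
            exact abs_integral_zeroAtInfty_le (ζ x) (f x - g x)
        _ = dist f g := by rw [L1.dist_eq_integral_dist]; simp only [dist_eq_norm]
        _ ≤ ε := hfg.le
    exact ⟨_, _, Eventually.of_forall fun n => hb (κ n), hb κ₀, hgP⟩
  · intro f g hfg _ hP
    have e : ∀ ζ : Kernel α Y, ∫ x, ∫ y, f x y ∂(ζ x) ∂μ = ∫ x, ∫ y, g x y ∂(ζ x) ∂μ := by
      intro ζ
      refine integral_congr_ae ?_
      filter_upwards [hfg] with x hx
      rw [hx]
    simpa only [e] using hP

end Bochner

/-! ### Correlation measures as compatible kernel families -/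

section Regular

variable {D : Set (X d)} {κ : KerFam d N}

/-- Symmetry gives the compatibility for permutations and consistency gives it for initial segments.
Every injection of indices is an initial segment followed by a permutation. -/
lemma IsCorrelationMeasure.exists_regular {p : ℝ} (hDo : IsOpen D) (hDn : D.Nonempty)
    {ν : MeasFamily d N} (hν : IsCorrelationMeasure p D ν) :
    ∃ κ : KerFam d N, IsRegular D κ ∧ ∀ k, ∀ᵐ x ∂(lam D k), κ k x = ν k x := by
  choose κ hκ hκν using fun k => exists_markovKernel_ae_eq (hν.prob k) (hν.meas k)
  have hperm : ∀ k (σ : Equiv.Perm (Fin k)),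
      ∀ᵐ x ∂(lam D k), (κ k x).map (fun ξ => ξ ∘ σ) = κ k (x ∘ σ) := by
    intro k σ
    have hq := quasiMeasurePreserving_comp (D := D) hDo hDn σ.injective
    have hm : Measurable fun ξ : Fin k → U N => ξ ∘ σ := measurable_comp_right σ
    have := Kernel.IsMarkovKernel.map (κ k) hm
    have key := kernel_ae_eq_of_ae_integral_eq (μ := lam D k) (κ := (κ k).map fun ξ => ξ ∘ σ)
      (η := (κ k).comap _ hq.measurable) fun f => by
        filter_upwards [hν.symm k σ f, hκν k, hq.ae (hκν k)] with x h1 h2 h3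
        rw [Kernel.map_apply _ hm, Kernel.comap_apply, h3, h2]
        exact (integral_map hm.aemeasurable f.continuous.aestronglyMeasurable).trans h1.symm
    filter_upwards [key] with x hx
    rwa [Kernel.map_apply _ hm, Kernel.comap_apply] at hx
  have hsucc : ∀ k, ∀ᵐ x ∂(lam D (k + 1)),
      (κ (k + 1) x).map (fun ξ => ξ ∘ Fin.castSucc) = κ k (x ∘ Fin.castSucc) := by
    intro k
    have hq := quasiMeasurePreserving_comp (D := D) hDo hDn (Fin.castSucc_injective k)
    have hm : Measurable fun ξ : Fin (k + 1) → U N => ξ ∘ Fin.castSucc := measurable_comp_right _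
    have := Kernel.IsMarkovKernel.map (κ (k + 1)) hm
    have key := kernel_ae_eq_of_ae_integral_eq (μ := lam D (k + 1))
      (κ := (κ (k + 1)).map fun ξ => ξ ∘ Fin.castSucc)
      (η := (κ k).comap _ hq.measurable) fun f => by
        filter_upwards [hν.consistent k f, hκν (k + 1), hq.ae (hκν k)] with x h1 h2 h3
        rw [Kernel.map_apply _ hm, Kernel.comap_apply, h3, h2]
        exact (integral_map hm.aemeasurable f.continuous.aestronglyMeasurable).trans h1
    filter_upwards [key] with x hx
    rwa [Kernel.map_apply _ hm, Kernel.comap_apply] at hx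
  have hcast : ∀ j k (h : j ≤ k), ∀ᵐ x ∂(lam D k),
      (κ k x).map (fun ξ => ξ ∘ Fin.castLE h) = κ j (x ∘ Fin.castLE h) := by
    intro j k h
    induction k, h using Nat.le_induction with
    | base =>
      refine ae_of_all _ fun x => ?_
      simp
    | succ k h ih =>
      have hq := quasiMeasurePreserving_comp (D := D) hDo hDn (Fin.castSucc_injective k)
      filter_upwards [hsucc k, hq.ae ih] with x h1 h2
      have e : (Fin.castLE (Nat.le_succ_of_le h) : Fin j → Fin (k + 1))
          = Fin.castSucc ∘ Fin.castLE h := funext fun _ => rfl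
      change (κ (k + 1) x).map (fun ξ => ξ ∘ (Fin.castLE (Nat.le_succ_of_le h))) =
        κ j (x ∘ (Fin.castLE (Nat.le_succ_of_le h)))
      rw [e, ← Function.comp_assoc, ← h2, ← h1,
        Measure.map_map (measurable_comp_right _) (measurable_comp_right _)]
      rfl
  refine ⟨κ, ⟨hκ, fun {j k} e he => ?_⟩, hκν⟩
  have hjk : j ≤ k := by simpa using Fintype.card_le_of_injective e he
  -- A permutation σ that carries the standard inclusion of the first j indices to e.
  obtain ⟨σ, hσ⟩ := Equiv.Perm.exists_extending_pair (Fin.castLE hjk) e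
    (Fin.castLE_injective hjk) he
  have he' : e = σ ∘ Fin.castLE hjk := funext fun a => (hσ a).symm
  have hq := quasiMeasurePreserving_comp (D := D) hDo hDn σ.injective
  filter_upwards [hperm k σ, hq.ae (hcast j k hjk)] with x h1 h2
  rw [he', ← Function.comp_assoc, ← h2, ← h1,
    Measure.map_map (measurable_comp_right _) (measurable_comp_right _)]
  rfl

lemma IsRegular.isCorrelationMeasure {p : ℝ} (h : IsRegular D κ)
    (hi : lpairing D κ.toFam (k := 1) (fun _ ξ => ‖ξ 0‖ₑ ^ p) < ∞)
    (hd : Tendsto (fun r => modCont p D r κ.toFam) (𝓝[>] 0) (𝓝 0)) :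
    IsCorrelationMeasure p D κ.toFam where
  prob k := ae_of_all _ fun x => (h.markov k).isProbabilityMeasure x
  meas k f := (measurable_integral_bcf (κ k) f).aemeasurable
  symm k σ f := by
    filter_upwards [h.marg σ σ.injective] with x hx
    change ∫ ξ, f ξ ∂(κ k (x ∘ σ)) = ∫ ξ, f (ξ ∘ σ) ∂(κ k x)
    rw [← hx]
    exact integral_map (measurable_comp_right _).aemeasurable f.continuous.aestronglyMeasurable
  consistent k f := by
    filter_upwards [h.marg Fin.castSucc (Fin.castSucc_injective k)] with x hx
    change ∫ ξ, f (ξ ∘ Fin.castSucc) ∂(κ (k + 1) x) = ∫ ξ, f ξ ∂(κ k (x ∘ Fin.castSucc))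
    rw [← hx]
    exact (integral_map (measurable_comp_right _).aemeasurable
      f.continuous.aestronglyMeasurable).symm
  integrable := hi
  diagCont := hd

end Regular

section Congr

variable {D : Set (X d)} {ν ν' : MeasFamily d N}

lemma lpairing_congr {k : ℕ} (h : ∀ᵐ x ∂(lam D k), ν k x = ν' k x)
    (g : (Fin k → X d) → (Fin k → U N) → ℝ≥0∞) : lpairing D ν g = lpairing D ν' g := by
  refine lintegral_congr_ae ?_
  filter_upwards [h] with x hx
  rw [hx]

lemma pairing_congr {k : ℕ} (h : ∀ᵐ x ∂(lam D k), ν k x = ν' k x)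
    (g : (Fin k → X d) → (Fin k → U N) → ℝ) : pairing D ν g = pairing D ν' g := by
  refine integral_congr_ae ?_
  filter_upwards [h] with x hx
  rw [hx]

lemma measurePreserving_vecTwo (D : Set (X d)) :
    MeasurePreserving (fun z : X d × X d => ![z.1, z.2])
      ((volume.restrict D).prod (volume.restrict D)) (lam D 2) := by
  have := (measurePreserving_finTwoArrow (volume.restrict D)).symm
  rw [lam_eq_pi]
  exact this

lemma ae_ae_of_ae_two {P : (Fin 2 → X d) → Prop} (h : ∀ᵐ x ∂(lam D 2), P x) :
    ∀ᵐ x ∂(volume.restrict D), ∀ᵐ y ∂(volume.restrict D), P ![x, y] :=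
  Measure.ae_ae_of_ae_prod ((measurePreserving_vecTwo D).quasiMeasurePreserving.ae h)

lemma modCont_congr {p : ℝ} (h : ∀ᵐ x ∂(lam D 2), ν 2 x = ν' 2 x) (r : ℝ) :
    modCont p D r ν = modCont p D r ν' := by
  refine lintegral_congr_ae ?_
  filter_upwards [ae_ae_of_ae_two h] with x hx
  rw [setLAverage_eq, setLAverage_eq]
  congr 1
  refine lintegral_congr_ae ?_
  filter_upwards [ae_mono (Measure.restrict_mono inter_subset_right le_rfl) hx] with y hy
  rw [hy]

lemma supportBound_congr {p M : ℝ} (h : ∀ k, ∀ᵐ x ∂(lam D k), ν k x = ν' k x) :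
    SupportBound p D M ν ↔ SupportBound p D M ν' := by
  unfold SupportBound
  simp only [lpairing_congr (h _)]

lemma IsDual.congr {p : ℝ} [Fact (1 ≤ p)] {μ : Measure (LpSpace N p D)}
    (hμ : IsDual p D ν μ) (h : ∀ k, ∀ᵐ x ∂(lam D k), ν k x = ν' k x) : IsDual p D ν' μ where
  prob := hμ.prob
  moment := hμ.moment
  dual k g hg := by rw [← pairing_congr (h k), hμ.dual k g hg]

end Congr

/-! ### The modulus of continuity and lower semicontinuity in the limit -/

/-- The kernel of the averaging operator over balls in `D`. -/
noncomputable def ballKer (D : Set (X d)) (r : ℝ) (x y : X d) : ℝ≥0∞ :=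
  (Metric.ball x r).indicator (fun _ => (volume (Metric.ball x r ∩ D))⁻¹) y

lemma measurable_volume_ball {D : Set (X d)} (hD : MeasurableSet D) (r : ℝ) :
    Measurable fun x => volume (Metric.ball x r ∩ D) := by
  have hs : MeasurableSet {z : X d × X d | dist z.2 z.1 < r ∧ z.2 ∈ D} :=
    (measurableSet_lt (measurable_snd.dist measurable_fst) measurable_const).inter
      (measurable_snd hD)
  exact measurable_measure_prodMk_left hs

lemma measurable_ballKer {D : Set (X d)} (hD : MeasurableSet D) (r : ℝ) :
    Measurable fun z : X d × X d => ballKer D r z.1 z.2 := by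
  have hs : MeasurableSet {z : X d × X d | dist z.2 z.1 < r} :=
    measurableSet_lt (measurable_snd.dist measurable_fst) measurable_const
  exact (((measurable_volume_ball hD r).inv).comp measurable_fst).indicator hs

lemma lintegral_ballKer_mul {D : Set (X d)} (r : ℝ) (x : X d)
    {f : X d → ℝ≥0∞} (hf : AEMeasurable f (volume.restrict D)) :
    ∫⁻ y in D, ballKer D r x y * f y = ⨍⁻ y in Metric.ball x r ∩ D, f y ∂volume := by
  rw [setLAverage_eq, ENNReal.div_eq_inv_mul, ← lintegral_const_mul'' _
    (hf.mono_measure (Measure.restrict_mono inter_subset_right le_rfl)),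
    ← Measure.restrict_restrict Metric.isOpen_ball.measurableSet,
    ← lintegral_indicator Metric.isOpen_ball.measurableSet]
  refine lintegral_congr fun y => ?_
  by_cases hy : y ∈ Metric.ball x r <;> simp only [ballKer, hy, indicator_of_mem,
    indicator_of_notMem, not_false_eq_true, zero_mul]

lemma measurable_diff_rpow (p : ℝ) {k : ℕ} (i j : Fin k) :
    Measurable fun ξ : Fin k → U N => ‖ξ i - ξ j‖ₑ ^ p :=
  ((measurable_pi_apply i).sub (measurable_pi_apply j)).enorm.pow_const p

lemma lintegral_lam_two (D : Set (X d)) {F : (Fin 2 → X d) → ℝ≥0∞} (hF : Measurable F) :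
    ∫⁻ z, F z ∂(lam D 2) = ∫⁻ x in D, ∫⁻ y in D, F ![x, y] := by
  have hv := (measurePreserving_vecTwo D).measurable
  rw [← (measurePreserving_vecTwo D).lintegral_comp hF]
  exact lintegral_prod _ (hF.comp hv).aemeasurable

lemma measurable_lintegral_diff (p : ℝ) (κ : KerFam d N) [IsMarkovKernel (κ 2)] :
    Measurable fun z => ∫⁻ ξ, ‖ξ 0 - ξ 1‖ₑ ^ p ∂(κ 2 z) :=
  Measurable.lintegral_kernel (measurable_diff_rpow p 0 1)

lemma modCont_eq_iterated (p : ℝ) (D : Set (X d)) (κ : KerFam d N)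
    (r : ℝ) [IsMarkovKernel (κ 2)] :
    modCont p D r κ.toFam = ∫⁻ x in D, ∫⁻ y in D, ballKer D r x y *
      ∫⁻ ξ, ‖ξ 0 - ξ 1‖ₑ ^ p ∂(κ 2 ![x, y]) := by
  refine lintegral_congr fun x => ?_
  have hv := (measurePreserving_vecTwo D).measurable
  have hg : Measurable fun y => ∫⁻ ξ, ‖ξ 0 - ξ 1‖ₑ ^ p ∂(κ 2 ![x, y]) :=
    (measurable_lintegral_diff p κ).comp (hv.comp measurable_prodMk_left)
  exact (lintegral_ballKer_mul r x hg.aemeasurable).symm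

lemma measurable_ballKer_two {D : Set (X d)} (hD : MeasurableSet D) (r : ℝ) :
    Measurable fun z : Fin 2 → X d => ballKer D r (z 0) (z 1) :=
  Measurable.comp (g := fun z : X d × X d => ballKer D r z.1 z.2)
    (f := fun z : Fin 2 → X d => (z 0, z 1)) (measurable_ballKer hD r)
    ((measurable_pi_apply (X := fun _ : Fin 2 => X d) 0).prodMk (measurable_pi_apply 1))

/-- In this form ω_r is the pairing of ν² with a product of a weight in (x, y) and a continuous
function of the values, so it falls under the general lower semicontinuity of product observables.
-/
lemma modCont_eq_lintegral (p : ℝ) {D : Set (X d)} (hD : MeasurableSet D) (κ : KerFam d N)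
    (r : ℝ) [IsMarkovKernel (κ 2)] :
    modCont p D r κ.toFam = ∫⁻ z, ballKer D r (z 0) (z 1) *
      ∫⁻ ξ, ‖ξ 0 - ξ 1‖ₑ ^ p ∂(κ 2 z) ∂(lam D 2) := by
  rw [modCont_eq_iterated]
  exact (lintegral_lam_two D
    ((measurable_ballKer_two hD r).mul (measurable_lintegral_diff p κ))).symm

section Limit

variable {D : Set (X d)} {κ : ℕ → KerFam d N} {κ₀ : KerFam d N} {p : ℝ}

lemma lpairing_product_le_liminf (hD : MeasurableSet D) (hκ : ∀ n, IsRegular D (κ n))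
    (hκ₀ : IsRegular D κ₀) {k : ℕ} (h : StableTendsto (lam D k) (fun n => κ n k) (κ₀ k))
    {φ : (Fin k → X d) → ℝ} {f : (Fin k → U N) → ℝ} (hφ : AEMeasurable φ (lam D k))
    (hφ0 : ∀ x ∈ prodDom D k, 0 ≤ φ x) (hf : Continuous f) (hf0 : ∀ ξ, 0 ≤ f ξ) :
    lpairing D κ₀.toFam (fun x ξ => ENNReal.ofReal (φ x * f ξ)) ≤
      liminf (fun n => lpairing D (κ n).toFam fun x ξ => ENNReal.ofReal (φ x * f ξ)) atTop := by
  have := fun n => (hκ n).markov k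
  have := hκ₀.markov k
  have e : ∀ ζ : KerFam d N, lpairing D ζ.toFam (fun x ξ => ENNReal.ofReal (φ x * f ξ))
      = ∫⁻ x, ENNReal.ofReal (φ x) * ∫⁻ ξ, ENNReal.ofReal (f ξ) ∂(ζ k x) ∂(lam D k) := by
    intro ζ
    refine setLIntegral_congr_fun (measurableSet_prodDom hD k) fun x hx => ?_
    simp only [ENNReal.ofReal_mul (hφ0 x hx)]
    exact lintegral_const_mul _ hf.measurable.ennreal_ofReal
  simp only [e]
  exact h.lintegral_le_liminf hφ.ennreal_ofReal hf hf0

lemma ofReal_norm_rpow {E : Type*} [SeminormedAddCommGroup E] (v : E) {p : ℝ} (hp : 0 ≤ p) :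
    ENNReal.ofReal (‖v‖ ^ p) = ‖v‖ₑ ^ p := by
  rw [← ENNReal.ofReal_rpow_of_nonneg (norm_nonneg _) hp, ofReal_norm]

lemma modCont_le_liminf (hD : MeasurableSet D) (hp : 0 ≤ p) (hκ : ∀ n, IsRegular D (κ n))
    (hκ₀ : IsRegular D κ₀) (h : StableTendsto (lam D 2) (fun n => κ n 2) (κ₀ 2)) (r : ℝ) :
    modCont p D r κ₀.toFam ≤ liminf (fun n => modCont p D r (κ n).toFam) atTop := by
  have := fun n => (hκ n).markov 2
  have := hκ₀.markov 2
  have := h.lintegral_le_liminf (φ := fun z => ballKer D r (z 0) (z 1))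
    (measurable_ballKer_two hD r).aemeasurable (f := fun ξ => ‖ξ 0 - ξ 1‖ ^ p)
    (((continuous_apply 0).sub (continuous_apply 1)).norm.rpow_const fun _ => .inr hp)
    fun ξ => by positivity
  simp only [ofReal_norm_rpow _ hp] at this
  simpa only [modCont_eq_lintegral p hD] using this

lemma lpairing_prod_le_liminf (hp : 0 ≤ p) (hκ : ∀ n, IsRegular D (κ n))
    (hκ₀ : IsRegular D κ₀) {k : ℕ} (h : StableTendsto (lam D k) (fun n => κ n k) (κ₀ k)) :
    lpairing D κ₀.toFam (k := k) (fun _ ξ => ∏ i, ‖ξ i‖ₑ ^ p) ≤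
      liminf (fun n => lpairing D (κ n).toFam (k := k) fun _ ξ => ∏ i, ‖ξ i‖ₑ ^ p) atTop := by
  have := fun n => (hκ n).markov k
  have := hκ₀.markov k
  have := h.lintegral_le_liminf (φ := fun z => 1) aemeasurable_const
    (f := fun ξ => ∏ i, ‖ξ i‖ ^ p)
    (continuous_finsetProd _ fun i _ => (continuous_apply i).norm.rpow_const fun _ => .inr hp)
    fun ξ => by positivity
  have e : ∀ ξ : Fin k → U N, ENNReal.ofReal (∏ i, ‖ξ i‖ ^ p) = ∏ i, ‖ξ i‖ₑ ^ p := fun ξ => by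
    rw [ENNReal.ofReal_prod_of_nonneg fun i _ => by positivity]
    simp only [ofReal_norm_rpow _ hp]
  simp only [e, one_mul] at this
  exact this

lemma lpairing_norm_le_of_stable (hp : 0 ≤ p) (hκ : ∀ n, IsRegular D (κ n))
    (hκ₀ : IsRegular D κ₀) (h : StableTendsto (lam D 1) (fun n => κ n 1) (κ₀ 1)) {C : ℝ≥0∞}
    (hC : ∀ n, lpairing D (κ n).toFam (k := 1) (fun _ ξ => ‖ξ 0‖ₑ ^ p) ≤ C) :
    lpairing D κ₀.toFam (k := 1) (fun _ ξ => ‖ξ 0‖ₑ ^ p) ≤ C := by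
  have := lpairing_prod_le_liminf hp hκ hκ₀ h
  simp only [Finset.univ_unique, Fin.default_eq_zero, Fin.isValue, Finset.prod_singleton] at this
  exact this.trans (liminf_le_of_le (by isBoundedDefault) fun b hb => by
    obtain ⟨n, hn⟩ := hb.exists
    exact hn.trans (hC n))

lemma tendsto_modCont_of_stable (hD : MeasurableSet D) (hp : 0 ≤ p)
    (hκ : ∀ n, IsRegular D (κ n))
    (hκ₀ : IsRegular D κ₀) (h : StableTendsto (lam D 2) (fun n => κ n 2) (κ₀ 2))
    (hdc : Tendsto (fun r => limsup (fun n => modCont p D r (κ n).toFam) atTop) (𝓝[>] 0) (𝓝 0)) :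
    Tendsto (fun r => modCont p D r κ₀.toFam) (𝓝[>] 0) (𝓝 0) :=
  tendsto_of_tendsto_of_tendsto_of_le_of_le tendsto_const_nhds hdc (fun _ => bot_le) fun r =>
    (modCont_le_liminf hD hp hκ hκ₀ h r).trans (liminf_le_limsup (by isBoundedDefault)
      (by isBoundedDefault))

end Limit

/-! ### Cauchy–Schwarz inequality for exchangeable sequences -/

section Exchangeable

variable {Y : Type*} [MeasurableSpace Y]

/-- The finite-dimensional distributions of an exchangeable sequence. -/
structure IsExchangeable (m : (k : ℕ) → Measure (Fin k → Y)) : Prop where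
  prob : ∀ k, IsProbabilityMeasure (m k)
  map_comp : ∀ {j k : ℕ} (e : Fin j → Fin k), Function.Injective e →
    (m k).map (fun ξ => ξ ∘ e) = m j

variable {m : (k : ℕ) → Measure (Fin k → Y)}

lemma IsExchangeable.lintegral_comp (hm : IsExchangeable m) {j k : ℕ} {e : Fin j → Fin k}
    (he : Function.Injective e) {f : (Fin j → Y) → ℝ≥0∞} (hf : Measurable f) :
    ∫⁻ ξ, f (ξ ∘ e) ∂(m k) = ∫⁻ ξ, f ξ ∂(m j) := by
  rw [← hm.map_comp e he, lintegral_map hf (measurable_comp_right e)]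

lemma IsExchangeable.integral_comp (hm : IsExchangeable m) {j k : ℕ} {e : Fin j → Fin k}
    (he : Function.Injective e) {f : (Fin j → Y) → ℝ} (hf : Measurable f) :
    ∫ ξ, f (ξ ∘ e) ∂(m k) = ∫ ξ, f ξ ∂(m j) := by
  rw [← hm.map_comp e he]
  exact (integral_map (measurable_comp_right e).aemeasurable hf.aestronglyMeasurable).symm

/-- Mixed moments of an exchangeable sequence. -/
noncomputable def mixedMoment (m : (k : ℕ) → Measure (Fin k → Y)) (a b : Y → ℝ≥0) (j : ℕ) :
    ℝ≥0∞ := ∫⁻ ξ, a (ξ 0) * ∏ l : Fin j, (b (ξ l.succ) : ℝ≥0∞) ∂(m (j + 1))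

lemma measurable_prod_coord {a b : Y → ℝ} (ha : Measurable a) (hb : Measurable b) (j : ℕ) :
    Measurable fun ξ : Fin (j + 1) → Y => a (ξ 0) * ∏ l : Fin j, b (ξ l.succ) :=
  (ha.comp (measurable_pi_apply 0)).mul
    (Finset.measurable_prod _ fun _ _ => hb.comp (measurable_pi_apply _))

lemma measurable_prod_coord' {a b : Y → ℝ≥0} (ha : Measurable a) (hb : Measurable b) (j : ℕ) :
    Measurable fun ξ : Fin (j + 1) → Y =>
      (a (ξ 0) : ℝ≥0∞) * ∏ l : Fin j, (b (ξ l.succ) : ℝ≥0∞) :=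
  (ha.coe_nnreal_ennreal.comp (measurable_pi_apply 0)).mul
    (Finset.measurable_prod _ fun _ _ => hb.coe_nnreal_ennreal.comp (measurable_pi_apply _))

/-- By de Finetti the claim would be Cauchy–Schwarz for A and B^j, where A and B are the conditional
means of a and b. The representation is avoided by replacing B^j with the mean of n products over
disjoint blocks of coordinates. The error is the diagonal of a double sum, which is of order 1/n. -/
lemma IsExchangeable.sq_integral_le (hm : IsExchangeable m) {a b : Y → ℝ} (ha : Measurable a)
    (hb : Measurable b) {A B : ℝ} (ha0 : ∀ y, 0 ≤ a y) (haA : ∀ y, a y ≤ A)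
    (hb0 : ∀ y, 0 ≤ b y) (hbB : ∀ y, b y ≤ B) (j : ℕ) :
    (∫ ξ, a (ξ 0) * ∏ l : Fin j, b (ξ l.succ) ∂(m (j + 1))) ^ 2 ≤
      (∫ ξ, a (ξ 0) ∂(m 1)) *
        ∫ ξ, a (ξ 0) * ∏ l : Fin (j + j), b (ξ l.succ) ∂(m (j + j + 1)) := by
  have := hm.prob
  set β : ℕ → ℝ := fun j => ∫ ξ, a (ξ 0) * ∏ l : Fin j, b (ξ l.succ) ∂(m (j + 1)) with hβ
  have hA0 : 0 ≤ A := by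
    obtain ⟨ξ⟩ : Nonempty (Fin 1 → Y) := (m 1).nonempty_of_neZero
    exact (ha0 (ξ 0)).trans (haA _)
  have hB0 : 0 ≤ B := by
    obtain ⟨ξ⟩ : Nonempty (Fin 1 → Y) := (m 1).nonempty_of_neZero
    exact (hb0 (ξ 0)).trans (hbB _)
  have hβ0 : 0 ≤ ∫ ξ, a (ξ 0) ∂(m 1) := integral_nonneg fun ξ => ha0 _
  have key : ∀ n : ℕ, 0 < n → β j ^ 2 ≤ (∫ ξ, a (ξ 0) ∂(m 1)) *
      (A * (B ^ j * B ^ j) * (n : ℝ)⁻¹ + β (j + j)) := by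
    intro n hn
    -- Coordinate 0 carries a; the other coordinates form n disjoint blocks of length j.
    let K := n * j + 1
    let idx : Fin n → Fin j → Fin K := fun i l => (finProdFinEquiv (i, l)).succ
    have hidx : ∀ i i' l l', idx i l = idx i' l' → i = i' ∧ l = l' := by
      intro i i' l l' h
      simpa [idx] using h
    have hidx0 : ∀ i l, idx i l ≠ 0 := fun i l => Fin.succ_ne_zero _
    let P : Fin n → (Fin K → Y) → ℝ := fun i ξ => ∏ l, b (ξ (idx i l))
    have hPm : ∀ i, Measurable (P i) := fun i =>
      Finset.measurable_prod _ fun l _ => hb.comp (measurable_pi_apply _)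
    have hP0 : ∀ i ξ, 0 ≤ P i ξ := fun i ξ => Finset.prod_nonneg fun l _ => hb0 _
    have hPB : ∀ i ξ, P i ξ ≤ B ^ j := fun i ξ => by
      simpa using Finset.prod_le_prod (s := Finset.univ) (fun l _ => hb0 (ξ (idx i l)))
        fun l _ => hbB (ξ (idx i l))
    have ham : Measurable fun ξ : Fin K → Y => a (ξ 0) := ha.comp (measurable_pi_apply 0)
    have hint : ∀ f : (Fin K → Y) → ℝ, Measurable f → (∃ C, ∀ ξ, |f ξ| ≤ C) →
        Integrable f (m K) := fun f hf ⟨C, hC⟩ =>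
      Integrable.of_bound hf.aestronglyMeasurable C (ae_of_all _ hC)
    have hia : Integrable (fun ξ : Fin K → Y => a (ξ 0)) (m K) :=
      hint _ ham ⟨A, fun ξ => by rw [abs_of_nonneg (ha0 _)]; exact haA _⟩
    have hiP : ∀ i, Integrable (fun ξ => a (ξ 0) * P i ξ) (m K) := fun i =>
      hint _ (ham.mul (hPm i)) ⟨A * B ^ j, fun ξ => by
        rw [abs_of_nonneg (mul_nonneg (ha0 _) (hP0 _ _))]
        exact mul_le_mul (haA _) (hPB _ _) (hP0 _ _) hA0⟩
    have hbPP : ∀ i i' ξ, a (ξ 0) * (P i ξ * P i' ξ) ≤ A * (B ^ j * B ^ j) := fun i i' ξ => by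
      have h1 := mul_le_mul (hPB i ξ) (hPB i' ξ) (hP0 _ _) (by positivity)
      exact mul_le_mul (haA _) h1 (mul_nonneg (hP0 _ _) (hP0 _ _)) hA0
    have hiPP : ∀ i i', Integrable (fun ξ => a (ξ 0) * (P i ξ * P i' ξ)) (m K) := fun i i' =>
      hint _ (ham.mul ((hPm i).mul (hPm i'))) ⟨A * (B ^ j * B ^ j), fun ξ => by
        rw [abs_of_nonneg (mul_nonneg (ha0 _) (mul_nonneg (hP0 _ _) (hP0 _ _)))]
        exact hbPP i i' ξ⟩
    have h1 : ∀ i, ∫ ξ, a (ξ 0) * P i ξ ∂(m K) = β j := by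
      intro i
      have he : Function.Injective (Fin.cons 0 (idx i) : Fin (j + 1) → Fin K) := by
        rw [Fin.cons_injective_iff]
        exact ⟨fun ⟨l, hl⟩ => hidx0 i l hl, fun l l' h => (hidx _ _ _ _ h).2⟩
      exact hm.integral_comp he (measurable_prod_coord ha hb j)
    have h2 : ∀ i i', i ≠ i' → ∫ ξ, a (ξ 0) * (P i ξ * P i' ξ) ∂(m K) = β (j + j) := by
      intro i i' hii'
      have he : Function.Injective
          (Fin.cons 0 (Fin.append (idx i) (idx i')) : Fin (j + j + 1) → Fin K) := by
        rw [Fin.cons_injective_iff]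
        refine ⟨fun ⟨l, hl⟩ => ?_, ?_⟩
        · induction l using Fin.addCases with
          | left l => exact hidx0 i l (by simpa using hl)
          | right l => exact hidx0 i' l ((Fin.append_right (idx i) (idx i') l).symm.trans hl)
        · rw [Fin.append_injective_iff]
          exact ⟨fun l l' h => (hidx _ _ _ _ h).2, fun l l' h => (hidx _ _ _ _ h).2,
            fun l l' h => hii' (hidx _ _ _ _ h).1⟩
      rw [hβ]
      simp only
      rw [← hm.integral_comp he (measurable_prod_coord ha hb (j + j))]
      refine integral_congr_ae (ae_of_all _ fun ξ => ?_)
      simp only [Fin.prod_univ_add, P, Function.comp, Fin.cons_zero, Fin.cons_succ,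
        Fin.append_left, Fin.append_right]
    have h0 : ∫ ξ, a (ξ 0) ∂(m K) = ∫ ξ, a (ξ 0) ∂(m 1) :=
      hm.integral_comp (e := fun _ : Fin 1 => (0 : Fin K)) (Function.injective_of_subsingleton _)
        (ha.comp (measurable_pi_apply 0))
    -- The expectation of a(ξ_0)(t − ∑ P_i)² is a nonnegative quadratic polynomial in t, so its
    -- discriminant is nonpositive. This is Cauchy–Schwarz with the weight a.
    have hquad : ∀ t : ℝ, 0 ≤ (∫ ξ, a (ξ 0) ∂(m 1)) * (t * t) + (-2 * (n * β j)) * t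
        + ∑ i, ∑ i', ∫ ξ, a (ξ 0) * (P i ξ * P i' ξ) ∂(m K) := by
      intro t
      have hS : ∫ ξ, a (ξ 0) * (t - ∑ i, P i ξ) ^ 2 ∂(m K) =
          (∫ ξ, a (ξ 0) ∂(m 1)) * (t * t) + (-2 * (n * β j)) * t
          + ∑ i, ∑ i', ∫ ξ, a (ξ 0) * (P i ξ * P i' ξ) ∂(m K) := by
        have e : ∀ ξ, a (ξ 0) * (t - ∑ i, P i ξ) ^ 2 = (t * t) * a (ξ 0)
            + ∑ i, (-2 * t) * (a (ξ 0) * P i ξ) + ∑ i, ∑ i', a (ξ 0) * (P i ξ * P i' ξ) := by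
          intro ξ
          have e1 : ∑ i, ∑ i', a (ξ 0) * (P i ξ * P i' ξ)
              = a (ξ 0) * ((∑ i, P i ξ) * ∑ i, P i ξ) := by
            rw [Finset.sum_mul_sum, Finset.mul_sum]
            exact Finset.sum_congr rfl fun i _ => (Finset.mul_sum _ _ _).symm
          rw [e1, ← Finset.mul_sum, ← Finset.mul_sum]
          ring
        have i1 : Integrable (fun ξ : Fin K → Y => (t * t) * a (ξ 0)) (m K) := hia.const_mul _
        have i2 : Integrable (fun ξ : Fin K → Y => ∑ i, (-2 * t) * (a (ξ 0) * P i ξ)) (m K) :=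
          integrable_finsetSum _ fun i _ => (hiP i).const_mul _
        have i3 : Integrable (fun ξ : Fin K → Y => ∑ i, ∑ i', a (ξ 0) * (P i ξ * P i' ξ)) (m K) :=
          integrable_finsetSum _ fun i _ => integrable_finsetSum _ fun i' _ => hiPP i i'
        have i12 : Integrable (fun ξ : Fin K → Y => (t * t) * a (ξ 0)
          + ∑ i, (-2 * t) * (a (ξ 0) * P i ξ)) (m K) := i1.add i2
        simp only [e]
        rw [integral_add i12 i3, integral_add i1 i2, integral_const_mul, h0,
          integral_finsetSum _ fun i _ => (hiP i).const_mul _,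
          integral_finsetSum _ fun i _ => integrable_finsetSum _ fun i' _ => hiPP i i']
        simp only [integral_const_mul, h1]
        simp only [Finset.sum_const, Finset.card_univ, Fintype.card_fin, nsmul_eq_mul]
        congr 1
        · ring
        · exact Finset.sum_congr rfl fun i _ => integral_finsetSum _ fun i' _ => hiPP i i'
      rw [← hS]
      exact integral_nonneg fun ξ => mul_nonneg (ha0 _) (sq_nonneg _)
    have hdisc := discrim_le_zero hquad
    -- The n diagonal terms satisfy only the crude bound A·B^{2j}; every off-diagonal term equals β
    -- (j + j) by exchangeability.
    have hsum : ∑ i, ∑ i', ∫ ξ, a (ξ 0) * (P i ξ * P i' ξ) ∂(m K)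
        ≤ n * (A * (B ^ j * B ^ j)) + n * n * β (j + j) := by
      have hβ2 : 0 ≤ β (j + j) := integral_nonneg fun ξ =>
        mul_nonneg (ha0 _) (Finset.prod_nonneg fun l _ => hb0 _)
      have hin : ∀ i, ∑ i', ∫ ξ, a (ξ 0) * (P i ξ * P i' ξ) ∂(m K)
          ≤ A * (B ^ j * B ^ j) + n * β (j + j) := by
        intro i
        rw [← Finset.add_sum_erase _ _ (Finset.mem_univ i)]
        refine add_le_add ?_ ?_
        · refine (integral_mono (hiPP i i) (integrable_const _) fun ξ => hbPP i i ξ).trans ?_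
          simp
        · rw [Finset.sum_congr rfl fun i' hi' => h2 i i' (Finset.ne_of_mem_erase hi').symm]
          rw [Finset.sum_const, nsmul_eq_mul]
          refine mul_le_mul_of_nonneg_right ?_ hβ2
          exact_mod_cast (Finset.card_le_card (Finset.erase_subset _ _)).trans (by simp)
      refine (Finset.sum_le_sum fun i _ => hin i).trans ?_
      simp only [Finset.sum_const, Finset.card_univ, Fintype.card_fin, nsmul_eq_mul]
      linarith
    rw [discrim] at hdisc
    have hn' : (0 : ℝ) < n := by exact_mod_cast hn
    have h4 : (n : ℝ) * n * β j ^ 2 ≤ (∫ ξ, a (ξ 0) ∂(m 1)) *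
        (n * (A * (B ^ j * B ^ j)) + n * n * β (j + j)) := by
      have := mul_le_mul_of_nonneg_left hsum hβ0
      nlinarith
    have h5 : (∫ ξ, a (ξ 0) ∂(m 1)) * (A * (B ^ j * B ^ j) * (n : ℝ)⁻¹ + β (j + j))
        = (n * n : ℝ)⁻¹ * ((∫ ξ, a (ξ 0) ∂(m 1)) *
        (n * (A * (B ^ j * B ^ j)) + n * n * β (j + j))) := by
      field_simp
    rw [h5, inv_mul_eq_div, le_div_iff₀ (by positivity)]
    linarith
  have hlim : Tendsto (fun n : ℕ => (∫ ξ, a (ξ 0) ∂(m 1)) *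
      (A * (B ^ j * B ^ j) * (n : ℝ)⁻¹ + β (j + j))) atTop
      (𝓝 ((∫ ξ, a (ξ 0) ∂(m 1)) * (A * (B ^ j * B ^ j) * 0 + β (j + j)))) :=
    ((tendsto_inv_atTop_nhds_zero_nat.const_mul _).add_const _).const_mul _
  have := ge_of_tendsto hlim (eventually_atTop.2 ⟨1, fun n hn => key n hn⟩)
  simpa using this

/-- Cauchy–Schwarz inequality for mixed moments of exchangeable sequences. -/
theorem IsExchangeable.sq_mixedMoment_le (hm : IsExchangeable m) {a b : Y → ℝ≥0}
    (ha : Measurable a) (hb : Measurable b) (j : ℕ) :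
    mixedMoment m a b j ^ 2 ≤ mixedMoment m a b 0 * mixedMoment m a b (j + j) := by
  have := hm.prob
  -- The bounded case is applied to truncations, and monotone convergence lets the level tend to
  -- infinity. The right-hand side need not converge: it is bounded by its untruncated value.
  let aL : ℕ → Y → ℝ≥0 := fun L y => min (a y) L
  let bL : ℕ → Y → ℝ≥0 := fun L y => min (b y) L
  have haL : ∀ L, Measurable (aL L) := fun L => ha.min measurable_const
  have hbL : ∀ L, Measurable (bL L) := fun L => hb.min measurable_const
  have hlim : ∀ j, Tendsto (fun L => mixedMoment m (aL L) (bL L) j) atTop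
      (𝓝 (mixedMoment m a b j)) := by
    intro j
    refine lintegral_tendsto_of_tendsto_of_monotone
      (fun L => (measurable_prod_coord' (haL L) (hbL L) j).aemeasurable) ?_ ?_
    · refine ae_of_all _ fun ξ L L' hLL' => ?_
      have h : (L : ℝ≥0) ≤ L' := Nat.cast_le.2 hLL'
      refine mul_le_mul' (ENNReal.coe_le_coe.2 (min_le_min_left _ h))
        (Finset.prod_le_prod' fun l _ => ENNReal.coe_le_coe.2 (min_le_min_left _ h))
    · refine ae_of_all _ fun ξ => ?_
      have hev : ∀ c : ℝ≥0, ∀ᶠ L : ℕ in atTop, c ≤ L := fun c => by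
        obtain ⟨n, hn⟩ := exists_nat_ge c
        filter_upwards [eventually_ge_atTop n] with L hL
        exact hn.trans (Nat.cast_le.2 hL)
      refine tendsto_const_nhds.congr' ?_
      filter_upwards [hev (a (ξ 0)), eventually_all.2 fun l : Fin j => hev (b (ξ l.succ))]
        with L h1 h2
      simp only [aL, bL, min_eq_left h1]
      congr 1
      exact Finset.prod_congr rfl fun l _ => by rw [min_eq_left (h2 l)]
  have hreal : ∀ L j, mixedMoment m (aL L) (bL L) j
      = ENNReal.ofReal (∫ ξ, (aL L (ξ 0) : ℝ) * ∏ l : Fin j, (bL L (ξ l.succ) : ℝ)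
        ∂(m (j + 1))) := by
    intro L j
    rw [ofReal_integral_eq_lintegral_ofReal]
    · refine lintegral_congr fun ξ => ?_
      rw [ENNReal.ofReal_mul (by positivity), ENNReal.ofReal_prod_of_nonneg fun _ _ => by positivity]
      simp only [ENNReal.ofReal_coe_nnreal]
    · refine Integrable.of_bound (measurable_prod_coord (haL L).coe_nnreal_real
        (hbL L).coe_nnreal_real j).aestronglyMeasurable (L * L ^ j) (ae_of_all _ fun ξ => ?_)
      rw [Real.norm_of_nonneg (by positivity)]
      have hp : ∏ l : Fin j, (bL L (ξ l.succ) : ℝ) ≤ (L : ℝ) ^ j := by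
        simpa using Finset.prod_le_prod (s := Finset.univ)
          (fun l _ => NNReal.coe_nonneg (bL L (ξ (Fin.succ l))))
          fun l _ => NNReal.coe_le_coe.2 (min_le_right (b (ξ (Fin.succ l))) (L : ℝ≥0))
      exact mul_le_mul (NNReal.coe_le_coe.2 (min_le_right _ _)) hp (by positivity) (by positivity)
    · exact ae_of_all _ fun ξ => by positivity
  have hle : ∀ L, mixedMoment m (aL L) (bL L) j ^ 2
      ≤ mixedMoment m (aL L) (bL L) 0 * mixedMoment m (aL L) (bL L) (j + j) := by
    intro L
    have h := hm.sq_integral_le (haL L).coe_nnreal_real (hbL L).coe_nnreal_real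
      (A := L) (B := L) (fun _ => NNReal.coe_nonneg _)
      (fun y => NNReal.coe_le_coe.2 (min_le_right (a y) (L : ℝ≥0))) (fun _ => NNReal.coe_nonneg _)
      (fun y => NNReal.coe_le_coe.2 (min_le_right (b y) (L : ℝ≥0))) j
    simp only [hreal]
    rw [← ENNReal.ofReal_pow (integral_nonneg fun ξ => by positivity),
      ← ENNReal.ofReal_mul (integral_nonneg fun ξ => by positivity)]
    refine ENNReal.ofReal_le_ofReal ?_
    simpa using h
  have hmono : ∀ L j, mixedMoment m (aL L) (bL L) j ≤ mixedMoment m a b j := fun L j =>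
    lintegral_mono fun ξ => mul_le_mul' (ENNReal.coe_le_coe.2 (min_le_left _ _))
      (Finset.prod_le_prod' fun l _ => ENNReal.coe_le_coe.2 (min_le_left _ _))
  exact le_of_tendsto' (((ENNReal.continuous_pow 2).tendsto _).comp (hlim j)) fun L =>
    (hle L).trans (mul_le_mul' (hmono L 0) (hmono L _))

end Exchangeable

/-! ### Values at independent uniform points -/

section Laws

lemma pi_smul_const {Z : Type*} [MeasurableSpace Z] (μ : Measure Z) [SigmaFinite μ] {c : ℝ≥0∞}
    (hc : c ≠ ∞) (k : ℕ) :
    (Measure.pi fun _ : Fin k => c • μ) = c ^ k • Measure.pi fun _ : Fin k => μ := by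
  have : SigmaFinite (c • μ) := by
    rw [← withDensity_const]
    exact SigmaFinite.withDensity_of_ne_top (ae_of_all _ fun _ => hc)
  refine Measure.pi_eq fun s hs => ?_
  simp [Measure.pi_pi, Finset.prod_mul_distrib]

variable {D : Set (X d)}

lemma volume_ne_zero (hDo : IsOpen D) (hDn : D.Nonempty) : volume D ≠ 0 :=
  (hDo.measure_pos volume hDn).ne'

/-- The uniform distribution on `D`. -/
noncomputable def unif (D : Set (X d)) : Measure (X d) := (volume D)⁻¹ • volume.restrict D

lemma isProbabilityMeasure_unif (hDo : IsOpen D) (hDn : D.Nonempty) (hDf : volume D ≠ ∞) :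
    IsProbabilityMeasure (unif D) :=
  ⟨by simp [unif, ENNReal.inv_mul_cancel (volume_ne_zero hDo hDn) hDf]⟩

lemma pi_unif (hDo : IsOpen D) (hDn : D.Nonempty) (k : ℕ) :
    (Measure.pi fun _ : Fin k => unif D) = (volume D)⁻¹ ^ k • lam D k := by
  rw [lam_eq_pi]
  exact pi_smul_const _ (ENNReal.inv_ne_top.2 (volume_ne_zero hDo hDn)) k

/-- The distributions of the values at independent uniformly distributed points. -/
noncomputable def law (D : Set (X d)) (κ : KerFam d N) (k : ℕ) : Measure (Fin k → U N) :=
  ((Measure.pi fun _ : Fin k => unif D) ⊗ₘ κ k).snd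

variable {κ : KerFam d N}

lemma lintegral_law (hDo : IsOpen D) (hDn : D.Nonempty) (hDf : volume D ≠ ∞)
    (hκ : IsRegular D κ) {k : ℕ} {f : (Fin k → U N) → ℝ≥0∞} (hf : Measurable f) :
    ∫⁻ ξ, f ξ ∂(law D κ k) = (volume D)⁻¹ ^ k * ∫⁻ x, ∫⁻ ξ, f ξ ∂(κ k x) ∂(lam D k) := by
  have := isProbabilityMeasure_unif hDo hDn hDf
  have := hκ.markov k
  rw [law, Measure.snd, lintegral_map hf measurable_snd,
    Measure.lintegral_compProd (f := fun z => f z.2) (hf.comp measurable_snd), pi_unif hDo hDn, lintegral_smul_measure]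
  rfl

lemma lintegral_lam (hDo : IsOpen D) (hDn : D.Nonempty) (hDf : volume D ≠ ∞)
    (hκ : IsRegular D κ) {k : ℕ} {f : (Fin k → U N) → ℝ≥0∞} (hf : Measurable f) :
    ∫⁻ x, ∫⁻ ξ, f ξ ∂(κ k x) ∂(lam D k) = volume D ^ k * ∫⁻ ξ, f ξ ∂(law D κ k) := by
  rw [lintegral_law hDo hDn hDf hκ hf, ← mul_assoc, ← mul_pow,
    ENNReal.mul_inv_cancel (volume_ne_zero hDo hDn) hDf, one_pow, one_mul]

/-- Selecting among independent uniform points leaves their law unchanged, and the kernels are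
compatible with the same selection. -/
lemma isExchangeable_law (hDo : IsOpen D) (hDn : D.Nonempty) (hDf : volume D ≠ ∞)
    (hκ : IsRegular D κ) : IsExchangeable (law D κ) := by
  have := isProbabilityMeasure_unif hDo hDn hDf
  have := hκ.markov
  refine ⟨fun k => by rw [law, Measure.snd]; exact
    Measure.isProbabilityMeasure_map measurable_snd.aemeasurable, fun {j k} e he => ?_⟩
  ext B hB
  rw [Measure.map_apply (measurable_comp_right e) hB]
  have hB' := measurable_comp_right (Z := U N) e hB
  rw [law, law, Measure.snd_apply hB', Measure.snd_apply hB,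
    Measure.compProd_apply (measurable_snd hB'), Measure.compProd_apply (measurable_snd hB),
    ← (measurePreserving_comp (unif D) he).lintegral_comp
      (Kernel.measurable_kernel_prodMk_left (measurable_snd hB))]
  refine lintegral_congr_ae ?_
  rw [pi_unif hDo hDn]
  refine Measure.smul_absolutelyContinuous.ae_le ?_
  filter_upwards [hκ.marg e he] with x hx
  change κ k x ((fun ξ => ξ ∘ e) ⁻¹' B) = κ j (x ∘ e) B
  rw [← hx, Measure.map_apply (measurable_comp_right e) hB]

end Laws

/-! ### Moments and the support bound -/

section Moments

variable {D : Set (X d)} {κ : KerFam d N} {p : ℝ}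

/-- The moments `∫_{D^k} ⟨ν^k_x, |ξ_1|^p ⋯ |ξ_k|^p⟩ dx`. -/
noncomputable def mom (p : ℝ) (D : Set (X d)) (κ : KerFam d N) (k : ℕ) : ℝ≥0∞ :=
  ∫⁻ x, ∫⁻ ξ, ∏ i, ‖ξ i‖ₑ ^ p ∂(κ k x) ∂(lam D k)

/-- The power of the norm, as a nonnegative real number. -/
noncomputable def powNorm (p : ℝ) (v : U N) : ℝ≥0 := ‖v‖₊ ^ p

lemma coe_powNorm (hp : 0 ≤ p) (v : U N) : (powNorm p v : ℝ≥0∞) = ‖v‖ₑ ^ p :=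
  ENNReal.coe_rpow_of_nonneg _ hp

lemma measurable_powNorm (p : ℝ) : Measurable (powNorm p : U N → ℝ≥0) :=
  measurable_nnnorm.pow_const p

lemma measurable_prod_rpow (p : ℝ) (k : ℕ) :
    Measurable fun ξ : Fin k → U N => ∏ i, ‖ξ i‖ₑ ^ p :=
  Finset.measurable_prod _ fun i _ => (measurable_pi_apply i).enorm.pow_const p

lemma mom_eq (hDo : IsOpen D) (hDn : D.Nonempty) (hDf : volume D ≠ ∞) (hκ : IsRegular D κ)
    (k : ℕ) : mom p D κ k = volume D ^ k * ∫⁻ ξ, ∏ i, ‖ξ i‖ₑ ^ p ∂(law D κ k) :=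
  lintegral_lam hDo hDn hDf hκ (measurable_prod_rpow p k)

lemma mixedMoment_one {m : (k : ℕ) → Measure (Fin k → U N)} (hm : IsExchangeable m) (hp : 0 ≤ p)
    (j : ℕ) : mixedMoment m (fun _ => 1) (powNorm p) j = ∫⁻ ξ, ∏ i, ‖ξ i‖ₑ ^ p ∂(m j) := by
  rw [← hm.lintegral_comp (Fin.succ_injective j) (measurable_prod_rpow p j)]
  simp [mixedMoment, coe_powNorm hp]

lemma mixedMoment_self {m : (k : ℕ) → Measure (Fin k → U N)} (hp : 0 ≤ p)
    (j : ℕ) : mixedMoment m (powNorm p) (powNorm p) j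
      = ∫⁻ ξ, ∏ i, ‖ξ i‖ₑ ^ p ∂(m (j + 1)) := by
  simp [mixedMoment, coe_powNorm hp, Fin.prod_univ_succ]

/-- This is the mixed moment inequality with a = 1. Both sides carry the same factor |D|^{2j}, so
the normalisation of the uniform law leaves no constant. -/
lemma sq_mom_le (hDo : IsOpen D) (hDn : D.Nonempty) (hDf : volume D ≠ ∞) (hκ : IsRegular D κ)
    (hp : 0 ≤ p) (j : ℕ) : mom p D κ j ^ 2 ≤ mom p D κ (j + j) := by
  have hm := isExchangeable_law hDo hDn hDf hκ
  have h := hm.sq_mixedMoment_le (a := fun _ => 1) measurable_const (measurable_powNorm p) j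
  rw [mixedMoment_one hm hp, mixedMoment_one hm hp, mixedMoment_one hm hp] at h
  have := hm.prob 0
  rw [mom_eq hDo hDn hDf hκ, mom_eq hDo hDn hDf hκ, mul_pow, ← pow_mul, mul_two]
  gcongr
  simpa using h

lemma mom_pow_le (hDo : IsOpen D) (hDn : D.Nonempty) (hDf : volume D ≠ ∞) (hκ : IsRegular D κ)
    (hp : 0 ≤ p) (j s : ℕ) : mom p D κ j ^ (2 ^ s) ≤ mom p D κ (2 ^ s * j) := by
  induction s with
  | zero => simp
  | succ s ih =>
    calc mom p D κ j ^ (2 ^ (s + 1)) = (mom p D κ j ^ (2 ^ s)) ^ 2 := by rw [← pow_mul, pow_succ]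
      _ ≤ mom p D κ (2 ^ s * j) ^ 2 := by gcongr
      _ ≤ mom p D κ (2 ^ s * j + 2 ^ s * j) := sq_mom_le hDo hDn hDf hκ hp _
      _ = mom p D κ (2 ^ (s + 1) * j) := by congr 1; ring

lemma supportBound_iff_limsup_mom {M : ℝ} : SupportBound p D M κ.toFam ↔
    limsup (fun k : ℕ => mom p D κ k ^ (1 / ((k : ℝ) * p))) atTop ≤ ENNReal.ofReal M := Iff.rfl

lemma rpow_inv_le_iff_mom {a b : ℝ≥0∞} {t : ℝ} (ht : 0 < t) : a ^ (1 / t) ≤ b ↔ a ≤ b ^ t := by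
  rw [one_div, ENNReal.rpow_inv_le_iff ht]

/-- The support bound controls all moments. -/
theorem mom_le_of_supportBound (hDo : IsOpen D) (hDn : D.Nonempty) (hDf : volume D ≠ ∞)
    (hκ : IsRegular D κ) (hp : 0 < p) {M : ℝ} (hM : 0 < M) (h : SupportBound p D M κ.toFam)
    (k : ℕ) : mom p D κ k ≤ ENNReal.ofReal M ^ ((k : ℝ) * p) := by
  rcases Nat.eq_zero_or_pos k with rfl | hk
  · have hm := isExchangeable_law hDo hDn hDf hκ
    have := hm.prob 0
    rw [mom_eq hDo hDn hDf hκ]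
    simp
  rw [supportBound_iff_limsup_mom] at h
  have key : ∀ M' > M, mom p D κ k ≤ ENNReal.ofReal M' ^ ((k : ℝ) * p) := by
    intro M' hM'
    have hlt : limsup (fun k : ℕ => mom p D κ k ^ (1 / ((k : ℝ) * p))) atTop
        < ENNReal.ofReal M' := h.trans_lt ((ENNReal.ofReal_lt_ofReal_iff (hM.trans hM')).2 hM')
    obtain ⟨k₀, hk₀⟩ := eventually_atTop.1 (eventually_lt_of_limsup_lt hlt)
    -- The limsup controls only late moments. The order 2^s·k is late enough, and the doubling
    -- inequality returns the bound to order k without a constant.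
    obtain ⟨s, hs⟩ : ∃ s : ℕ, k₀ ≤ 2 ^ s * k :=
      ⟨k₀, (Nat.lt_two_pow_self.le).trans (Nat.le_mul_of_pos_right _ hk)⟩
    have h1 := (hk₀ _ hs).le
    have hkp : (0 : ℝ) < ((2 ^ s * k : ℕ) : ℝ) * p := by positivity
    rw [rpow_inv_le_iff_mom hkp] at h1
    have h2 := (mom_pow_le hDo hDn hDf hκ hp.le k s).trans h1
    have e : ENNReal.ofReal M' ^ (((2 ^ s * k : ℕ) : ℝ) * p)
        = (ENNReal.ofReal M' ^ ((k : ℝ) * p)) ^ (2 ^ s) := by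
      rw [← ENNReal.rpow_natCast, ← ENNReal.rpow_mul]
      congr 1
      push_cast
      ring
    rw [e] at h2
    exact (ENNReal.pow_le_pow_left_iff (by positivity)).1 h2
  have hlim : Tendsto (fun M' : ℝ => ENNReal.ofReal M' ^ ((k : ℝ) * p)) (𝓝[>] M)
      (𝓝 (ENNReal.ofReal M ^ ((k : ℝ) * p))) :=
    ((ENNReal.continuous_rpow_const.comp ENNReal.continuous_ofReal).tendsto M).mono_left
      nhdsWithin_le_nhds
  exact ge_of_tendsto hlim (by filter_upwards [self_mem_nhdsWithin] with M' hM' using key M' hM')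

theorem supportBound_of_mom_le (hp : 0 < p) {M : ℝ}
    (h : ∀ k, mom p D κ k ≤ ENNReal.ofReal M ^ ((k : ℝ) * p)) : SupportBound p D M κ.toFam := by
  rw [supportBound_iff_limsup_mom]
  refine limsup_le_of_le (by isBoundedDefault) ?_
  filter_upwards [eventually_gt_atTop 0] with k hk
  have hkp : (0 : ℝ) < (k : ℝ) * p := by positivity
  rw [rpow_inv_le_iff_mom hkp]
  exact h k

end Moments

/-! ### The tail of a single value -/

section Tails

variable {D : Set (X d)} {κ : KerFam d N} {p : ℝ}

/-- The power of the norm, restricted to large values. -/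
noncomputable def tailNorm (p L : ℝ) (v : U N) : ℝ≥0 := {v | L < ‖v‖}.indicator (powNorm p) v

lemma measurable_tailNorm (p L : ℝ) : Measurable (tailNorm p L : U N → ℝ≥0) :=
  (measurable_powNorm p).indicator (measurableSet_lt measurable_const measurable_norm)

lemma tailNorm_le (p L : ℝ) (v : U N) : tailNorm p L v ≤ powNorm p v :=
  indicator_le_self _ _ _

/-- The mass of the large values. -/
noncomputable def tail (p : ℝ) (D : Set (X d)) (L : ℝ) (κ : KerFam d N) : ℝ≥0∞ :=
  ∫⁻ x, ∫⁻ ξ, tailNorm p L (ξ 0) ∂(κ 1 x) ∂(lam D 1)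

/-- Cauchy–Schwarz isolates the truncated factor. A product with one large factor is small as soon
as the first-order tail is small and the moment of order 2j + 1 is bounded. -/
lemma mixedMoment_tail_le (hDo : IsOpen D) (hDn : D.Nonempty) (hDf : volume D ≠ ∞)
    (hκ : IsRegular D κ) (hp : 0 ≤ p) (L : ℝ) (j : ℕ) :
    mixedMoment (law D κ) (tailNorm p L) (powNorm p) j ^ 2
      ≤ ((volume D)⁻¹ * tail p D L κ) * ((volume D)⁻¹ ^ (j + j + 1) * mom p D κ (j + j + 1)) := by
  have hm := isExchangeable_law hDo hDn hDf hκ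
  refine (hm.sq_mixedMoment_le (measurable_tailNorm p L) (measurable_powNorm p) j).trans ?_
  refine mul_le_mul' (le_of_eq ?_) ?_
  · rw [tail, ← pow_one (volume D)⁻¹, ← lintegral_law (f := fun ξ => (tailNorm p L (ξ 0) : ℝ≥0∞)) hDo hDn hDf hκ
      ((measurable_tailNorm p L).coe_nnreal_ennreal.comp (measurable_pi_apply 0))]
    simp [mixedMoment]
  · rw [mom, ← lintegral_law hDo hDn hDf hκ (measurable_prod_rpow p _), ← mixedMoment_self hp]
    exact lintegral_mono fun ξ => mul_le_mul' (ENNReal.coe_le_coe.2 (tailNorm_le p L _)) le_rfl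

/-- No regularity of the boundary is assumed, so the volume of B_r(x) ∩ D may degenerate. Cover D by
finitely many balls of radius r/2. If x lies in such a piece, then B_r(x) ∩ D contains the whole
piece, so each piece contributes at most 1. -/
lemma lintegral_inv_volume_ball_lt_top (hDo : IsOpen D) (hDb : Bornology.IsBounded D) {r : ℝ}
    (hr : 0 < r) : ∫⁻ x in D, (volume (Metric.ball x r ∩ D))⁻¹ < ∞ := by
  obtain ⟨t, ht, hcov⟩ := Metric.totallyBounded_iff.1
    (Metric.isCompact_of_isClosed_isBounded isClosed_closure hDb.closure).totallyBounded
    (r / 2) (by positivity)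
  have hD : D ⊆ ⋃ z ∈ t, D ∩ Metric.ball z (r / 2) := by
    intro x hx
    obtain ⟨z, hz, hxz⟩ := mem_iUnion₂.1 (hcov (subset_closure hx))
    exact mem_iUnion₂.2 ⟨z, hz, hx, hxz⟩
  have hone : ∀ z, ∫⁻ x in D ∩ Metric.ball z (r / 2), (volume (Metric.ball x r ∩ D))⁻¹ ≤ 1 := by
    intro z
    have hm : MeasurableSet (D ∩ Metric.ball z (r / 2)) :=
      hDo.measurableSet.inter Metric.isOpen_ball.measurableSet
    calc ∫⁻ x in D ∩ Metric.ball z (r / 2), (volume (Metric.ball x r ∩ D))⁻¹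
        ≤ ∫⁻ _ in D ∩ Metric.ball z (r / 2), (volume (D ∩ Metric.ball z (r / 2)))⁻¹ := by
          refine setLIntegral_mono' hm fun x hx => ?_
          refine ENNReal.inv_le_inv.2 (measure_mono fun y hy => ⟨?_, hy.1⟩)
          have h1 := Metric.mem_ball.1 hy.2
          have h2 := Metric.mem_ball'.1 hx.2
          rw [Metric.mem_ball]
          linarith [dist_triangle y z x]
      _ ≤ 1 := by
          rw [setLIntegral_const, mul_comm]
          exact ENNReal.mul_inv_le_one _
  calc ∫⁻ x in D, (volume (Metric.ball x r ∩ D))⁻¹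
      ≤ ∫⁻ x in ⋃ z ∈ t, D ∩ Metric.ball z (r / 2), (volume (Metric.ball x r ∩ D))⁻¹ :=
        lintegral_mono_set hD
    _ ≤ ∑' z : t, ∫⁻ x in D ∩ Metric.ball z (r / 2), (volume (Metric.ball x r ∩ D))⁻¹ := by
        have := ht.to_subtype
        rw [biUnion_eq_iUnion]
        exact lintegral_iUnion_le _ _
    _ ≤ ∑' _z : t, 1 := ENNReal.tsum_le_tsum fun z => hone z
    _ < ∞ := by
        have := ht.to_subtype
        have := Fintype.ofFinite t
        rw [tsum_fintype]
        simp

lemma lintegral_ballKer (hDo : IsOpen D) (hDf : volume D ≠ ∞) {r : ℝ} (hr : 0 < r) {x : X d}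
    (hx : x ∈ D) : ∫⁻ y in D, ballKer D r x y = 1 := by
  have h := lintegral_ballKer_mul (D := D) r x (f := fun _ => 1) aemeasurable_const
  simp only [mul_one] at h
  rw [h, setLAverage_eq, setLIntegral_const, one_mul]
  refine ENNReal.div_self ?_ ?_
  · exact ((Metric.isOpen_ball.inter hDo).measure_pos volume ⟨x, Metric.mem_ball_self hr, hx⟩).ne'
  · exact ((measure_mono inter_subset_right).trans_lt hDf.lt_top).ne

lemma lintegral_lam_one (D : Set (X d)) (F : (Fin 1 → X d) → ℝ≥0∞) :
    ∫⁻ x, F x ∂(lam D 1) = ∫⁻ x in D, F fun _ => x := by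
  have := (measurePreserving_funUnique (volume.restrict D) (Fin 1)).symm
  rw [lam_eq_pi]
  exact (this.lintegral_comp_emb (MeasurableEquiv.measurableEmbedding _) F).symm

lemma enorm_rpow_le_add (hp : 0 ≤ p) (v w : U N) :
    ‖v‖ₑ ^ p ≤ 2 ^ p * ‖v - w‖ₑ ^ p + 2 ^ p * ‖w‖ₑ ^ p := by
  have h : ‖v‖ₑ ≤ 2 * max ‖v - w‖ₑ ‖w‖ₑ := by
    calc ‖v‖ₑ = ‖(v - w) + w‖ₑ := by rw [sub_add_cancel]
      _ ≤ ‖v - w‖ₑ + ‖w‖ₑ := enorm_add_le _ _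
      _ ≤ max ‖v - w‖ₑ ‖w‖ₑ + max ‖v - w‖ₑ ‖w‖ₑ := add_le_add (le_max_left _ _) (le_max_right _ _)
      _ = 2 * max ‖v - w‖ₑ ‖w‖ₑ := (two_mul _).symm
  calc ‖v‖ₑ ^ p ≤ (2 * max ‖v - w‖ₑ ‖w‖ₑ) ^ p := by gcongr
    _ = 2 ^ p * (max ‖v - w‖ₑ ‖w‖ₑ) ^ p := ENNReal.mul_rpow_of_nonneg _ _ hp
    _ ≤ 2 ^ p * (‖v - w‖ₑ ^ p + ‖w‖ₑ ^ p) := by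
        gcongr
        rcases le_total ‖v - w‖ₑ ‖w‖ₑ with h | h
        · rw [max_eq_right h]; exact le_add_self
        · rw [max_eq_left h]; exact le_self_add
    _ = _ := mul_add _ _ _

lemma ballKer_le (D : Set (X d)) (r : ℝ) (x y : X d) :
    ballKer D r x y ≤ (volume (Metric.ball x r ∩ D))⁻¹ := indicator_le_self _ _ _

/-- Averaging in a second point does not change an integral. -/
lemma lintegral_lam_one_eq_two (hκ : IsRegular D κ) (hDm : MeasurableSet D)
    {B : X d × X d → ℝ≥0∞} (hB : Measurable B) (hB1 : ∀ x ∈ D, ∫⁻ y in D, B (x, y) = 1)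
    {f : U N → ℝ≥0∞} (hf : Measurable f) :
    ∫⁻ x, ∫⁻ ξ, f (ξ 0) ∂(κ 1 x) ∂(lam D 1)
      = ∫⁻ z, B (z 0, z 1) * ∫⁻ ξ, f (ξ 0) ∂(κ 2 z) ∂(lam D 2) := by
  have := hκ.markov
  have hf1 : Measurable fun ξ : Fin 1 → U N => f (ξ 0) := hf.comp (measurable_pi_apply 0)
  have hG : Measurable fun x : Fin 1 → X d => ∫⁻ ξ, f (ξ 0) ∂(κ 1 x) :=
    Measurable.lintegral_kernel hf1
  have hB2 : Measurable fun z : Fin 2 → X d => B (z 0, z 1) :=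
    hB.comp ((measurable_pi_apply 0).prodMk (measurable_pi_apply 1))
  have hG2 : Measurable fun z : Fin 2 → X d => ∫⁻ ξ, f (ξ 0) ∂(κ 1 (z ∘ fun _ : Fin 1 => 0)) :=
    hG.comp (measurable_comp_right _)
  calc ∫⁻ x, ∫⁻ ξ, f (ξ 0) ∂(κ 1 x) ∂(lam D 1)
      = ∫⁻ x in D, ∫⁻ ξ, f (ξ 0) ∂(κ 1 fun _ => x) := lintegral_lam_one D _
    _ = ∫⁻ x in D, ∫⁻ y in D, B (x, y) * ∫⁻ ξ, f (ξ 0) ∂(κ 1 fun _ => x) := by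
        refine setLIntegral_congr_fun hDm fun x hx => ?_
        have hbm : Measurable fun y => B (x, y) := hB.comp measurable_prodMk_left
        rw [lintegral_mul_const _ hbm, hB1 x hx, one_mul]
    _ = ∫⁻ z, B (z 0, z 1) * ∫⁻ ξ, f (ξ 0) ∂(κ 1 (z ∘ fun _ : Fin 1 => 0)) ∂(lam D 2) :=
        (lintegral_lam_two D (hB2.mul hG2)).symm
    _ = _ := by
        refine lintegral_congr_ae ?_
        filter_upwards [hκ.lintegral_comp (e := fun _ : Fin 1 => (0 : Fin 2))
          (Function.injective_of_subsingleton _)] with z hz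
        rw [← hz _ hf1]
        rfl

/-- The weight sees only the first point and the value only the second, so the double integral
factorises. -/
lemma lintegral_lam_two_snd (hκ : IsRegular D κ) {W : X d → ℝ≥0∞} (hW : Measurable W)
    {f : U N → ℝ≥0∞} (hf : Measurable f) :
    ∫⁻ z : Fin 2 → X d, W (z 0) * ∫⁻ ξ, f (ξ 1) ∂(κ 2 z) ∂(lam D 2)
      = (∫⁻ x in D, W x) * ∫⁻ x, ∫⁻ ξ, f (ξ 0) ∂(κ 1 x) ∂(lam D 1) := by
  have := hκ.markov
  have hf1 : Measurable fun ξ : Fin 1 → U N => f (ξ 0) := hf.comp (measurable_pi_apply 0)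
  have hG : Measurable fun x : Fin 1 → X d => ∫⁻ ξ, f (ξ 0) ∂(κ 1 x) :=
    Measurable.lintegral_kernel hf1
  have hc : Measurable fun y : X d => (fun _ => y : Fin 1 → X d) :=
    measurable_pi_lambda _ fun _ => measurable_id
  calc ∫⁻ z : Fin 2 → X d, W (z 0) * ∫⁻ ξ, f (ξ 1) ∂(κ 2 z) ∂(lam D 2)
      = ∫⁻ z : Fin 2 → X d, W (z 0) *
          ∫⁻ ξ, f (ξ 0) ∂(κ 1 (z ∘ fun _ : Fin 1 => 1)) ∂(lam D 2) := by
        refine lintegral_congr_ae ?_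
        filter_upwards [hκ.lintegral_comp (e := fun _ : Fin 1 => (1 : Fin 2))
          (Function.injective_of_subsingleton _)] with z hz
        rw [← hz _ hf1]
        rfl
    _ = ∫⁻ x in D, ∫⁻ y in D, W x * ∫⁻ ξ, f (ξ 0) ∂(κ 1 fun _ => y) :=
        lintegral_lam_two D ((hW.comp (measurable_pi_apply 0)).mul
          (hG.comp (measurable_comp_right _)))
    _ = ∫⁻ x in D, W x * ∫⁻ x, ∫⁻ ξ, f (ξ 0) ∂(κ 1 x) ∂(lam D 1) := by
        refine lintegral_congr fun x => ?_
        rw [lintegral_lam_one]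
        exact lintegral_const_mul (W x) (hG.comp hc)
    _ = _ := lintegral_mul_const _ hW

lemma tailNorm_le_add (hp : 0 ≤ p) (L : ℝ) (v w : U N) : (tailNorm p L v : ℝ≥0∞) ≤
    2 ^ p * ‖v - w‖ₑ ^ p + 2 ^ p * {u : U N | L < ‖u‖}.indicator (fun _ => ‖w‖ₑ ^ p) v := by
  by_cases hξ : L < ‖v‖
  · rw [indicator_of_mem (by exact hξ), tailNorm, indicator_of_mem (by exact hξ), coe_powNorm hp]
    exact enorm_rpow_le_add hp _ _
  · rw [tailNorm, indicator_of_notMem (by exact hξ)]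
    simp

lemma indicator_tail_le_mul (hp : 0 ≤ p) {L : ℝ} (hL : 0 < L) (v w : U N) :
    {u : U N | L < ‖u‖}.indicator (fun _ => ‖w‖ₑ ^ p) v
      ≤ (ENNReal.ofReal L ^ p)⁻¹ * (‖v‖ₑ ^ p * ‖w‖ₑ ^ p) := by
  have hL0 : ENNReal.ofReal L ^ p ≠ 0 := by simp [hL, not_lt.2 hp]
  have hLt : ENNReal.ofReal L ^ p ≠ ∞ := by simp [hp]
  by_cases hξ : L < ‖v‖
  · rw [indicator_of_mem (by exact hξ), ← mul_assoc]
    refine le_mul_of_one_le_left' ?_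
    rw [← ENNReal.div_eq_inv_mul, ENNReal.le_div_iff_mul_le (.inl hL0) (.inl hLt), one_mul]
    gcongr
    rw [← ofReal_norm]
    exact ENNReal.ofReal_le_ofReal hξ.le
  · rw [indicator_of_notMem (by exact hξ)]
    exact bot_le

/-- Where |ξ_0| > L, |ξ_0|^p is at most 2^p|ξ_0 − ξ_1|^p + 2^p|ξ_1|^p. Averaged in the second point,
the first term is a modulus of continuity. For the second term the weight is split at height S. Its
large part is paired with |ξ_1|^p alone; its bounded part uses that the indicator of |ξ_0| > L is at
most |ξ_0|^p / L^p and gives the second moment. -/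
lemma tail_le_of_average (hDm : MeasurableSet D) (hκ : IsRegular D κ) (hp : 0 ≤ p)
    {B : X d × X d → ℝ≥0∞} (hB : Measurable B) (hB1 : ∀ x ∈ D, ∫⁻ y in D, B (x, y) = 1)
    {K : X d → ℝ≥0∞} (hK : Measurable K) (hBK : ∀ x y, B (x, y) ≤ K x) (S : ℝ≥0∞) {L : ℝ}
    (hL : 0 < L) :
    tail p D L κ ≤ 2 ^ p * (∫⁻ z, B (z 0, z 1) * ∫⁻ ξ, ‖ξ 0 - ξ 1‖ₑ ^ p ∂(κ 2 z) ∂(lam D 2)) +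
      2 ^ p * ((∫⁻ x in D, {x | S < K x}.indicator K x) * mom p D κ 1
        + S * ((ENNReal.ofReal L ^ p)⁻¹ * mom p D κ 2)) := by
  -- The function W below is the part of the weight bound K above height S.
  have := hκ.markov
  set W : X d → ℝ≥0∞ := {x | S < K x}.indicator K with hWdef
  have hW : Measurable W := hK.indicator (measurableSet_lt measurable_const hK)
  have hBW : ∀ x y, B (x, y) ≤ W x + S := by
    intro x y
    refine (hBK x y).trans ?_
    by_cases hS : S < K x
    · rw [hWdef, indicator_of_mem (by exact hS)]; exact le_self_add
    · exact (not_lt.1 hS).trans le_add_self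
  have hn : Measurable fun v : U N => ‖v‖ₑ ^ p := measurable_enorm.pow_const p
  have hn1 : Measurable fun ξ : Fin 2 → U N => ‖ξ 1‖ₑ ^ p := hn.comp (measurable_pi_apply 1)
  have hB2 : Measurable fun z : Fin 2 → X d => B (z 0, z 1) :=
    hB.comp ((measurable_pi_apply 0).prodMk (measurable_pi_apply 1))
  have m1 : Measurable fun z => ∫⁻ ξ, ‖ξ 0 - ξ 1‖ₑ ^ p ∂(κ 2 z) := measurable_lintegral_diff p κ
  have m2 : Measurable fun z => ∫⁻ ξ, ‖ξ 1‖ₑ ^ p ∂(κ 2 z) := Measurable.lintegral_kernel hn1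
  have m3 : Measurable fun z => ∫⁻ ξ, ∏ i, ‖ξ i‖ₑ ^ p ∂(κ 2 z) :=
    Measurable.lintegral_kernel (measurable_prod_rpow p 2)
  have m4 : Measurable fun z : Fin 2 → X d => W (z 0) := hW.comp (measurable_pi_apply 0)
  have hmom : ∫⁻ z : Fin 2 → X d, W (z 0) * ∫⁻ ξ, ‖ξ 1‖ₑ ^ p ∂(κ 2 z) ∂(lam D 2)
      = (∫⁻ x in D, W x) * mom p D κ 1 := by
    rw [lintegral_lam_two_snd hκ hW hn]
    simp [mom]
  have him : Measurable fun ξ : Fin 2 → U N =>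
      {u : U N | L < ‖u‖}.indicator (fun _ => ‖ξ 1‖ₑ ^ p) (ξ 0) :=
    hn1.indicator (measurableSet_lt measurable_const (measurable_pi_apply 0).norm)
  have hpt : ∀ z : Fin 2 → X d, B (z 0, z 1) * ∫⁻ ξ, tailNorm p L (ξ 0) ∂(κ 2 z) ≤
      2 ^ p * (B (z 0, z 1) * ∫⁻ ξ, ‖ξ 0 - ξ 1‖ₑ ^ p ∂(κ 2 z)) +
        2 ^ p * (W (z 0) * (∫⁻ ξ, ‖ξ 1‖ₑ ^ p ∂(κ 2 z)) +
            S * ((ENNReal.ofReal L ^ p)⁻¹ * ∫⁻ ξ, ∏ i, ‖ξ i‖ₑ ^ p ∂(κ 2 z))) := by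
    intro z
    calc B (z 0, z 1) * ∫⁻ ξ, tailNorm p L (ξ 0) ∂(κ 2 z)
        ≤ B (z 0, z 1) * ∫⁻ ξ, (2 ^ p * ‖ξ 0 - ξ 1‖ₑ ^ p +
          2 ^ p * {u : U N | L < ‖u‖}.indicator (fun _ => ‖ξ 1‖ₑ ^ p) (ξ 0)) ∂(κ 2 z) := by
          gcongr; exact tailNorm_le_add hp L _ _
      _ = 2 ^ p * (B (z 0, z 1) * ∫⁻ ξ, ‖ξ 0 - ξ 1‖ₑ ^ p ∂(κ 2 z)) +
          2 ^ p * (B (z 0, z 1) * ∫⁻ ξ, {u : U N | L < ‖u‖}.indicator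
            (fun _ => ‖ξ 1‖ₑ ^ p) (ξ 0) ∂(κ 2 z)) := by
          rw [lintegral_add_left ((measurable_diff_rpow p 0 1).const_mul _),
            lintegral_const_mul _ (measurable_diff_rpow p 0 1), lintegral_const_mul _ him]
          ring
      _ ≤ _ := by
          gcongr
          refine (mul_le_mul' (hBW _ _) le_rfl).trans ?_
          rw [add_mul]
          gcongr
          · exact indicator_le_self _ (fun _ => _) _
          · rw [← lintegral_const_mul _ (measurable_prod_rpow p 2)]
            refine lintegral_mono fun ξ => ?_
            rw [Fin.prod_univ_two]
            exact indicator_tail_le_mul hp hL _ _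
  have htm : Measurable fun v : U N => (tailNorm p L v : ℝ≥0∞) :=
    (measurable_tailNorm p L).coe_nnreal_ennreal
  rw [tail, lintegral_lam_one_eq_two hκ hDm hB hB1 htm]
  refine (lintegral_mono hpt).trans_eq ?_
  have m5 : Measurable fun z : Fin 2 → X d =>
    B (z 0, z 1) * ∫⁻ ξ, ‖ξ 0 - ξ 1‖ₑ ^ p ∂(κ 2 z) := hB2.mul m1
  have m6 : Measurable fun z : Fin 2 → X d => W (z 0) * ∫⁻ ξ, ‖ξ 1‖ₑ ^ p ∂(κ 2 z) := m4.mul m2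
  have m7 : Measurable fun z : Fin 2 → X d => W (z 0) * (∫⁻ ξ, ‖ξ 1‖ₑ ^ p ∂(κ 2 z)) +
      S * ((ENNReal.ofReal L ^ p)⁻¹ * ∫⁻ ξ, ∏ i, ‖ξ i‖ₑ ^ p ∂(κ 2 z)) :=
    m6.add ((m3.const_mul _).const_mul _)
  rw [lintegral_add_left (m5.const_mul _), lintegral_const_mul _ m5,
    lintegral_const_mul _ m7, lintegral_add_left m6, hmom, lintegral_const_mul _ (m3.const_mul _),
    lintegral_const_mul _ m3]
  rfl

/-- Equi-integrability of the family from its modulus of continuity. -/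
theorem tail_le (hDo : IsOpen D) (hDf : volume D ≠ ∞) (hκ : IsRegular D κ)
    (hp : 0 ≤ p) {r : ℝ} (hr : 0 < r) (S : ℝ≥0∞) {L : ℝ} (hL : 0 < L) :
    tail p D L κ ≤ 2 ^ p * modCont p D r κ.toFam +
      2 ^ p * ((∫⁻ x in D, {x | S < (volume (Metric.ball x r ∩ D))⁻¹}.indicator
        (fun x => (volume (Metric.ball x r ∩ D))⁻¹) x) * mom p D κ 1
        + S * ((ENNReal.ofReal L ^ p)⁻¹ * mom p D κ 2)) := by
  have hDm := hDo.measurableSet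
  have := hκ.markov
  rw [modCont_eq_lintegral p hDm]
  exact tail_le_of_average hDm hκ hp (measurable_ballKer hDm r)
    (fun x hx => lintegral_ballKer hDo hDf hr hx) (measurable_volume_ball hDm r).inv
    (fun x y => ballKer_le D r x y) S hL

end Tails

section Truncation

lemma exists_lintegral_tail_le {α : Type*} [MeasurableSpace α] {μ : Measure α} {f : α → ℝ≥0∞}
    (hf : AEMeasurable f μ) (hfi : ∫⁻ x, f x ∂μ ≠ ∞) {δ : ℝ≥0∞} (hδ : δ ≠ 0) :
    ∃ T : ℝ≥0∞, T ≠ ∞ ∧ ∫⁻ x, (Ioi T).indicator id (f x) ∂μ ≤ δ := by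
  have hlim : Tendsto (fun n : ℕ => ∫⁻ x, (Ioi (n : ℝ≥0∞)).indicator id (f x) ∂μ) atTop
      (𝓝 (∫⁻ _, 0 ∂μ)) := by
    refine tendsto_lintegral_of_dominated_convergence' f (fun n => ?_)
      (fun n => ae_of_all _ fun x => indicator_le_self (Ioi (n : ℝ≥0∞)) id (f x)) hfi ?_
    · exact (measurable_id.indicator measurableSet_Ioi).comp_aemeasurable hf
    · filter_upwards [ae_lt_top' hf hfi] with x hx
      obtain ⟨n₀, hn₀⟩ := ENNReal.exists_nat_gt hx.ne
      refine tendsto_const_nhds.congr' ?_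
      filter_upwards [eventually_ge_atTop n₀] with n hn
      rw [indicator_of_notMem]
      exact not_lt.2 (hn₀.le.trans (by exact_mod_cast hn))
  rw [lintegral_zero] at hlim
  obtain ⟨n, hn⟩ := (hlim.eventually (ge_mem_nhds (pos_iff_ne_zero.2 hδ))).exists
  exact ⟨n, by simp, hn⟩

lemma exists_mul_le {C δ : ℝ≥0∞} (hC : C ≠ ∞) (hδ : δ ≠ 0) : ∃ ε : ℝ≥0∞, ε ≠ 0 ∧ ε * C ≤ δ := by
  have hC1 : C + 1 ≠ ∞ := by simp [hC]
  refine ⟨δ / (C + 1), ENNReal.div_ne_zero.2 ⟨hδ, hC1⟩, ?_⟩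
  calc δ / (C + 1) * C ≤ δ / (C + 1) * (C + 1) := by gcongr; exact le_self_add
    _ = δ := ENNReal.div_mul_cancel (by simp) hC1

end Truncation

/-! ### Uniform integrability of products -/

section UniformTails

variable {D : Set (X d)} {p : ℝ} {κ : ℕ → KerFam d N}

/-- Large values are negligible, uniformly along the sequence. -/
theorem eventually_tail_le (hDo : IsOpen D) (hDb : Bornology.IsBounded D)
    (hκ : ∀ n, IsRegular D (κ n)) (hp : 0 < p) (hmom : ∀ k, ∃ A ≠ ∞, ∀ n, mom p D (κ n) k ≤ A)
    (hdc : ∀ δ ≠ 0, ∃ r > 0, ∀ᶠ n in atTop, modCont p D r (κ n).toFam ≤ δ) {ε : ℝ≥0∞} (hε : ε ≠ 0) :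
    ∀ᶠ L in atTop, ∀ᶠ n in atTop, tail p D L (κ n) ≤ ε := by
  have hDm := hDo.measurableSet
  have h2 : (2 : ℝ≥0∞) ^ p ≠ ∞ := by simp [hp.le]
  obtain ⟨A₁, hA₁, hm₁⟩ := hmom 1
  obtain ⟨A₂, hA₂, hm₂⟩ := hmom 2
  have hε3 : ε / 3 ≠ 0 := ENNReal.div_ne_zero.2 ⟨hε, by simp⟩
  obtain ⟨δ, hδ, hδε⟩ := exists_mul_le h2 hε3
  -- The constants are chosen in this order: r makes the modulus small, S (depending on r) handles
  -- the points with small balls, and L (depending on S) is taken last.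
  obtain ⟨r, hr, hrn⟩ := hdc δ hδ
  obtain ⟨δ₁, hδ₁, hδ₁ε⟩ := exists_mul_le hA₁ hδ
  obtain ⟨S, hS, hSδ⟩ := exists_lintegral_tail_le
    (measurable_volume_ball hDm r).inv.aemeasurable (lintegral_inv_volume_ball_lt_top hDo hDb hr).ne
    hδ₁
  obtain ⟨δ₂, hδ₂, hδ₂ε⟩ := exists_mul_le (ENNReal.mul_ne_top hS hA₂) hδ
  have hlim : Tendsto (fun L : ℝ => (ENNReal.ofReal L ^ p)⁻¹) atTop (𝓝 0) := by
    have h1 : Tendsto (fun L : ℝ => ENNReal.ofReal L ^ p) atTop (𝓝 ∞) :=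
      (ENNReal.tendsto_rpow_at_top hp).comp ENNReal.tendsto_ofReal_atTop
    simpa using tendsto_inv_iff.2 h1
  filter_upwards [eventually_gt_atTop 0, hlim.eventually (ge_mem_nhds (pos_iff_ne_zero.2 hδ₂))]
    with L hL hLδ
  filter_upwards [hrn] with n hn
  refine (tail_le hDo hDb.measure_lt_top.ne (hκ n) hp.le hr S hL).trans ?_
  calc 2 ^ p * modCont p D r (κ n).toFam +
      2 ^ p * ((∫⁻ x in D, {x | S < (volume (Metric.ball x r ∩ D))⁻¹}.indicator
        (fun x => (volume (Metric.ball x r ∩ D))⁻¹) x) * mom p D (κ n) 1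
        + S * ((ENNReal.ofReal L ^ p)⁻¹ * mom p D (κ n) 2))
      ≤ 2 ^ p * δ + 2 ^ p * (δ₁ * A₁ + S * (δ₂ * A₂)) := by
        gcongr
        · exact hSδ
        · exact hm₁ n
        · exact hm₂ n
    _ ≤ ε / 3 + 2 ^ p * (δ + δ) := by
        gcongr
        · rwa [mul_comm]
        · rwa [mul_left_comm]
    _ = ε / 3 + (2 ^ p * δ + 2 ^ p * δ) := by rw [mul_add]
    _ ≤ ε / 3 + (ε / 3 + ε / 3) := by gcongr <;> rwa [mul_comm]
    _ = ε := by rw [← add_assoc, ENNReal.add_thirds]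

lemma eventually_mixedMoment_le (hDo : IsOpen D) (hDn : D.Nonempty) (hDf : volume D ≠ ∞)
    (hκ : ∀ n, IsRegular D (κ n)) (hp : 0 < p) (hmom : ∀ k, ∃ A ≠ ∞, ∀ n, mom p D (κ n) k ≤ A)
    (htail : ∀ ε ≠ 0, ∀ᶠ L in atTop, ∀ᶠ n in atTop, tail p D L (κ n) ≤ ε) (j : ℕ)
    {ε : ℝ≥0∞} (hε : ε ≠ 0) :
    ∀ᶠ L in atTop, ∀ᶠ n in atTop,
      mixedMoment (law D (κ n)) (tailNorm p L) (powNorm p) j ≤ ε := by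
  obtain ⟨A, hA, hm⟩ := hmom (j + j + 1)
  have hv : (volume D)⁻¹ ≠ ∞ := ENNReal.inv_ne_top.2 (volume_ne_zero hDo hDn)
  obtain ⟨δ, hδ, hδε⟩ := exists_mul_le (C := (volume D)⁻¹ * ((volume D)⁻¹ ^ (j + j + 1) * A))
    (ENNReal.mul_ne_top hv (ENNReal.mul_ne_top (ENNReal.pow_ne_top hv) hA)) (pow_ne_zero 2 hε)
  filter_upwards [htail δ hδ] with L hL
  filter_upwards [hL] with n hn
  rw [← ENNReal.pow_le_pow_left_iff two_ne_zero]
  refine (mixedMoment_tail_le hDo hDn hDf (hκ n) hp.le L j).trans (le_trans ?_ hδε)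
  calc (volume D)⁻¹ * tail p D L (κ n) * ((volume D)⁻¹ ^ (j + j + 1) * mom p D (κ n) (j + j + 1))
      ≤ (volume D)⁻¹ * δ * ((volume D)⁻¹ ^ (j + j + 1) * A) := by gcongr; exact hm n
    _ = _ := by ring

section Mixed

variable {κ : KerFam d N}

lemma lintegral_lam_split {k : ℕ} (S : Finset (Fin k)) {Φ : (Fin Sᶜ.card → X d) → ℝ≥0∞}
    {Ψ : (Fin S.card → X d) → ℝ≥0∞} (hΦ : AEMeasurable Φ (lam D Sᶜ.card))
    (hΨ : AEMeasurable Ψ (lam D S.card)) :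
    ∫⁻ x, Φ (x ∘ Sᶜ.orderEmbOfFin rfl) * Ψ (x ∘ S.orderEmbOfFin rfl) ∂(lam D k)
      = (∫⁻ x, Φ x ∂(lam D Sᶜ.card)) * ∫⁻ x, Ψ x ∂(lam D S.card) := by
  have hmp : MeasurePreserving (fun x : Fin k → X d =>
      (x ∘ Sᶜ.orderEmbOfFin rfl, x ∘ S.orderEmbOfFin rfl)) (lam D k)
      ((lam D Sᶜ.card).prod (lam D S.card)) := by
    let e : Fin Sᶜ.card ⊕ Fin S.card ≃ Fin k :=
      (Equiv.sumComm _ _).trans (finSumEquivOfFinset (s := S) rfl rfl)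
    have h1 := (measurePreserving_piCongrLeft (fun _ : Fin k => volume.restrict D) e).symm
    have h2 := measurePreserving_sumPiEquivProdPi
      (fun _ : Fin Sᶜ.card ⊕ Fin S.card => volume.restrict D)
    simp only [lam_eq_pi]
    exact h2.comp h1
  rw [← lintegral_prod_mul hΦ hΨ, ← hmp.map_eq]
  rw [lintegral_map' ?_ hmp.aemeasurable]
  rw [hmp.map_eq]
  exact (hΦ.comp_fst).mul (hΨ.comp_snd)

lemma measurable_prod_finset_rpow (p : ℝ) {k : ℕ} (S : Finset (Fin k)) :
    Measurable fun ξ : Fin k → U N => ∏ i ∈ S, ‖ξ i‖ₑ ^ p :=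
  Finset.measurable_prod _ fun i _ => (measurable_pi_apply i).enorm.pow_const p

lemma prod_orderEmb {k : ℕ} (S : Finset (Fin k)) (f : Fin k → ℝ≥0∞) :
    ∏ j, f (S.orderEmbOfFin rfl j) = ∏ i ∈ S, f i := by
  conv_rhs => rw [← Finset.map_orderEmbOfFin_univ S rfl]
  rw [Finset.prod_map]
  rfl

/-- The weight involves only the points outside S. By compatibility the product involves only those
in S, so the integral splits and the second factor is a moment of order |S|. -/
lemma lintegral_mul_prod_eq (hκ : IsRegular D κ) (p : ℝ) {k : ℕ} (S : Finset (Fin k))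
    {Φ : (Fin Sᶜ.card → X d) → ℝ≥0∞} (hΦ : AEMeasurable Φ (lam D Sᶜ.card)) :
    ∫⁻ x, Φ (x ∘ Sᶜ.orderEmbOfFin rfl) * ∫⁻ ξ, ∏ i ∈ S, ‖ξ i‖ₑ ^ p ∂(κ k x) ∂(lam D k)
      = (∫⁻ x, Φ x ∂(lam D Sᶜ.card)) * mom p D κ S.card := by
  have := hκ.markov
  rw [mom, ← lintegral_lam_split S hΦ
    (Measurable.lintegral_kernel (measurable_prod_rpow p _)).aemeasurable]
  refine lintegral_congr_ae ?_
  filter_upwards [hκ.lintegral_comp (S.orderEmbOfFin rfl).injective] with x hx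
  rw [← hx _ (measurable_prod_rpow p _)]
  simp only [Function.comp_apply]
  congr 1
  refine lintegral_congr fun ξ => ?_
  exact (prod_orderEmb S fun i => ‖ξ i‖ₑ ^ p).symm

/-- The large component i need not occur in the product. The condition L ≥ 1 allows the factor
|ξ_i|^p ≥ 1 to be inserted when it is absent. -/
lemma indicator_le_tailNorm_mul (hp : 0 ≤ p) {L : ℝ} (hL : 1 ≤ L) {k : ℕ} (S : Finset (Fin k))
    (i : Fin k) (ξ : Fin k → U N) :
    {ξ : Fin k → U N | L < ‖ξ i‖}.indicator (fun ξ => ∏ l ∈ S, ‖ξ l‖ₑ ^ p) ξ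
      ≤ tailNorm p L (ξ i) * ∏ l ∈ S.erase i, ‖ξ l‖ₑ ^ p := by
  by_cases h : L < ‖ξ i‖
  · rw [indicator_of_mem (by exact h), tailNorm, indicator_of_mem (by exact h), coe_powNorm hp]
    by_cases hi : i ∈ S
    · rw [Finset.mul_prod_erase S (fun l => ‖ξ l‖ₑ ^ p) hi]
    · rw [Finset.erase_eq_of_notMem hi]
      refine le_mul_of_one_le_left' ?_
      rw [← ENNReal.one_rpow p, ← ofReal_norm]
      gcongr
      exact ENNReal.one_le_ofReal.2 (hL.trans h.le)
  · rw [indicator_of_notMem (by exact h)]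
    exact bot_le

/-- By exchangeability the large component may be moved to position 0, in front of the remaining
factors, which gives a mixed moment. -/
lemma lintegral_indicator_le (hDo : IsOpen D) (hDn : D.Nonempty) (hDf : volume D ≠ ∞)
    (hκ : IsRegular D κ) (hp : 0 ≤ p) {L : ℝ} (hL : 1 ≤ L) {k : ℕ} (S : Finset (Fin k))
    (i : Fin k) :
    ∫⁻ x, ∫⁻ ξ, {ξ : Fin k → U N | L < ‖ξ i‖}.indicator (fun ξ => ∏ l ∈ S, ‖ξ l‖ₑ ^ p) ξ ∂(κ k x)
      ∂(lam D k)
      ≤ volume D ^ k * mixedMoment (law D κ) (tailNorm p L) (powNorm p) (S.erase i).card := by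
  have hm := isExchangeable_law hDo hDn hDf hκ
  have hmeas : Measurable ({ξ : Fin k → U N | L < ‖ξ i‖}.indicator
      (fun ξ => ∏ l ∈ S, ‖ξ l‖ₑ ^ p)) := (measurable_prod_finset_rpow p S).indicator
    (measurableSet_lt measurable_const (measurable_pi_apply i).norm)
  rw [lintegral_lam hDo hDn hDf hκ hmeas]
  gcongr
  refine (lintegral_mono (indicator_le_tailNorm_mul hp hL S i)).trans_eq ?_
  let e : Fin ((S.erase i).card + 1) → Fin k := Fin.cons i ((S.erase i).orderEmbOfFin rfl)
  have he : Function.Injective e := by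
    refine Fin.cons_injective_iff.2 ⟨?_, ((S.erase i).orderEmbOfFin rfl).injective⟩
    rintro ⟨j, hj⟩
    have := (S.erase i).orderEmbOfFin_mem rfl j
    rw [hj] at this
    exact Finset.notMem_erase i S this
  rw [mixedMoment, ← hm.lintegral_comp he]
  · refine lintegral_congr fun ξ => ?_
    simp only [Function.comp_apply, e, Fin.cons_zero, Fin.cons_succ, coe_powNorm hp]
    rw [prod_orderEmb _ fun l => ‖ξ l‖ₑ ^ p]
  · exact measurable_prod_coord' (measurable_tailNorm p L) (measurable_powNorm p) _

end Mixed

/-- Uniform integrability of the observables of the class `MemH`. -/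
theorem eventually_lintegral_remainder_le (hDo : IsOpen D) (hDn : D.Nonempty) (hDf : volume D ≠ ∞)
    (hκ : ∀ n, IsRegular D (κ n)) (hp : 0 < p) (hmom : ∀ k, ∃ A ≠ ∞, ∀ n, mom p D (κ n) k ≤ A)
    (htail : ∀ ε ≠ 0, ∀ᶠ L in atTop, ∀ᶠ n in atTop, tail p D L (κ n) ≤ ε) {k : ℕ}
    (S : Finset (Fin k)) {Φ : (Fin Sᶜ.card → X d) → ℝ≥0∞} (hΦ : AEMeasurable Φ (lam D Sᶜ.card))
    (hΦi : ∫⁻ x, Φ x ∂(lam D Sᶜ.card) ≠ ∞) {ε : ℝ≥0∞} (hε : ε ≠ 0) :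
    ∀ᶠ L in atTop, ∀ᶠ n in atTop,
      ∫⁻ x, Φ (x ∘ Sᶜ.orderEmbOfFin rfl) * ∫⁻ ξ, {ξ : Fin k → U N | ∃ i, L < ‖ξ i‖}.indicator
        (fun ξ => ∏ i ∈ S, ‖ξ i‖ₑ ^ p) ξ ∂(κ n k x) ∂(lam D k) ≤ ε := by
  obtain ⟨A, hA, hm⟩ := hmom S.card
  have hε2 : ε / 2 ≠ 0 := ENNReal.div_ne_zero.2 ⟨hε, by simp⟩
  obtain ⟨δ, hδ, hδA⟩ := exists_mul_le hA hε2
  -- The weight Φ is split at height T. The part above T has small integral and meets a bounded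
  -- moment; the part below is replaced by the constant T, which leaves the mixed moments with one
  -- large component.
  obtain ⟨T, hT, hTδ⟩ := exists_lintegral_tail_le hΦ hΦi hδ
  obtain ⟨η, hη, hηε⟩ := exists_mul_le (C := T * (k * volume D ^ k))
    (ENNReal.mul_ne_top hT (ENNReal.mul_ne_top (by simp) (ENNReal.pow_ne_top hDf))) hε2
  have hev : ∀ᶠ L in atTop, ∀ i : Fin k, ∀ᶠ n in atTop,
      mixedMoment (law D (κ n)) (tailNorm p L) (powNorm p) (S.erase i).card ≤ η :=
    eventually_all.2 fun i => eventually_mixedMoment_le hDo hDn hDf hκ hp hmom htail _ hη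
  filter_upwards [hev, eventually_ge_atTop 1] with L hL hL1
  filter_upwards [eventually_all.2 hL] with n hn
  have := (hκ n).markov
  have hmS := measurable_prod_finset_rpow (N := N) p S
  have hmI : ∀ i : Fin k, Measurable ({ξ : Fin k → U N | L < ‖ξ i‖}.indicator
      (fun ξ => ∏ l ∈ S, ‖ξ l‖ₑ ^ p)) := fun i =>
    hmS.indicator (measurableSet_lt measurable_const (measurable_pi_apply i).norm)
  have hind : ∀ ξ : Fin k → U N, {ξ : Fin k → U N | ∃ i, L < ‖ξ i‖}.indicator
        (fun ξ => ∏ i ∈ S, ‖ξ i‖ₑ ^ p) ξ ≤ ∑ i, {ξ : Fin k → U N | L < ‖ξ i‖}.indicator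
        (fun ξ => ∏ i ∈ S, ‖ξ i‖ₑ ^ p) ξ := by
    intro ξ
    by_cases h : ∃ i, L < ‖ξ i‖
    · obtain ⟨i, hi⟩ := h
      rw [indicator_of_mem (by exact ⟨i, hi⟩)]
      refine le_trans (le_of_eq ?_) (Finset.single_le_sum (fun _ _ => bot_le) (Finset.mem_univ i))
      rw [indicator_of_mem (by exact hi)]
    · rw [indicator_of_notMem (by exact h)]
      exact bot_le
  have hpt : ∀ x : Fin k → X d, Φ (x ∘ Sᶜ.orderEmbOfFin rfl) *
      ∫⁻ ξ, {ξ : Fin k → U N | ∃ i, L < ‖ξ i‖}.indicator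
        (fun ξ => ∏ i ∈ S, ‖ξ i‖ₑ ^ p) ξ ∂(κ n k x) ≤
      (Ioi T).indicator id (Φ (x ∘ Sᶜ.orderEmbOfFin rfl)) *
        (∫⁻ ξ, ∏ i ∈ S, ‖ξ i‖ₑ ^ p ∂(κ n k x)) +
      T * ∑ i, ∫⁻ ξ, {ξ : Fin k → U N | L < ‖ξ i‖}.indicator
        (fun ξ => ∏ i ∈ S, ‖ξ i‖ₑ ^ p) ξ ∂(κ n k x) := by
    intro x
    have h1 : Φ (x ∘ Sᶜ.orderEmbOfFin rfl) ≤
        (Ioi T).indicator id (Φ (x ∘ Sᶜ.orderEmbOfFin rfl)) + T := by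
      by_cases hS : T < Φ (x ∘ Sᶜ.orderEmbOfFin rfl)
      · rw [indicator_of_mem (by exact hS)]; exact le_self_add
      · exact (not_lt.1 hS).trans le_add_self
    refine (mul_le_mul' h1 le_rfl).trans ?_
    rw [add_mul]
    gcongr
    · exact indicator_le_self _ _ _
    · rw [← lintegral_finsetSum _ fun i _ => hmI i]
      exact lintegral_mono hind
  have hmT : ∀ i, Measurable fun x => ∫⁻ ξ, {ξ : Fin k → U N | L < ‖ξ i‖}.indicator
        (fun ξ => ∏ i ∈ S, ‖ξ i‖ₑ ^ p) ξ ∂(κ n k x) := fun i => Measurable.lintegral_kernel (hmI i)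
  refine (lintegral_mono hpt).trans ?_
  rw [lintegral_add_right _ ((Finset.measurable_sum _ fun i _ => hmT i).const_mul _),
    lintegral_const_mul _ (Finset.measurable_sum _ fun i _ => hmT i),
    lintegral_finsetSum _ fun i _ => hmT i,
    lintegral_mul_prod_eq (hκ n) p S (Φ := fun x => (Ioi T).indicator id (Φ x))
      ((measurable_id.indicator measurableSet_Ioi).comp_aemeasurable hΦ)]
  calc _ ≤ δ * A + T * ∑ _i : Fin k, volume D ^ k * η := by
        gcongr with i
        · exact hm n
        · refine (lintegral_indicator_le hDo hDn hDf (hκ n) hp.le hL1 S i).trans ?_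
          gcongr
          exact hn i
    _ ≤ ε / 2 + ε / 2 := by
        gcongr
        refine le_trans (le_of_eq ?_) hηε
        simp
        ring
    _ = ε := ENNReal.add_halves ε

end UniformTails

/-! ### Oscillation of bounded observables and averaging -/

section Oscillation

/-- A bounded uniformly continuous function has small oscillation up to `p`-th powers of the
distance. -/
lemma exists_enorm_sub_le {E F : Type*} [PseudoMetricSpace E] [SeminormedAddCommGroup F] {f : E → F}
    (hf : UniformContinuous f) {B : ℝ} (hB : ∀ u, ‖f u‖ ≤ B) {p : ℝ} (hp : 0 < p)
    {ε : ℝ≥0∞} (hε : ε ≠ 0) :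
    ∃ C : ℝ≥0∞, C ≠ ∞ ∧ ∀ u v, ‖f u - f v‖ₑ ≤ ε + C * edist u v ^ p := by
  rw [Metric.uniformContinuous_iff] at hf
  obtain ⟨η, hη, hηε⟩ : ∃ η : ℝ, 0 < η ∧ ENNReal.ofReal η ≤ ε := by
    rcases eq_or_ne ε ∞ with rfl | h
    · exact ⟨1, one_pos, le_top⟩
    · exact ⟨ε.toReal, ENNReal.toReal_pos hε h, ENNReal.ofReal_toReal_le⟩
  obtain ⟨δ, hδ, h⟩ := hf η hη
  have hδ0 : ENNReal.ofReal δ ^ p ≠ 0 := by simp [hδ]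
  have hδt : ENNReal.ofReal δ ^ p ≠ ∞ := by simp [hp.le]
  -- At distances below δ the modulus of continuity suffices. At distances of at least δ the total
  -- oscillation 2B is at most 2B·(dist/δ)^p.
  refine ⟨ENNReal.ofReal (2 * B) / ENNReal.ofReal δ ^ p, ENNReal.div_ne_top ENNReal.ofReal_ne_top hδ0, ?_⟩
  intro u v
  by_cases huv : dist u v < δ
  · refine le_trans ?_ (hηε.trans le_self_add)
    rw [← edist_eq_enorm_sub, edist_dist]
    exact ENNReal.ofReal_le_ofReal (h huv).le
  · refine le_trans ?_ le_add_self
    calc ‖f u - f v‖ₑ ≤ ENNReal.ofReal (2 * B) := by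
          rw [← ofReal_norm]
          refine ENNReal.ofReal_le_ofReal ((norm_sub_le _ _).trans ?_)
          linarith [hB u, hB v]
      _ = ENNReal.ofReal (2 * B) / ENNReal.ofReal δ ^ p * ENNReal.ofReal δ ^ p :=
          (ENNReal.div_mul_cancel hδ0 hδt).symm
      _ ≤ _ := by
          gcongr
          rw [edist_dist]
          exact ENNReal.ofReal_le_ofReal (not_lt.1 huv)

lemma edist_pi_rpow_le {k : ℕ} {p : ℝ} (hp : 0 < p) (ξ ζ : Fin k → U N) :
    edist ξ ζ ^ p ≤ ∑ i, ‖ξ i - ζ i‖ₑ ^ p := by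
  rw [← ENNReal.le_rpow_inv_iff hp, edist_pi_le_iff]
  intro i
  rw [ENNReal.le_rpow_inv_iff hp, edist_eq_enorm_sub]
  exact Finset.single_le_sum (f := fun i => ‖ξ i - ζ i‖ₑ ^ p) (fun _ _ => bot_le) (Finset.mem_univ i)

end Oscillation

section Doubling

variable {D : Set (X d)}

lemma measurePreserving_append (D : Set (X d)) (k : ℕ) :
    MeasurePreserving (fun z : Fin (k + k) → X d => (z ∘ Fin.castAdd k, z ∘ Fin.natAdd k))
      (lam D (k + k)) ((lam D k).prod (lam D k)) := by
  have h1 := (measurePreserving_piCongrLeft (fun _ : Fin (k + k) => volume.restrict D)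
    (finSumFinEquiv (m := k) (n := k))).symm
  have h2 := measurePreserving_sumPiEquivProdPi (fun _ : Fin k ⊕ Fin k => volume.restrict D)
  simp only [lam_eq_pi]
  exact h2.comp h1

lemma measurable_prod_pair {b : X d × X d → ℝ≥0∞} (hb : Measurable b) (k : ℕ) :
    Measurable fun q : (Fin k → X d) × (Fin k → X d) => ∏ l, b (q.1 l, q.2 l) :=
  Finset.measurable_prod _ fun l _ => hb.comp
    (((measurable_pi_apply l).comp measurable_fst).prodMk
      ((measurable_pi_apply l).comp measurable_snd))

/-- The 2k points are regrouped into k independent pairs. -/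
lemma lintegral_lam_append {k : ℕ} (f : Fin k → X d × X d → ℝ≥0∞) (hf : ∀ l, Measurable (f l)) :
    ∫⁻ z, ∏ l, f l (z (Fin.castAdd k l), z (Fin.natAdd k l)) ∂(lam D (k + k))
      = ∏ l, ∫⁻ q, f l q ∂((volume.restrict D).prod (volume.restrict D)) := by
  rw [← lintegral_pi_prod _ f hf]
  have h := measurePreserving_arrowProdEquivProdArrow (X d) (X d) (Fin k)
    (fun _ => volume.restrict D) (fun _ => volume.restrict D)
  simp only [← lam_eq_pi] at h
  have hm : Measurable fun q : (Fin k → X d) × (Fin k → X d) => ∏ l, f l (q.1 l, q.2 l) :=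
    Finset.measurable_prod _ fun l _ => (hf l).comp
      (((measurable_pi_apply l).comp measurable_fst).prodMk
        ((measurable_pi_apply l).comp measurable_snd))
  exact ((measurePreserving_append D k).lintegral_comp hm).trans (h.lintegral_comp hm).symm

variable {b : X d × X d → ℝ≥0∞}

lemma lintegral_pair_eq (hDm : MeasurableSet D) (hb : Measurable b)
    (hb1 : ∀ x ∈ D, ∫⁻ y in D, b (x, y) = 1) :
    ∫⁻ q, b q ∂((volume.restrict D).prod (volume.restrict D)) = volume D := by
  rw [lintegral_prod _ hb.aemeasurable, setLIntegral_congr_fun hDm hb1]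
  simp

/-- The average of a function of the `i`-th pair of points. -/
lemma lintegral_average_coord (hDm : MeasurableSet D) (hb : Measurable b)
    (hb1 : ∀ x ∈ D, ∫⁻ y in D, b (x, y) = 1) {k : ℕ} (i : Fin k) {h : (Fin 2 → X d) → ℝ≥0∞}
    (hh : Measurable h) :
    ∫⁻ z, (∏ l, b (z (Fin.castAdd k l), z (Fin.natAdd k l))) *
        h ![z (Fin.castAdd k i), z (Fin.natAdd k i)] ∂(lam D (k + k))
      = volume D ^ (k - 1) * ∫⁻ z, b (z 0, z 1) * h z ∂(lam D 2) := by
  have hvec : Measurable fun q : X d × X d => ![q.1, q.2] :=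
    measurable_pi_iff.2 fun j => by fin_cases j; exacts [measurable_fst, measurable_snd]
  have hbh : Measurable fun q : X d × X d => b q * h ![q.1, q.2] := hb.mul (hh.comp hvec)
  have e := lintegral_lam_append (D := D) (fun l => if l = i then fun q => b q * h ![q.1, q.2] else b)
    (fun l => by split_ifs; exacts [hbh, hb])
  have e2 : ∀ z : Fin (k + k) → X d, ∏ l, (if l = i then fun q => b q * h ![q.1, q.2] else b)
      (z (Fin.castAdd k l), z (Fin.natAdd k l)) =
      (∏ l, b (z (Fin.castAdd k l), z (Fin.natAdd k l))) *
        h ![z (Fin.castAdd k i), z (Fin.natAdd k i)] := by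
    intro z
    rw [← Finset.mul_prod_erase _ _ (Finset.mem_univ i), if_pos rfl,
      ← Finset.mul_prod_erase _ (fun l => b (z (Fin.castAdd k l), z (Fin.natAdd k l)))
        (Finset.mem_univ i), mul_right_comm]
    congr 2
    refine Finset.prod_congr rfl fun l hl => ?_
    rw [if_neg (Finset.ne_of_mem_erase hl)]
  simp only [e2] at e
  rw [e, ← Finset.mul_prod_erase _ _ (Finset.mem_univ i), if_pos rfl, mul_comm]
  congr 1
  · rw [Finset.prod_congr rfl fun l hl => by rw [if_neg (Finset.ne_of_mem_erase hl)],
      Finset.prod_const, lintegral_pair_eq hDm hb hb1, Finset.card_erase_of_mem (Finset.mem_univ i)]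
    simp
  · rw [← (measurePreserving_vecTwo D).lintegral_comp]
    · rfl
    · exact (hb.comp ((measurable_pi_apply 0).prodMk (measurable_pi_apply 1))).mul hh

lemma lintegral_average_one (hDm : MeasurableSet D) (hb : Measurable b)
    (hb1 : ∀ x ∈ D, ∫⁻ y in D, b (x, y) = 1) (k : ℕ) :
    ∫⁻ z, ∏ l, b (z (Fin.castAdd k l), z (Fin.natAdd k l)) ∂(lam D (k + k)) = volume D ^ k := by
  rw [lintegral_lam_append (fun _ => b) fun _ => hb]
  simp [lintegral_pair_eq hDm hb hb1]

variable {κ : KerFam d N}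

/-- The kernel at 2k points is a coupling of the kernels at its first and last k points. -/
lemma IsRegular.enorm_integral_sub_le (hκ : IsRegular D κ) {k : ℕ} (f : (Fin k → U N) →ᵇ ℝ) :
    ∀ᵐ z ∂(lam D (k + k)), ‖(∫ ξ, f ξ ∂(κ k (z ∘ Fin.castAdd k))) -
      ∫ ξ, f ξ ∂(κ k (z ∘ Fin.natAdd k))‖ₑ ≤
        ∫⁻ ξ, ‖f (ξ ∘ Fin.castAdd k) - f (ξ ∘ Fin.natAdd k)‖ₑ ∂(κ (k + k) z) := by
  have := hκ.markov
  filter_upwards [hκ.marg _ (Fin.castAdd_injective k k), hκ.marg _ (Fin.natAdd_injective k k)]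
    with z h1 h2
  have hi : ∀ e : Fin k → Fin (k + k), Integrable (fun ξ => f (ξ ∘ e)) (κ (k + k) z) := fun e =>
    (f.compContinuous ⟨fun ξ : Fin (k + k) → U N => ξ ∘ e, by fun_prop⟩).integrable _
  rw [← h1, ← h2, integral_map (measurable_comp_right _).aemeasurable
    f.continuous.aestronglyMeasurable, integral_map (measurable_comp_right _).aemeasurable
    f.continuous.aestronglyMeasurable, ← integral_sub (hi _) (hi _)]
  exact enorm_integral_le_lintegral_enorm _

/-- The oscillation of an observable is controlled by the modulus of continuity. -/
theorem lintegral_average_osc_le (hDm : MeasurableSet D) (hκ : IsRegular D κ) {p : ℝ}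
    {k : ℕ} (f : (Fin k → U N) →ᵇ ℝ) {ε C : ℝ≥0∞}
    (hf : ∀ ξ ζ, ‖f ξ - f ζ‖ₑ ≤ ε + C * ∑ i, ‖ξ i - ζ i‖ₑ ^ p) (hb : Measurable b)
    (hb1 : ∀ x ∈ D, ∫⁻ y in D, b (x, y) = 1) :
    ∫⁻ z, (∏ l, b (z (Fin.castAdd k l), z (Fin.natAdd k l))) *
      ‖(∫ ξ, f ξ ∂(κ k (z ∘ Fin.castAdd k))) - ∫ ξ, f ξ ∂(κ k (z ∘ Fin.natAdd k))‖ₑ ∂(lam D (k + k))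
      ≤ ε * volume D ^ k + C * (k * (volume D ^ (k - 1) *
        ∫⁻ z, b (z 0, z 1) * ∫⁻ ξ, ‖ξ 0 - ξ 1‖ₑ ^ p ∂(κ 2 z) ∂(lam D 2))) := by
  have := hκ.markov
  have hBm : Measurable fun z : Fin (k + k) → X d =>
      ∏ l, b (z (Fin.castAdd k l), z (Fin.natAdd k l)) :=
    Finset.measurable_prod _ fun l _ => hb.comp
      ((measurable_pi_apply _).prodMk (measurable_pi_apply _))
  have hd2 := measurable_lintegral_diff p κ
  have hdm : ∀ i : Fin k, Measurable fun z : Fin (k + k) → X d =>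
      ∫⁻ ξ, ‖ξ 0 - ξ 1‖ₑ ^ p ∂(κ 2 ![z (Fin.castAdd k i), z (Fin.natAdd k i)]) := fun i =>
    hd2.comp (measurable_pi_iff.2 fun j => by
      fin_cases j; exacts [measurable_pi_apply _, measurable_pi_apply _])
  -- The marginal of the coupling on the i-th pair of points is the two-point correlation there,
  -- which is where ω_r enters.
  have hpair : ∀ᵐ z ∂(lam D (k + k)), ∀ i : Fin k,
      ∫⁻ ξ, ‖ξ (Fin.castAdd k i) - ξ (Fin.natAdd k i)‖ₑ ^ p ∂(κ (k + k) z) =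
      ∫⁻ ξ, ‖ξ 0 - ξ 1‖ₑ ^ p ∂(κ 2 ![z (Fin.castAdd k i), z (Fin.natAdd k i)]) := by
    refine ae_all_iff.2 fun i => ?_
    have hinj : Function.Injective ![Fin.castAdd k i, Fin.natAdd k i] := by
      have hne : Fin.castAdd k i ≠ Fin.natAdd k i := by
        rw [Ne, Fin.ext_iff, Fin.val_castAdd, Fin.val_natAdd]
        omega
      intro a c hac
      fin_cases a <;> fin_cases c
      exacts [rfl, (hne hac).elim, (hne hac.symm).elim, rfl]
    filter_upwards [hκ.lintegral_comp hinj] with z hz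
    have := hz _ (measurable_diff_rpow p 0 1)
    have e : z ∘ ![Fin.castAdd k i, Fin.natAdd k i] = ![z (Fin.castAdd k i), z (Fin.natAdd k i)] := by
      funext j
      fin_cases j <;> rfl
    rwa [e] at this
  calc _ ≤ ∫⁻ z, (ε * (∏ l, b (z (Fin.castAdd k l), z (Fin.natAdd k l))) + C * ∑ i : Fin k,
        (∏ l, b (z (Fin.castAdd k l), z (Fin.natAdd k l))) * ∫⁻ ξ, ‖ξ 0 - ξ 1‖ₑ ^ p
          ∂(κ 2 ![z (Fin.castAdd k i), z (Fin.natAdd k i)])) ∂(lam D (k + k)) := by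
        refine lintegral_mono_ae ?_
        filter_upwards [hpair, hκ.enorm_integral_sub_le f] with z hz hz2
        calc _ ≤ (∏ l, b (z (Fin.castAdd k l), z (Fin.natAdd k l))) *
              ∫⁻ ξ, (ε + C * ∑ i, ‖ξ (Fin.castAdd k i) - ξ (Fin.natAdd k i)‖ₑ ^ p)
                ∂(κ (k + k) z) := by
              gcongr
              exact hz2.trans (lintegral_mono fun ξ => hf _ _)
          _ = _ := by
              rw [lintegral_add_left measurable_const, lintegral_const, measure_univ, mul_one,
                lintegral_const_mul _ (Finset.measurable_sum _ fun i _ => measurable_diff_rpow p _ _),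
                lintegral_finsetSum _ fun i _ => measurable_diff_rpow p _ _, mul_add,
                ← Finset.mul_sum]
              simp only [hz]
              ring
    _ = _ := by
        have hm : ∀ i : Fin k, Measurable fun z : Fin (k + k) → X d =>
            (∏ l, b (z (Fin.castAdd k l), z (Fin.natAdd k l))) * ∫⁻ ξ, ‖ξ 0 - ξ 1‖ₑ ^ p
              ∂(κ 2 ![z (Fin.castAdd k i), z (Fin.natAdd k i)]) := fun i => hBm.mul (hdm i)
        rw [lintegral_add_left (hBm.const_mul _), lintegral_const_mul _ hBm,
          lintegral_average_one hDm hb hb1,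
          lintegral_const_mul _ (Finset.measurable_sum _ fun i _ => hm i),
          lintegral_finsetSum _ fun i _ => hm i]
        simp only [lintegral_average_coord hDm hb hb1 _ hd2]
        simp

end Doubling

section Averages

variable {D : Set (X d)} {b : X d × X d → ℝ≥0∞}

lemma isFiniteMeasure_lam (hDf : volume D ≠ ∞) (k : ℕ) : IsFiniteMeasure (lam D k) := by
  have : IsFiniteMeasure (volume.restrict D) := ⟨by simpa using hDf.lt_top⟩
  rw [lam_eq_pi]
  infer_instance

/-- The weight of an average over all components. -/
noncomputable def avgKer (b : X d × X d → ℝ≥0∞) {k : ℕ} (x y : Fin k → X d) : ℝ≥0∞ :=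
  ∏ l, b (x l, y l)

lemma measurable_avgKer (hb : Measurable b) {k : ℕ} :
    Measurable fun q : (Fin k → X d) × (Fin k → X d) => avgKer b q.1 q.2 :=
  measurable_prod_pair hb k

lemma lintegral_avgKer (hb : Measurable b) (hb1 : ∀ x ∈ D, ∫⁻ y in D, b (x, y) = 1) {k : ℕ}
    {x : Fin k → X d} (hx : x ∈ prodDom D k) : ∫⁻ y, avgKer b x y ∂(lam D k) = 1 := by
  rw [lam_eq_pi]
  refine (lintegral_pi_prod _ (fun l y => b (x l, y)) fun l =>
    hb.comp measurable_prodMk_left).trans ?_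
  exact Finset.prod_eq_one fun l _ => hb1 _ (hx l (mem_univ l))

lemma integrable_avgKer (hb : Measurable b) (hb1 : ∀ x ∈ D, ∫⁻ y in D, b (x, y) = 1) {k : ℕ}
    {x : Fin k → X d} (hx : x ∈ prodDom D k) :
    Integrable (fun y => (avgKer b x y).toReal) (lam D k) :=
  integrable_toReal_of_lintegral_ne_top
    ((measurable_avgKer hb).comp measurable_prodMk_left).aemeasurable
    (by rw [lintegral_avgKer hb hb1 hx]; simp)

lemma integral_avgKer (hb : Measurable b) (hb1 : ∀ x ∈ D, ∫⁻ y in D, b (x, y) = 1) {k : ℕ}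
    {x : Fin k → X d} (hx : x ∈ prodDom D k) : ∫ y, (avgKer b x y).toReal ∂(lam D k) = 1 := by
  have hm : Measurable fun y => avgKer b x y := (measurable_avgKer hb).comp measurable_prodMk_left
  rw [integral_toReal hm.aemeasurable (ae_lt_top hm (by rw [lintegral_avgKer hb hb1 hx]; simp)),
    lintegral_avgKer hb hb1 hx]
  rfl

/-- The weight has mass one, so G(x) is the average of the constant G(x) and the difference moves
under the integral. -/
lemma enorm_sub_average_le (hb : Measurable b) (hb1 : ∀ x ∈ D, ∫⁻ y in D, b (x, y) = 1) {k : ℕ}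
    {x : Fin k → X d} (hx : x ∈ prodDom D k) {G : (Fin k → X d) → ℝ} (hG : Measurable G) {c : ℝ}
    (hc : ∀ y, |G y| ≤ c) :
    ‖G x - ∫ y, (avgKer b x y).toReal * G y ∂(lam D k)‖ₑ
      ≤ ∫⁻ y, avgKer b x y * ‖G x - G y‖ₑ ∂(lam D k) := by
  have hi := integrable_avgKer hb hb1 hx
  have e : G x - ∫ y, (avgKer b x y).toReal * G y ∂(lam D k)
      = ∫ y, (avgKer b x y).toReal * (G x - G y) ∂(lam D k) := by
    simp only [mul_sub]
    rw [integral_sub (hi.mul_const _) (hi.mul_bdd (c := c) hG.aestronglyMeasurable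
      (ae_of_all _ hc)), integral_mul_const, integral_avgKer hb hb1 hx, one_mul]
  rw [e]
  refine (enorm_integral_le_lintegral_enorm _).trans (lintegral_mono fun y => ?_)
  rw [enorm_mul]
  gcongr
  rw [Real.enorm_of_nonneg ENNReal.toReal_nonneg]
  exact ENNReal.ofReal_toReal_le

lemma lintegral_enorm_sub_average_le (hDm : MeasurableSet D) (hb : Measurable b)
    (hb1 : ∀ x ∈ D, ∫⁻ y in D, b (x, y) = 1) {k : ℕ} {G : (Fin k → X d) → ℝ} (hG : Measurable G)
    {c : ℝ} (hc : ∀ y, |G y| ≤ c) :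
    ∫⁻ x, ‖G x - ∫ y, (avgKer b x y).toReal * G y ∂(lam D k)‖ₑ ∂(lam D k)
      ≤ ∫⁻ z, (∏ l, b (z (Fin.castAdd k l), z (Fin.natAdd k l))) *
        ‖G (z ∘ Fin.castAdd k) - G (z ∘ Fin.natAdd k)‖ₑ ∂(lam D (k + k)) := by
  have hm : Measurable fun q : (Fin k → X d) × (Fin k → X d) =>
      avgKer b q.1 q.2 * ‖G q.1 - G q.2‖ₑ :=
    (measurable_avgKer hb).mul ((hG.comp measurable_fst).sub (hG.comp measurable_snd)).enorm
  refine le_trans ?_ ((measurePreserving_append D k).lintegral_comp hm).symm.le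
  rw [lintegral_prod _ hm.aemeasurable]
  exact setLIntegral_mono_ae' (measurableSet_prodDom hDm k) (ae_of_all _ fun x hx =>
    enorm_sub_average_le hb hb1 hx hG hc)

end Averages

/-! ### From stable to strong convergence -/

section Strong

variable {D : Set (X d)} {κ : ℕ → KerFam d N} {κ₀ : KerFam d N} {p : ℝ}

lemma measurable_average (hDf : volume D ≠ ∞) {b : X d × X d → ℝ≥0∞} (hb : Measurable b) {k : ℕ}
    (f : (Fin k → U N) →ᵇ ℝ) (ζ : Kernel (Fin k → X d) (Fin k → U N)) :
    Measurable fun x => ∫ y, (avgKer b x y).toReal * ∫ ξ, f ξ ∂(ζ y) ∂(lam D k) := by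
  have := isFiniteMeasure_lam hDf k
  have h : StronglyMeasurable fun q : (Fin k → X d) × (Fin k → X d) =>
      (avgKer b q.1 q.2).toReal * ∫ ξ, f ξ ∂(ζ q.2) :=
    ((measurable_avgKer hb).ennreal_toReal.mul
      ((measurable_integral_bcf ζ f).comp measurable_snd)).stronglyMeasurable
  exact (StronglyMeasurable.integral_prod_right' (ν := lam D k) h).measurable

lemma lintegral_enorm_sub_le_add {α : Type*} [MeasurableSpace α] {μ : Measure α}
    {G G₀ T T₀ : α → ℝ} (hG : Measurable G) (hT : Measurable T)
    (hT₀ : Measurable T₀) :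
    ∫⁻ x, ‖G x - G₀ x‖ₑ ∂μ ≤ ∫⁻ x, ‖G x - T x‖ₑ ∂μ +
      (∫⁻ x, ‖T x - T₀ x‖ₑ ∂μ + ∫⁻ x, ‖G₀ x - T₀ x‖ₑ ∂μ) := by
  have m1 : Measurable fun x => ‖G x - T x‖ₑ := (hG.sub hT).enorm
  have m2 : Measurable fun x => ‖T x - T₀ x‖ₑ := (hT.sub hT₀).enorm
  rw [← lintegral_add_left m2, ← lintegral_add_left m1]
  refine lintegral_mono fun x => ?_
  simp only [← edist_eq_enorm_sub]
  exact (edist_triangle _ _ _).trans (add_le_add le_rfl ((edist_triangle _ _ _).trans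
    (add_le_add le_rfl (edist_comm _ _).le)))

/-- For fixed x the averaging weight is integrable in y, so stable convergence gives pointwise
convergence of the averages. They are bounded by ‖f‖ on a set of finite measure, and dominated
convergence applies. -/
lemma tendsto_lintegral_average (hDf : volume D ≠ ∞) (hDm : MeasurableSet D)
    (hκ : ∀ n, IsRegular D (κ n)) (hκ₀ : IsRegular D κ₀)
    {k : ℕ} (hst : StableTendsto (lam D k) (fun n => κ n k) (κ₀ k)) {b : X d × X d → ℝ≥0∞}
    (hb : Measurable b) (hb1 : ∀ x ∈ D, ∫⁻ y in D, b (x, y) = 1) (f : (Fin k → U N) →ᵇ ℝ) :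
    Tendsto (fun n => ∫⁻ x, ‖(∫ y, (avgKer b x y).toReal * ∫ ξ, f ξ ∂(κ n k y) ∂(lam D k)) -
      ∫ y, (avgKer b x y).toReal * ∫ ξ, f ξ ∂(κ₀ k y) ∂(lam D k)‖ₑ ∂(lam D k)) atTop (𝓝 0) := by
  have := isFiniteMeasure_lam hDf k
  have := fun n => (hκ n).markov k
  have := hκ₀.markov k
  have hmeas := measurable_average hDf hb (k := k) f
  have hbd : ∀ (ζ : Kernel (Fin k → X d) (Fin k → U N)) [IsMarkovKernel ζ], ∀ x ∈ prodDom D k,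
      |∫ y, (avgKer b x y).toReal * ∫ ξ, f ξ ∂(ζ y) ∂(lam D k)| ≤ ‖f‖ := by
    intro ζ _ x hx
    have hi := integrable_avgKer hb hb1 hx
    calc |∫ y, (avgKer b x y).toReal * ∫ ξ, f ξ ∂(ζ y) ∂(lam D k)|
        ≤ ∫ y, (avgKer b x y).toReal * ‖f‖ ∂(lam D k) := by
          rw [← Real.norm_eq_abs]
          refine norm_integral_le_of_norm_le (hi.mul_const _) (ae_of_all _ fun y => ?_)
          rw [norm_mul, Real.norm_of_nonneg ENNReal.toReal_nonneg]
          gcongr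
          exact abs_integral_bcf_le ζ f y
      _ = ‖f‖ := by rw [integral_mul_const, integral_avgKer hb hb1 hx, one_mul]
  have hD := measurableSet_prodDom hDm k
  rw [← lintegral_zero (μ := lam D k)]
  refine tendsto_lintegral_of_dominated_convergence' (fun _ => ENNReal.ofReal (2 * ‖f‖))
    (fun n => ((hmeas _).sub (hmeas _)).enorm.aemeasurable) (fun n => ?_) ?_ ?_
  · filter_upwards [ae_restrict_mem hD] with x hx
    rw [← ofReal_norm]
    refine ENNReal.ofReal_le_ofReal ((norm_sub_le _ _).trans ?_)
    rw [two_mul]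
    exact add_le_add (hbd _ x hx) (hbd _ x hx)
  · rw [lintegral_const]
    exact ENNReal.mul_ne_top ENNReal.ofReal_ne_top (measure_ne_top _ _)
  · filter_upwards [ae_restrict_mem hD] with x hx
    have h := hst _ (integrable_avgKer hb hb1 hx) f
    rw [← enorm_zero (E := ℝ)]
    refine (continuous_enorm.tendsto _).comp ?_
    simpa using h.sub_const (∫ y, (avgKer b x y).toReal * ∫ ξ, f ξ ∂(κ₀ k y) ∂(lam D k))

/-- Strong convergence of the expected values of uniformly continuous bounded observables. -/
theorem tendsto_lintegral_of_uniformContinuous (hDo : IsOpen D) (hDf : volume D ≠ ∞)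
    (hp : 0 < p) (hκ : ∀ n, IsRegular D (κ n)) (hκ₀ : IsRegular D κ₀)
    {k : ℕ} (hst : StableTendsto (lam D k) (fun n => κ n k) (κ₀ k))
    (hdc : ∀ δ ≠ 0, ∃ r > 0, (∀ᶠ n in atTop, modCont p D r (κ n).toFam ≤ δ) ∧
      modCont p D r κ₀.toFam ≤ δ)
    (f : (Fin k → U N) →ᵇ ℝ) (hf : UniformContinuous f) :
    Tendsto (fun n => ∫⁻ x, ‖(∫ ξ, f ξ ∂(κ n k x)) - ∫ ξ, f ξ ∂(κ₀ k x)‖ₑ ∂(lam D k)) atTop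
      (𝓝 0) := by
  have hDm := hDo.measurableSet
  rw [ENNReal.tendsto_nhds_zero]
  intro η hη
  have hη6 : η / 3 / 2 ≠ 0 :=
    -- Each of the two families is compared with its average at cost η/3, half for ε and half for
    -- the modulus; the last third is the distance between the averages.
    ENNReal.div_ne_zero.2 ⟨ENNReal.div_ne_zero.2 ⟨hη.ne', by simp⟩, by simp⟩
  obtain ⟨ε, hε, hεη⟩ := exists_mul_le (C := volume D ^ k) (ENNReal.pow_ne_top hDf) hη6
  obtain ⟨C, hC, hCf⟩ := exists_enorm_sub_le hf f.norm_coe_le_norm hp hε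
  have hCf' : ∀ ξ ζ, ‖f ξ - f ζ‖ₑ ≤ ε + C * ∑ i, ‖ξ i - ζ i‖ₑ ^ p := fun ξ ζ =>
    (hCf ξ ζ).trans (by gcongr; exact edist_pi_rpow_le hp ξ ζ)
  obtain ⟨δ, hδ, hδη⟩ := exists_mul_le (C := C * (k * volume D ^ (k - 1)))
    (ENNReal.mul_ne_top hC (ENNReal.mul_ne_top (by simp) (ENNReal.pow_ne_top hDf))) hη6
  obtain ⟨r, hr, hrn, hr0⟩ := hdc δ hδ
  let b : X d × X d → ℝ≥0∞ := fun q => ballKer D r q.1 q.2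
  have hb : Measurable b := measurable_ballKer hDm r
  have hb1 : ∀ x ∈ D, ∫⁻ y in D, b (x, y) = 1 := fun x hx => lintegral_ballKer hDo hDf hr hx
  have hosc : ∀ ζ : KerFam d N, IsRegular D ζ → modCont p D r ζ.toFam ≤ δ →
      ∫⁻ x, ‖(∫ ξ, f ξ ∂(ζ k x)) - ∫ y, (avgKer b x y).toReal * ∫ ξ, f ξ ∂(ζ k y) ∂(lam D k)‖ₑ
        ∂(lam D k) ≤ η / 3 := by
    intro ζ hζ hζr
    have := hζ.markov
    rw [modCont_eq_lintegral p hDm] at hζr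
    refine (lintegral_enorm_sub_average_le hDm hb hb1 (measurable_integral_bcf (ζ k) f)
      (abs_integral_bcf_le (ζ k) f)).trans
      ((lintegral_average_osc_le hDm hζ f hCf' hb hb1).trans ?_)
    calc _ ≤ ε * volume D ^ k + C * (k * (volume D ^ (k - 1) * δ)) := by gcongr
      _ = ε * volume D ^ k + δ * (C * (k * volume D ^ (k - 1))) := by ring
      _ ≤ η / 3 / 2 + η / 3 / 2 := add_le_add hεη hδη
      _ = η / 3 := ENNReal.add_halves _
  have hmid := (ENNReal.tendsto_nhds_zero.1
    (tendsto_lintegral_average hDf hDm hκ hκ₀ hst hb hb1 f)) (η / 3)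
    (ENNReal.div_pos hη.ne' (by simp))
  have hmeas := measurable_average hDf hb (k := k) f
  filter_upwards [hrn, hmid] with n hn hmn
  have hG := measurable_integral_bcf (κ n k) f
  have hT := hmeas (κ n k)
  have hT0 := hmeas (κ₀ k)
  have h1 := hosc (κ n) (hκ n) hn
  have h0 := hosc κ₀ hκ₀ hr0
  calc _ ≤ η / 3 + (η / 3 + η / 3) := (lintegral_enorm_sub_le_add hG hT hT0).trans
        (add_le_add h1 (add_le_add hmn h0))
    _ = η := by rw [← add_assoc, ENNReal.add_thirds]

end Strong

section Gap

variable {α Y : Type*} [MeasurableSpace α] [MetricSpace Y] [ProperSpace Y] [MeasurableSpace Y]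
  [BorelSpace Y]

lemma enorm_integral_sub_zeroAtInfty_le (m : Measure Y) [IsProbabilityMeasure m] (f g : C₀(Y, ℝ)) :
    ‖(∫ y, f y ∂m) - ∫ y, g y ∂m‖ₑ ≤ ‖f - g‖ₑ := by
  rw [← integral_sub (integrable_zeroAtInfty m f) (integrable_zeroAtInfty m g), ← ofReal_norm,
    ← ofReal_norm]
  exact ENNReal.ofReal_le_ofReal (abs_integral_zeroAtInfty_le m (f - g))

/-- Strong convergence passes from the functions in `C₀` to the Bochner integrable ones. -/
theorem tendsto_lintegral_zeroAtInfty {μ : Measure α} {κ : ℕ → Kernel α Y} {κ₀ : Kernel α Y}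
    [∀ n, IsMarkovKernel (κ n)] [IsMarkovKernel κ₀]
    (h : ∀ f : C₀(Y, ℝ), Tendsto (fun n => ∫⁻ x, ‖(∫ y, f y ∂(κ n x)) - ∫ y, f y ∂(κ₀ x)‖ₑ ∂μ)
      atTop (𝓝 0)) {g : α → C₀(Y, ℝ)} (hg : Integrable g μ) :
    Tendsto (fun n => ∫⁻ x, ‖(∫ y, g x y ∂(κ n x)) - ∫ y, g x y ∂(κ₀ x)‖ₑ ∂μ) atTop (𝓝 0) := by
  refine hg.induction (P := fun g : α → C₀(Y, ℝ) => Tendsto (fun n => ∫⁻ x, ‖(∫ y, g x y ∂(κ n x)) -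
    ∫ y, g x y ∂(κ₀ x)‖ₑ ∂μ) atTop (𝓝 0)) ?_ ?_ ?_ ?_
  · intro c s hs hμs
    refine tendsto_of_tendsto_of_tendsto_of_le_of_le tendsto_const_nhds (h c) (fun _ => bot_le)
      fun n => lintegral_mono fun x => ?_
    by_cases hx : x ∈ s <;> simp [hx]
  · intro f g _ hf hg hPf hPg
    have hs := hPf.add hPg
    rw [add_zero] at hs
    refine tendsto_of_tendsto_of_tendsto_of_le_of_le tendsto_const_nhds hs (fun _ => bot_le)
      fun n => ?_
    have hm : AEMeasurable (fun x => ‖(∫ y, f x y ∂(κ n x)) - ∫ y, f x y ∂(κ₀ x)‖ₑ) μ :=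
      ((aestronglyMeasurable_integral_zeroAtInfty hf.1 (κ n)).sub
        (aestronglyMeasurable_integral_zeroAtInfty hf.1 κ₀)).enorm
    simp only
    rw [← lintegral_add_left' hm]
    refine lintegral_mono fun x => ?_
    have e : ∀ (ζ : Kernel α Y) [IsMarkovKernel ζ], ∫ y, (f + g) x y ∂(ζ x)
        = ∫ y, f x y ∂(ζ x) + ∫ y, g x y ∂(ζ x) := fun ζ _ =>
      integral_add (integrable_zeroAtInfty _ (f x)) (integrable_zeroAtInfty _ (g x))
    rw [e, e, add_sub_add_comm]
    exact enorm_add_le _ _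
  -- Replacing f by g costs their L¹ distance once for each of the two kernels, whatever n is.
  · refine isClosed_of_closure_subset fun f hf => ?_
    refine ENNReal.tendsto_nhds_zero.2 fun ε hε => ?_
    have hε3 : 0 < ε / 3 := ENNReal.div_pos hε.ne' (by simp)
    obtain ⟨g, hgP, hfg⟩ := EMetric.mem_closure_iff.1 hf (ε / 3) hε3
    have hfi := L1.integrable_coeFn f
    have hgi := L1.integrable_coeFn g
    have hd : ∫⁻ x, ‖f x - g x‖ₑ ∂μ ≤ ε / 3 := by
      rw [L1.edist_def] at hfg
      simpa only [edist_eq_enorm_sub] using hfg.le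
    filter_upwards [ENNReal.tendsto_nhds_zero.1 hgP (ε / 3) hε3] with n hn
    have hm1 : AEMeasurable (fun x => ‖f x - g x‖ₑ) μ := (hfi.1.sub hgi.1).enorm
    have hm2 : AEMeasurable (fun x => ‖(∫ y, g x y ∂(κ n x)) - ∫ y, g x y ∂(κ₀ x)‖ₑ) μ :=
      ((aestronglyMeasurable_integral_zeroAtInfty hgi.1 (κ n)).sub
        (aestronglyMeasurable_integral_zeroAtInfty hgi.1 κ₀)).enorm
    calc ∫⁻ x, ‖(∫ y, f x y ∂(κ n x)) - ∫ y, f x y ∂(κ₀ x)‖ₑ ∂μ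
        ≤ ∫⁻ x, (‖f x - g x‖ₑ + (‖(∫ y, g x y ∂(κ n x)) - ∫ y, g x y ∂(κ₀ x)‖ₑ + ‖f x - g x‖ₑ))
            ∂μ := by
          refine lintegral_mono fun x => ?_
          refine le_trans ?_ (add_le_add (enorm_integral_sub_zeroAtInfty_le (κ n x) (f x) (g x))
            (add_le_add le_rfl (enorm_integral_sub_zeroAtInfty_le (κ₀ x) (f x) (g x))))
          simp only [← edist_eq_enorm_sub]
          exact (edist_triangle _ _ _).trans (add_le_add le_rfl ((edist_triangle _ _ _).trans
            (add_le_add le_rfl (edist_comm _ _).le)))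
      _ = ∫⁻ x, ‖f x - g x‖ₑ ∂μ + (∫⁻ x, ‖(∫ y, g x y ∂(κ n x)) - ∫ y, g x y ∂(κ₀ x)‖ₑ ∂μ +
            ∫⁻ x, ‖f x - g x‖ₑ ∂μ) := by
          rw [lintegral_add_left' hm1, lintegral_add_left' hm2]
      _ ≤ ε / 3 + (ε / 3 + ε / 3) := add_le_add hd (add_le_add hn hd)
      _ = ε := by rw [← add_assoc, ENNReal.add_thirds]
  · intro f g hfg _ hP
    refine hP.congr fun n => lintegral_congr_ae ?_
    filter_upwards [hfg] with x hx
    rw [hx]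

end Gap

/-! ### Truncation of Carathéodory functions -/

section Caratheodory

variable {α : Type*} [MeasurableSpace α]

/-- Balls form a basis, and by second countability they generate the Borel σ-algebra. This is used
below for C(K) and for L^p. -/
lemma measurable_of_measurable_dist {E : Type*} [PseudoMetricSpace E] [SecondCountableTopology E]
    [MeasurableSpace E] [BorelSpace E] {F : α → E} (hF : ∀ h, Measurable fun x => dist (F x) h) :
    Measurable F := by
  have hb : TopologicalSpace.IsTopologicalBasis {U : Set E | ∃ h r, U = Metric.ball h r} := by
    refine TopologicalSpace.isTopologicalBasis_of_isOpen_of_nhds ?_ ?_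
    · rintro _ ⟨h, r, rfl⟩
      exact Metric.isOpen_ball
    · intro h U hhU hU
      obtain ⟨r, hr, hrU⟩ := Metric.isOpen_iff.1 hU h hhU
      exact ⟨_, ⟨h, r, rfl⟩, Metric.mem_ball_self hr, hrU⟩
  obtain rfl := (BorelSpace.measurable_eq (α := E)).trans hb.borel_eq_generateFrom
  refine measurable_generateFrom ?_
  rintro _ ⟨h, r, rfl⟩
  exact measurableSet_lt (hF h) measurable_const

/-- A bound on the supremum distance of continuous functions needs checking only on a countable
dense set. -/
lemma stronglyMeasurable_of_eval {K : Type*} [TopologicalSpace K] [CompactSpace K]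
    [SecondCountableTopology C(K, ℝ)] {s : ℕ → K} (hs : DenseRange s) {F : α → C(K, ℝ)}
    (hF : ∀ i, Measurable fun x => F x (s i)) : StronglyMeasurable F := by
  borelize C(K, ℝ)
  refine Measurable.stronglyMeasurable ?_
  have hdist : ∀ h : C(K, ℝ), Measurable fun x => dist (F x) h := by
    intro h
    refine measurable_of_Iic fun c => ?_
    rcases lt_or_ge c 0 with hc | hc
    · convert MeasurableSet.empty
      ext x
      simpa using hc.trans_le dist_nonneg
    · have : (fun x => dist (F x) h) ⁻¹' Iic c = ⋂ i, {x | dist (F x (s i)) (h (s i)) ≤ c} := by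
        ext x
        simp only [mem_preimage, mem_Iic, mem_iInter, mem_ofPred_eq]
        rw [ContinuousMap.dist_le hc]
        refine ⟨fun H i => H _, fun H y => ?_⟩
        refine hs.induction_on (p := fun y => dist (F x y) (h y) ≤ c) y ?_ H
        exact isClosed_le ((F x).continuous.dist h.continuous) continuous_const
      rw [this]
      exact MeasurableSet.iInter fun i =>
        measurableSet_le ((hF i).dist measurable_const) measurable_const
  exact measurable_of_measurable_dist hdist

variable {E : Type*} [NormedAddCommGroup E] [NormedSpace ℝ E] [ProperSpace E]

/-- A continuous cutoff function. -/
noncomputable def cutoff (L : ℝ) (ξ : E) : ℝ := max 0 (min 1 (L + 1 - ‖ξ‖))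

lemma continuous_cutoff (L : ℝ) : Continuous (cutoff L : E → ℝ) :=
  continuous_const.max (continuous_const.min (continuous_const.sub continuous_norm))

lemma cutoff_eq_one {L : ℝ} {ξ : E} (h : ‖ξ‖ ≤ L) : cutoff L ξ = 1 := by
  rw [cutoff, min_eq_left (by linarith), max_eq_right zero_le_one]

lemma cutoff_eq_zero {L : ℝ} {ξ : E} (h : L + 1 ≤ ‖ξ‖) : cutoff L ξ = 0 :=
  max_eq_left ((min_le_right _ _).trans (by linarith))

lemma abs_cutoff_le (L : ℝ) (ξ : E) : |cutoff L ξ| ≤ 1 := by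
  rw [abs_of_nonneg (le_max_left _ _)]
  exact max_le zero_le_one (min_le_left _ _)

lemma abs_one_sub_cutoff_le (L : ℝ) (ξ : E) : |1 - cutoff L ξ| ≤ 1 := by
  have h1 : (0 : ℝ) ≤ cutoff L ξ := le_max_left _ _
  have h2 := abs_cutoff_le L ξ
  rw [abs_of_nonneg h1] at h2
  rw [abs_of_nonneg (by linarith)]
  linarith

lemma hasCompactSupport_cutoff (L : ℝ) : HasCompactSupport (cutoff L : E → ℝ) := by
  refine HasCompactSupport.intro (isCompact_closedBall (0 : E) (L + 1)) fun ξ hξ => ?_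
  rw [mem_closedBall_zero_iff, not_le] at hξ
  exact cutoff_eq_zero hξ.le

/-- The radial retraction onto a closed ball. -/
noncomputable def ballRetract {R : ℝ} (hR : 0 < R) (ξ : E) : Metric.closedBall (0 : E) R :=
  ⟨(R / max R ‖ξ‖) • ξ, by
    have : 0 < max R ‖ξ‖ := hR.trans_le (le_max_left _ _)
    rw [mem_closedBall_zero_iff, norm_smul, Real.norm_of_nonneg (by positivity), div_mul_eq_mul_div,
      div_le_iff₀ this]
    gcongr
    exact le_max_right _ _⟩

lemma continuous_ballRetract {R : ℝ} (hR : 0 < R) : Continuous (ballRetract hR : E → _) := by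
  refine Continuous.subtype_mk (Continuous.smul (continuous_const.div
    (continuous_const.max continuous_norm) fun ξ => ?_) continuous_id) _
  exact (hR.trans_le (le_max_left _ _)).ne'

lemma coe_ballRetract {R : ℝ} (hR : 0 < R) {ξ : E} (h : ‖ξ‖ ≤ R) :
    (ballRetract hR ξ : E) = ξ := by
  simp only [ballRetract, max_eq_left h, div_self hR.ne', one_smul]

/-- The extension of a continuous function on a ball by a cutoff function. -/
noncomputable def extendCutoff {L : ℝ} (hL : 0 < L + 1)
    (h : C(Metric.closedBall (0 : E) (L + 1), ℝ)) : C₀(E, ℝ) where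
  toFun ξ := cutoff L ξ * h (ballRetract hL ξ)
  continuous_toFun := (continuous_cutoff L).mul (h.continuous.comp (continuous_ballRetract hL))
  zero_at_infty' := ((hasCompactSupport_cutoff L).mul_right).is_zero_at_infty

lemma norm_zeroAtInfty_le {f : C₀(E, ℝ)} {c : ℝ} (hc : 0 ≤ c) (h : ∀ ξ, |f ξ| ≤ c) : ‖f‖ ≤ c := by
  rw [← ZeroAtInftyContinuousMap.norm_toBCF_eq_norm]
  exact (BoundedContinuousFunction.norm_le hc).2 h

lemma continuous_extendCutoff {L : ℝ} (hL : 0 < L + 1) :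
    Continuous (extendCutoff (E := E) hL) := by
  refine LipschitzWith.continuous (K := 1) (LipschitzWith.of_dist_le_mul fun h h' => ?_)
  rw [NNReal.coe_one, one_mul, dist_eq_norm]
  refine norm_zeroAtInfty_le dist_nonneg fun ξ => ?_
  change |cutoff L ξ * h (ballRetract hL ξ) - cutoff L ξ * h' (ballRetract hL ξ)| ≤ _
  rw [← mul_sub, abs_mul]
  have hd : |h (ballRetract hL ξ) - h' (ballRetract hL ξ)| ≤ dist h h' :=
    (Real.dist_eq _ _).symm.trans_le (ContinuousMap.dist_apply_le_dist _)
  calc |cutoff L ξ| * |h (ballRetract hL ξ) - h' (ballRetract hL ξ)| ≤ 1 * dist h h' := by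
        gcongr
        exact abs_cutoff_le L ξ
    _ = _ := one_mul _

/-- Truncations of Carathéodory functions are Bochner integrable. -/
theorem exists_integrable_cutoff {μ : Measure α} {g : α → E → ℝ}
    (hc : ∀ᵐ x ∂μ, Continuous (g x)) (hm : ∀ ξ, AEMeasurable (fun x => g x ξ) μ) {L : ℝ}
    (hL : 0 < L + 1) {B : α → ℝ≥0∞} (hB : ∫⁻ x, B x ∂μ ≠ ∞)
    (hgB : ∀ᵐ x ∂μ, ∀ ξ, ‖ξ‖ ≤ L + 1 → ‖g x ξ‖ₑ ≤ B x) :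
    ∃ G : α → C₀(E, ℝ), Integrable G μ ∧ ∀ᵐ x ∂μ, ∀ ξ, G x ξ = cutoff L ξ * g x ξ := by
  classical
  let K := Metric.closedBall (0 : E) (L + 1)
  have hne : Nonempty K := ⟨⟨0, Metric.mem_closedBall_self hL.le⟩⟩
  have hK : CompactSpace K := isCompact_iff_compactSpace.1 (isCompact_closedBall _ _)
  let s : ℕ → K := TopologicalSpace.denseSeq K
  have hs : DenseRange s := TopologicalSpace.denseRange_denseSeq K
  have hgood : ∀ᵐ x ∂μ, Continuous (g x) ∧ ∀ i, g x (s i) = (hm (s i)).mk _ x :=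
    hc.and (ae_all_iff.2 fun i => (hm (s i)).ae_eq_mk)
  obtain ⟨A, hAsub, hAm, hA⟩ := exists_measurable_superset_of_null hgood
  -- Restriction to the compact ball K places g(x) in the separable space C(K), where strong
  -- measurability follows from countably many evaluations. The cutoff vanishes beyond radius L + 1,
  -- so the radial extension outside K is irrelevant.
  let F : α → C(K, ℝ) := fun x => if hx : x ∈ A then 0 else
    ⟨fun y => g x y, (not_not.1 fun h => hx (hAsub h) : Continuous (g x) ∧ _).1.comp
      continuous_subtype_val⟩
  have hF : StronglyMeasurable F := by
    refine stronglyMeasurable_of_eval hs fun i => ?_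
    have : (fun x => F x (s i)) = fun x => if x ∈ A then 0 else (hm (s i)).mk _ x := by
      ext x
      by_cases hx : x ∈ A
      · simp [F, hx]
      · have h2 := (not_not.1 fun h => hx (hAsub h) : Continuous (g x) ∧
          ∀ i, g x (s i) = (hm (s i)).mk _ x).2 i
        simp only [F, hx, dite_false, if_false]
        exact h2
    rw [this]
    exact Measurable.ite hAm measurable_const (hm (s i)).measurable_mk
  have hval : ∀ᵐ x ∂μ, ∀ ξ, extendCutoff hL (F x) ξ = cutoff L ξ * g x ξ := by
    filter_upwards [measure_eq_zero_iff_ae_notMem.1 hA] with x hx ξ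
    change cutoff L ξ * F x (ballRetract hL ξ) = _
    rcases le_total ‖ξ‖ (L + 1) with h | h
    · congr 1
      simp only [F, hx, dite_false]
      change g x (ballRetract hL ξ) = _
      rw [coe_ballRetract hL h]
    · rw [cutoff_eq_zero h, zero_mul, zero_mul]
  have hGm : StronglyMeasurable fun x => extendCutoff hL (F x) :=
    (continuous_extendCutoff hL).comp_stronglyMeasurable hF
  refine ⟨_, ⟨hGm.aestronglyMeasurable, ?_⟩, hval⟩
  refine lt_of_le_of_lt (lintegral_mono_ae ?_) hB.lt_top
  filter_upwards [hval, hgB] with x hx hxB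
  rcases eq_or_ne (B x) ∞ with hT | hT
  · rw [hT]; exact le_top
  · rw [← ofReal_norm]
    refine ENNReal.ofReal_le_of_le_toReal (norm_zeroAtInfty_le ENNReal.toReal_nonneg fun ξ => ?_)
    rw [hx ξ]
    rcases le_total ‖ξ‖ (L + 1) with h | h
    · have h1 := hxB ξ h
      rw [← ofReal_norm] at h1
      rw [abs_mul]
      calc _ ≤ 1 * (B x).toReal := by
            gcongr
            · exact abs_cutoff_le L ξ
            · exact (ENNReal.ofReal_le_iff_le_toReal hT).1 h1
        _ = _ := one_mul _
    · rw [cutoff_eq_zero h]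
      simp

end Caratheodory

/-! ### Observables with p-growth -/

section Growth

variable {D : Set (X d)} {p : ℝ} {k : ℕ} {g : (Fin k → X d) → (Fin k → U N) → ℝ}

/-- The growth condition of the class `MemH`, in extended nonnegative reals. -/
structure GrowthBound (p : ℝ) (D : Set (X d)) (k : ℕ) (g : (Fin k → X d) → (Fin k → U N) → ℝ)
    (Φ : (S : Finset (Fin k)) → (Fin Sᶜ.card → X d) → ℝ≥0∞) : Prop where
  meas : ∀ S, AEMeasurable (Φ S) (lam D Sᶜ.card)
  finite : ∀ S, ∫⁻ x, Φ S x ∂(lam D Sᶜ.card) ≠ ∞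
  le : ∀ x ∈ prodDom D k, ∀ ξ,
    ‖g x ξ‖ₑ ≤ ∑ S, Φ S (x ∘ Sᶜ.orderEmbOfFin rfl) * ∏ i ∈ S, ‖ξ i‖ₑ ^ p

lemma MemH.exists_growthBound (hp : 0 ≤ p) (h : MemH p D k g) : ∃ Φ, GrowthBound p D k g Φ := by
  obtain ⟨φ, hφ, hle⟩ := h.bound
  have hcard : ∀ S : Finset (Fin k), Sᶜ.card ≤ k := fun S =>
    (Finset.card_le_univ _).trans_eq (Fintype.card_fin k)
  refine ⟨fun S x => ‖φ Sᶜ.card x‖ₑ, fun S => (hφ _ (hcard S)).2.aestronglyMeasurable.enorm,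
    fun S => (hφ _ (hcard S)).2.2.ne, fun x hx ξ => ?_⟩
  have hx' : ∀ S : Finset (Fin k), (x ∘ Sᶜ.orderEmbOfFin rfl) ∈ prodDom D Sᶜ.card :=
    fun S j _ => hx _ (mem_univ _)
  have h0 : ∀ S : Finset (Fin k), 0 ≤ φ Sᶜ.card (x ∘ Sᶜ.orderEmbOfFin rfl) := fun S =>
    (hφ _ (hcard S)).1 _ (hx' S)
  have hprod : ∀ S : Finset (Fin k), (0 : ℝ) ≤ ∏ i ∈ S, ‖ξ i‖ ^ p := fun S => by positivity
  calc ‖g x ξ‖ₑ = ENNReal.ofReal |g x ξ| := (ofReal_norm _).symm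
    _ ≤ ENNReal.ofReal (∑ S : Finset (Fin k),
        φ Sᶜ.card (x ∘ Sᶜ.orderEmbOfFin rfl) * ∏ i ∈ S, ‖ξ i‖ ^ p) :=
        ENNReal.ofReal_le_ofReal (hle x hx ξ)
    _ = _ := by
        rw [ENNReal.ofReal_sum_of_nonneg fun S _ => mul_nonneg (h0 S) (hprod S)]
        refine Finset.sum_congr rfl fun S _ => ?_
        rw [ENNReal.ofReal_mul (h0 S), ENNReal.ofReal_prod_of_nonneg fun i _ => by positivity,
          Real.enorm_of_nonneg (h0 S)]
        congr 1
        exact Finset.prod_congr rfl fun i _ => ofReal_norm_rpow _ hp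

variable {Φ : (S : Finset (Fin k)) → (Fin Sᶜ.card → X d) → ℝ≥0∞} {κ : KerFam d N}

lemma aemeasurable_comp_orderEmb (hDo : IsOpen D) (hDn : D.Nonempty) (S : Finset (Fin k))
    {Ψ : (Fin Sᶜ.card → X d) → ℝ≥0∞} (hΨ : AEMeasurable Ψ (lam D Sᶜ.card)) :
    AEMeasurable (fun x => Ψ (x ∘ Sᶜ.orderEmbOfFin rfl)) (lam D k) :=
  hΨ.comp_quasiMeasurePreserving
    (quasiMeasurePreserving_comp hDo hDn (Sᶜ.orderEmbOfFin rfl).injective)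

/-- The contribution of the values in a set `A` to the growth bound. -/
noncomputable def growthOn (p : ℝ) (Φ : (S : Finset (Fin k)) → (Fin Sᶜ.card → X d) → ℝ≥0∞)
    (κ : KerFam d N) (A : Set (Fin k → U N)) (x : Fin k → X d) : ℝ≥0∞ :=
  ∑ S, Φ S (x ∘ Sᶜ.orderEmbOfFin rfl) *
    ∫⁻ ξ, A.indicator (fun ξ => ∏ i ∈ S, ‖ξ i‖ₑ ^ p) ξ ∂(κ k x)

lemma GrowthBound.lintegral_indicator_le (hΦ : GrowthBound p D k g Φ) {A : Set (Fin k → U N)}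
    (hA : MeasurableSet A) {x : Fin k → X d} (hx : x ∈ prodDom D k) :
    ∫⁻ ξ, A.indicator (fun ξ => ‖g x ξ‖ₑ) ξ ∂(κ k x) ≤ growthOn p Φ κ A x := by
  have hm : ∀ S : Finset (Fin k), Measurable (A.indicator fun ξ => ∏ i ∈ S, ‖ξ i‖ₑ ^ p) := fun S =>
    (measurable_prod_finset_rpow p S).indicator hA
  calc _ ≤ ∫⁻ ξ, ∑ S, Φ S (x ∘ Sᶜ.orderEmbOfFin rfl) *
        A.indicator (fun ξ => ∏ i ∈ S, ‖ξ i‖ₑ ^ p) ξ ∂(κ k x) := by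
        refine lintegral_mono fun ξ => ?_
        by_cases hξ : ξ ∈ A
        · simpa only [indicator_of_mem hξ] using hΦ.le x hx ξ
        · simp [indicator_of_notMem hξ]
    _ = growthOn p Φ κ A x := by
        rw [lintegral_finsetSum _ fun S _ => (hm S).const_mul _]
        exact Finset.sum_congr rfl fun S _ => lintegral_const_mul _ (hm S)

lemma GrowthBound.aemeasurable_term (hΦ : GrowthBound p D k g Φ) (hDo : IsOpen D)
    (hDn : D.Nonempty) (κ : KerFam d N) {A : Set (Fin k → U N)} (hA : MeasurableSet A)
    (S : Finset (Fin k)) :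
    AEMeasurable (fun x => Φ S (x ∘ Sᶜ.orderEmbOfFin rfl) *
      ∫⁻ ξ, A.indicator (fun ξ => ∏ i ∈ S, ‖ξ i‖ₑ ^ p) ξ ∂(κ k x)) (lam D k) :=
  (aemeasurable_comp_orderEmb hDo hDn S (hΦ.meas S)).mul
    (Measurable.lintegral_kernel ((measurable_prod_finset_rpow p S).indicator hA)).aemeasurable

lemma GrowthBound.aemeasurable_growthOn (hΦ : GrowthBound p D k g Φ) (hDo : IsOpen D)
    (hDn : D.Nonempty) (κ : KerFam d N) {A : Set (Fin k → U N)} (hA : MeasurableSet A) :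
    AEMeasurable (growthOn p Φ κ A) (lam D k) :=
  Finset.aemeasurable_fun_sum _ fun S _ => hΦ.aemeasurable_term hDo hDn κ hA S

lemma GrowthBound.lintegral_growthOn (hΦ : GrowthBound p D k g Φ) (hDo : IsOpen D)
    (hDn : D.Nonempty) (κ : KerFam d N) {A : Set (Fin k → U N)} (hA : MeasurableSet A) :
    ∫⁻ x, growthOn p Φ κ A x ∂(lam D k) = ∑ S, ∫⁻ x, Φ S (x ∘ Sᶜ.orderEmbOfFin rfl) *
      ∫⁻ ξ, A.indicator (fun ξ => ∏ i ∈ S, ‖ξ i‖ₑ ^ p) ξ ∂(κ k x) ∂(lam D k) :=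
  lintegral_finsetSum' _ fun S _ => hΦ.aemeasurable_term hDo hDn κ hA S

/-- Each term factorises into the integral of Φ S and the moment of order |S|. -/
lemma GrowthBound.lintegral_growthOn_univ_ne_top (hΦ : GrowthBound p D k g Φ) (hDo : IsOpen D)
    (hDn : D.Nonempty) (hκ : IsRegular D κ) (hmom : ∀ k, mom p D κ k ≠ ∞) :
    ∫⁻ x, growthOn p Φ κ univ x ∂(lam D k) ≠ ∞ := by
  rw [hΦ.lintegral_growthOn hDo hDn κ MeasurableSet.univ]
  refine ENNReal.sum_ne_top.2 fun S _ => ?_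
  simp only [indicator_univ]
  rw [lintegral_mul_prod_eq hκ p S (hΦ.meas S)]
  exact ENNReal.mul_ne_top (hΦ.finite S) (hmom _)

lemma GrowthBound.lpairing_ne_top (hΦ : GrowthBound p D k g Φ) (hDo : IsOpen D)
    (hDn : D.Nonempty) (hκ : IsRegular D κ) (hmom : ∀ k, mom p D κ k ≠ ∞) :
    lpairing D κ.toFam (fun x ξ => ‖g x ξ‖ₑ) ≠ ∞ := by
  refine ne_top_of_le_ne_top (hΦ.lintegral_growthOn_univ_ne_top hDo hDn hκ hmom) ?_
  refine setLIntegral_mono_ae' (measurableSet_prodDom hDo.measurableSet k)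
    (ae_of_all _ fun x hx => ?_)
  have h := hΦ.lintegral_indicator_le (κ := κ) MeasurableSet.univ hx
  simp only [indicator_univ] at h
  exact h

lemma MemH.ae_integrable (h : MemH p D k g) (hΦ : GrowthBound p D k g Φ) (hDo : IsOpen D)
    (hDn : D.Nonempty) (hκ : IsRegular D κ) (hmom : ∀ k, mom p D κ k ≠ ∞) :
    ∀ᵐ x ∂(lam D k), Integrable (g x) (κ k x) := by
  filter_upwards [h.cont, ae_lt_top' (hΦ.aemeasurable_growthOn hDo hDn κ MeasurableSet.univ)
    (hΦ.lintegral_growthOn_univ_ne_top hDo hDn hκ hmom),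
    ae_restrict_mem (measurableSet_prodDom hDo.measurableSet k)] with x hc hlt hx
  refine ⟨hc.aestronglyMeasurable, lt_of_le_of_lt ?_ hlt⟩
  simpa only [indicator_univ] using
    hΦ.lintegral_indicator_le (κ := κ) MeasurableSet.univ hx

/-- Truncations of the observables in `MemH` are Bochner integrable. -/
lemma MemH.exists_cutoff (hp : 0 ≤ p) (h : MemH p D k g) (hΦ : GrowthBound p D k g Φ)
    (hDo : IsOpen D) (hDn : D.Nonempty) (hDf : volume D ≠ ∞) {L : ℝ} (hL : 0 < L + 1) :
    ∃ G : (Fin k → X d) → C₀(Fin k → U N, ℝ), Integrable G (lam D k) ∧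
      ∀ᵐ x ∂(lam D k), ∀ ξ, G x ξ = cutoff L ξ * g x ξ := by
  have hc : ∀ S : Finset (Fin k), ∏ _i ∈ S, ENNReal.ofReal (L + 1) ^ p ≠ ∞ := fun S =>
    ENNReal.prod_ne_top fun i _ => ENNReal.rpow_ne_top_of_nonneg hp ENNReal.ofReal_ne_top
  refine exists_integrable_cutoff (B := fun x => ∑ S, Φ S (x ∘ Sᶜ.orderEmbOfFin rfl) *
    ∏ _i ∈ S, ENNReal.ofReal (L + 1) ^ p) h.cont h.meas hL ?_ ?_
  · have hm := fun S => aemeasurable_comp_orderEmb hDo hDn S (hΦ.meas S)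
    rw [lintegral_finsetSum' _ fun S _ => (hm S).mul_const _]
    refine ENNReal.sum_ne_top.2 fun S _ => ?_
    rw [lintegral_mul_const'' _ (hm S)]
    refine ENNReal.mul_ne_top ?_ (hc S)
    have e := lintegral_lam_split S (hΦ.meas S) (Ψ := fun _ => 1) aemeasurable_const
    simp only [mul_one] at e
    rw [e]
    have := isFiniteMeasure_lam hDf S.card
    refine ENNReal.mul_ne_top (hΦ.finite S) ?_
    rw [lintegral_const, one_mul]
    exact measure_ne_top _ _
  · filter_upwards [ae_restrict_mem (measurableSet_prodDom hDo.measurableSet k)] with x hx ξ hξ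
    refine (hΦ.le x hx ξ).trans ?_
    gcongr with S _ i _
    rw [← ofReal_norm]
    exact ENNReal.ofReal_le_ofReal ((norm_le_pi_norm ξ i).trans hξ)

end Growth

/-! ### Strong convergence of observables with p-growth -/

section Convergence

variable {D : Set (X d)} {κ : ℕ → KerFam d N} {κ₀ : KerFam d N} {p : ℝ}

lemma measurableSet_exists_lt (L : ℝ) (k : ℕ) :
    MeasurableSet {ξ : Fin k → U N | ∃ i, L < ‖ξ i‖} := by
  have : {ξ : Fin k → U N | ∃ i, L < ‖ξ i‖} = ⋃ i, {ξ | L < ‖ξ i‖} := by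
    ext ξ
    simp
  rw [this]
  exact MeasurableSet.iUnion fun i => measurableSet_lt measurable_const (measurable_pi_apply i).norm

/-- The cutoff equals one unless some component exceeds L, so the truncation error lives on the set
that uniform integrability makes negligible. -/
lemma enorm_integral_sub_cutoff_le {k : ℕ} {m : Measure (Fin k → U N)} [IsFiniteMeasure m]
    {f : (Fin k → U N) → ℝ} (hf : Integrable f m) {F : C₀(Fin k → U N, ℝ)} {L : ℝ} (hL : 0 ≤ L)
    (hF : ∀ ξ, F ξ = cutoff L ξ * f ξ) :
    ‖(∫ ξ, f ξ ∂m) - ∫ ξ, F ξ ∂m‖ₑ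
      ≤ ∫⁻ ξ, {ξ : Fin k → U N | ∃ i, L < ‖ξ i‖}.indicator (fun ξ => ‖f ξ‖ₑ) ξ ∂m := by
  rw [← integral_sub hf (integrable_zeroAtInfty m F)]
  refine (enorm_integral_le_lintegral_enorm _).trans (lintegral_mono fun ξ => ?_)
  by_cases h : ∃ i, L < ‖ξ i‖
  · rw [indicator_of_mem (by exact h), hF, ← one_sub_mul, enorm_mul]
    refine mul_le_of_le_one_left' ?_
    rw [← ofReal_norm]
    exact ENNReal.ofReal_le_one.2 (abs_one_sub_cutoff_le L ξ)
  · push Not at h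
    rw [hF, cutoff_eq_one ((pi_norm_le_iff_of_nonneg hL).2 h)]
    simp

/-- Strong convergence of the expected values of the observables in `MemH`. -/
theorem MemH.tendsto_lintegral (hDo : IsOpen D) (hDn : D.Nonempty) (hDb : Bornology.IsBounded D)
    (hp : 0 < p) (hκ : ∀ n, IsRegular D (κ n)) (hκ₀ : IsRegular D κ₀)
    (hst : ∀ k, StableTendsto (lam D k) (fun n => κ n k) (κ₀ k))
    (hdc : ∀ δ ≠ 0, ∃ r > 0, (∀ᶠ n in atTop, modCont p D r (κ n).toFam ≤ δ) ∧
      modCont p D r κ₀.toFam ≤ δ)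
    (hmom : ∀ k, ∃ A ≠ ∞, ∀ n, mom p D (κ n) k ≤ A) (hmom₀ : ∀ k, mom p D κ₀ k ≠ ∞)
    {k : ℕ} {g : (Fin k → X d) → (Fin k → U N) → ℝ} (hg : MemH p D k g) :
    Tendsto (fun n => ∫⁻ x, ‖(∫ ξ, g x ξ ∂(κ n k x)) - ∫ ξ, g x ξ ∂(κ₀ k x)‖ₑ ∂(lam D k)) atTop
      (𝓝 0) := by
  have hDf := hDb.measure_lt_top (μ := volume).ne
  obtain ⟨Φ, hΦ⟩ := hg.exists_growthBound hp.le
  rw [ENNReal.tendsto_nhds_zero]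
  intro ε hε
  have hε3 : 0 < ε / 3 := ENNReal.div_pos hε.ne' (by simp)
  obtain ⟨η, hη, hηε⟩ := exists_mul_le (C := ((Finset.univ : Finset (Finset (Fin k))).card : ℝ≥0∞))
    (by simp) hε3.ne'
  have hmom₀' : ∀ k, ∃ A ≠ ∞, ∀ _n : ℕ, mom p D κ₀ k ≤ A := fun k => ⟨_, hmom₀ k, fun _ => le_rfl⟩
  have ht : ∀ ε ≠ 0, ∀ᶠ L in atTop, ∀ᶠ n in atTop, tail p D L (κ n) ≤ ε := fun ε hε =>
    eventually_tail_le hDo hDb hκ hp hmom (fun δ hδ =>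
      let ⟨r, hr, h, _⟩ := hdc δ hδ; ⟨r, hr, h⟩) hε
  -- The limit is treated as a constant sequence, so that one level L serves both it and the
  -- approximating families.
  have ht₀ : ∀ ε ≠ 0, ∀ᶠ L in atTop, ∀ᶠ n : ℕ in atTop, tail p D L κ₀ ≤ ε := fun ε hε =>
    eventually_tail_le (κ := fun _ => κ₀) hDo hDb (fun _ => hκ₀) hp hmom₀' (fun δ hδ =>
      let ⟨r, hr, _, h⟩ := hdc δ hδ; ⟨r, hr, Eventually.of_forall fun _ => h⟩) hε
  have hr : ∀ᶠ L in atTop, ∀ S : Finset (Fin k), ∀ᶠ n in atTop,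
      ∫⁻ x, Φ S (x ∘ Sᶜ.orderEmbOfFin rfl) * ∫⁻ ξ, {ξ : Fin k → U N | ∃ i, L < ‖ξ i‖}.indicator
        (fun ξ => ∏ i ∈ S, ‖ξ i‖ₑ ^ p) ξ ∂(κ n k x) ∂(lam D k) ≤ η :=
    eventually_all.2 fun S => eventually_lintegral_remainder_le hDo hDn hDf hκ hp hmom ht S
      (hΦ.meas S) (hΦ.finite S) hη
  have hr₀ : ∀ᶠ L in atTop, ∀ S : Finset (Fin k), ∀ᶠ n : ℕ in atTop,
      ∫⁻ x, Φ S (x ∘ Sᶜ.orderEmbOfFin rfl) * ∫⁻ ξ, {ξ : Fin k → U N | ∃ i, L < ‖ξ i‖}.indicator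
        (fun ξ => ∏ i ∈ S, ‖ξ i‖ₑ ^ p) ξ ∂(κ₀ k x) ∂(lam D k) ≤ η :=
    eventually_all.2 fun S => eventually_lintegral_remainder_le (κ := fun _ => κ₀) hDo hDn hDf
      (fun _ => hκ₀) hp hmom₀' ht₀ S (hΦ.meas S) (hΦ.finite S) hη
  obtain ⟨L, ⟨hL, hL₀⟩, hL0⟩ := ((hr.and hr₀).and (eventually_ge_atTop 0)).exists
  set A : Set (Fin k → U N) := {ξ | ∃ i, L < ‖ξ i‖} with hAdef
  have hA : MeasurableSet A := measurableSet_exists_lt L k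
  obtain ⟨G, hG, hGg⟩ := hg.exists_cutoff hp.le hΦ hDo hDn hDf (L := L) (by linarith)
  have := fun n => (hκ n).markov k
  have := hκ₀.markov k
  have hC0 := tendsto_lintegral_zeroAtInfty (fun f => tendsto_lintegral_of_uniformContinuous
    hDo hDf hp hκ hκ₀ (hst k) hdc f.toBCF (ZeroAtInftyContinuousMap.uniformContinuous f)) hG
  have hsum : ∀ ζ : KerFam d N, (∀ S : Finset (Fin k), ∫⁻ x, Φ S (x ∘ Sᶜ.orderEmbOfFin rfl) *
      ∫⁻ ξ, A.indicator (fun ξ => ∏ i ∈ S, ‖ξ i‖ₑ ^ p) ξ ∂(ζ k x) ∂(lam D k) ≤ η) →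
      ∫⁻ x, growthOn p Φ ζ A x ∂(lam D k) ≤ ε / 3 := by
    intro ζ hζ
    rw [hΦ.lintegral_growthOn hDo hDn ζ hA]
    refine (Finset.sum_le_card_nsmul _ _ _ fun S _ => hζ S).trans ?_
    rwa [nsmul_eq_mul, mul_comm]
  -- For the constant sequence the bound does not depend on the index, so any index may be
  -- extracted.
  have h0 := hsum κ₀ fun S => (hL₀ S).exists.choose_spec
  filter_upwards [ENNReal.tendsto_nhds_zero.1 hC0 _ hε3, eventually_all.2 hL] with n hn hLn
  have h1 := hsum (κ n) hLn
  have hmomn : ∀ k, mom p D (κ n) k ≠ ∞ := fun k =>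
    let ⟨A, hA, h⟩ := hmom k; ne_top_of_le_ne_top hA (h n)
  calc _ ≤ ∫⁻ x, (growthOn p Φ (κ n) A x + (‖(∫ ξ, G x ξ ∂(κ n k x)) - ∫ ξ, G x ξ ∂(κ₀ k x)‖ₑ +
        growthOn p Φ κ₀ A x)) ∂(lam D k) := by
        refine lintegral_mono_ae ?_
        filter_upwards [hg.ae_integrable hΦ hDo hDn (hκ n) hmomn,
          hg.ae_integrable hΦ hDo hDn hκ₀ hmom₀, hGg,
          ae_restrict_mem (measurableSet_prodDom hDo.measurableSet k)] with x hin hi0 hGx hx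
        have a1 := (enorm_integral_sub_cutoff_le hin hL0 hGx).trans
          (hΦ.lintegral_indicator_le (κ := κ n) hA hx)
        have a0 := (enorm_integral_sub_cutoff_le hi0 hL0 hGx).trans
          (hΦ.lintegral_indicator_le (κ := κ₀) hA hx)
        refine le_trans ?_ (add_le_add a1 (add_le_add le_rfl a0))
        simp only [← edist_eq_enorm_sub]
        exact (edist_triangle _ _ _).trans (add_le_add le_rfl ((edist_triangle _ _ _).trans
          (add_le_add le_rfl (edist_comm _ _).le)))
    _ ≤ ε / 3 + (ε / 3 + ε / 3) := by
        rw [lintegral_add_left' (hΦ.aemeasurable_growthOn hDo hDn (κ n) hA),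
          lintegral_add_right' _ (hΦ.aemeasurable_growthOn hDo hDn κ₀ hA)]
        exact add_le_add h1 (add_le_add hn h0)
    _ = ε := by rw [← add_assoc, ENNReal.add_thirds]

end Convergence

/-! ### Measurable representatives in L^p -/

section Representatives

variable {p : ℝ} [Fact (1 ≤ p)] {D : Set (X d)}

lemma exponent_pos (p : ℝ) [h : Fact (1 ≤ p)] : 0 < p := one_pos.trans_le h.out

instance factOfRealNeTop {p : ℝ} : Fact (ENNReal.ofReal p ≠ ∞) := ⟨ENNReal.ofReal_ne_top⟩

lemma eLpNorm_ofReal_rpow (p : ℝ) [Fact (1 ≤ p)] {α E : Type*} [MeasurableSpace α]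
    [NormedAddCommGroup E] (μ : Measure α) (f : α → E) :
    eLpNorm f (ENNReal.ofReal p) μ ^ p = ∫⁻ x, ‖f x‖ₑ ^ p ∂μ := by
  have hp := exponent_pos p
  rw [eLpNorm_eq_lintegral_rpow_enorm_toReal (by simpa using hp) ENNReal.ofReal_ne_top,
    ENNReal.toReal_ofReal hp.le, ← ENNReal.rpow_mul, one_div_mul_cancel hp.ne', ENNReal.rpow_one]

lemma edist_rpow_eq (u w : LpSpace N p D) :
    edist u w ^ p = ∫⁻ x in D, ‖u x - w x‖ₑ ^ p := by
  rw [Lp.edist_def, eLpNorm_ofReal_rpow]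
  rfl

lemma enorm_rpow_eq (u : LpSpace N p D) : ‖u‖ₑ ^ p = ∫⁻ x in D, ‖u x‖ₑ ^ p := by
  rw [Lp.enorm_def, eLpNorm_ofReal_rpow]

/-- A jointly measurable choice of representatives of the elements of `L^p`. -/
theorem exists_measurable_representative (N : ℕ) (p : ℝ) [Fact (1 ≤ p)] (D : Set (X d)) :
    ∃ v : LpSpace N p D × X d → U N, Measurable v ∧
      ∀ u, ∀ᵐ x ∂(volume.restrict D), v (u, x) = u x := by
  classical
  have hp := exponent_pos p
  let e : ℕ → LpSpace N p D := TopologicalSpace.denseSeq _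
  have he : DenseRange e := TopologicalSpace.denseRange_denseSeq _
  let c : ℕ → ℝ≥0∞ := fun n => (2⁻¹ : ℝ≥0∞) ^ (n + 1)
  have hc0 : ∀ n, c n ≠ 0 := fun n => pow_ne_zero _ (by simp)
  have hfind : ∀ n (u : LpSpace N p D), ∃ i, edist u (e i) ^ p < c n := by
    intro n u
    have hc : 0 < c n ^ p⁻¹ := ENNReal.rpow_pos (pos_iff_ne_zero.2 (hc0 n)) (by finiteness)
    obtain ⟨_, ⟨i, rfl⟩, hi⟩ := EMetric.mem_closure_iff.1 (he u) _ hc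
    exact ⟨i, (ENNReal.lt_rpow_inv_iff hp).1 hi⟩
  -- The least index of a good approximant depends measurably on u. The errors have summable p-th
  -- powers, so the approximants converge to u almost everywhere.
  let idx : ℕ → LpSpace N p D → ℕ := fun n u => Nat.find (hfind n u)
  have hidx : ∀ n, Measurable (idx n) := fun n => measurable_find (hfind n) fun i =>
    measurableSet_lt ((measurable_id.edist measurable_const).pow_const p) measurable_const
  let rep : ℕ → LpSpace N p D × X d → U N := fun n q => e (idx n q.1) q.2
  have hrep : ∀ n, Measurable (rep n) := by
    intro n
    have h : Measurable fun q : ℕ × X d => e q.1 q.2 :=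
      measurable_from_prod_countable_right fun i => (Lp.stronglyMeasurable (e i)).measurable
    exact h.comp (((hidx n).comp measurable_fst).prodMk measurable_snd)
  refine ⟨fun q => limUnder atTop fun n => rep n q,
    (StronglyMeasurable.limUnder fun n => (hrep n).stronglyMeasurable).measurable, fun u => ?_⟩
  have hm : ∀ n, AEMeasurable (fun x => ‖u x - rep n (u, x)‖ₑ ^ p) (volume.restrict D) := fun n =>
    (((Lp.stronglyMeasurable u).measurable.sub
      ((hrep n).comp measurable_prodMk_left)).enorm.pow_const p).aemeasurable
  have hsum : ∫⁻ x in D, ∑' n, ‖u x - rep n (u, x)‖ₑ ^ p ≠ ∞ := by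
    rw [lintegral_tsum hm]
    refine ne_top_of_le_ne_top (b := ∑' n, c n) ?_ (ENNReal.tsum_le_tsum fun n => ?_)
    · simp only [c]
      rw [ENNReal.tsum_geometric_add_one]
      simp
    · have h := Nat.find_spec (hfind n u)
      rw [edist_rpow_eq] at h
      exact h.le
  filter_upwards [ae_lt_top' (AEMeasurable.tsum hm) hsum] with x hx
  refine Tendsto.limUnder_eq ?_
  have h1 := ENNReal.tendsto_atTop_zero_of_tsum_ne_top hx.ne
  have h2 : Tendsto (fun n => (‖u x - rep n (u, x)‖ₑ ^ p) ^ p⁻¹) atTop (𝓝 (0 ^ p⁻¹)) :=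
    (ENNReal.continuous_rpow_const.tendsto 0).comp h1
  rw [ENNReal.zero_rpow_of_pos (by positivity)] at h2
  rw [tendsto_iff_edist_tendsto_0]
  refine h2.congr fun n => ?_
  rw [← ENNReal.rpow_mul, mul_inv_cancel₀ hp.ne', ENNReal.rpow_one, edist_comm,
    edist_eq_enorm_sub]

/-- A jointly measurable choice of representatives. -/
noncomputable def evalLp (p : ℝ) [Fact (1 ≤ p)] (D : Set (X d)) : LpSpace N p D × X d → U N :=
  (exists_measurable_representative N p D).choose

lemma measurable_evalLp : Measurable (evalLp (N := N) p D) :=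
  (exists_measurable_representative N p D).choose_spec.1

lemma evalLp_ae_eq (u : LpSpace N p D) : ∀ᵐ x ∂(volume.restrict D), evalLp p D (u, x) = u x :=
  (exists_measurable_representative N p D).choose_spec.2 u

lemma evalLp_pi_ae_eq (u : LpSpace N p D) (k : ℕ) :
    ∀ᵐ x ∂(lam D k), ∀ i, evalLp p D (u, x i) = u (x i) := by
  rw [lam_eq_pi]
  exact ae_all_iff.2 fun i =>
    (Measure.tendsto_eval_ae_ae (μ := fun _ : Fin k => volume.restrict D) (i := i)).eventually
      (evalLp_ae_eq u)

lemma measurable_evalLp_section (u : LpSpace N p D) : Measurable fun x => evalLp p D (u, x) :=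
  measurable_evalLp.comp measurable_prodMk_left

lemma enorm_rpow_eq_evalLp (u : LpSpace N p D) :
    ‖u‖ₑ ^ p = ∫⁻ x in D, ‖evalLp p D (u, x)‖ₑ ^ p := by
  rw [enorm_rpow_eq]
  refine lintegral_congr_ae ?_
  filter_upwards [evalLp_ae_eq u] with x hx
  rw [hx]

end Representatives

/-! ### Dual measures as laws of random functions -/

section JointLaw

variable {p : ℝ} [Fact (1 ≤ p)] {D : Set (X d)} {κ : KerFam d N} {μ : Measure (LpSpace N p D)}

/-- The points together with the values at these points. -/
noncomputable def sampleMap (N : ℕ) (p : ℝ) [Fact (1 ≤ p)] (D : Set (X d)) (k : ℕ)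
    (q : LpSpace N p D × (Fin k → X d)) : (Fin k → X d) × (Fin k → U N) :=
  (q.2, fun i => evalLp p D (q.1, q.2 i))

lemma measurable_sampleMap (k : ℕ) : Measurable (sampleMap N p D k) :=
  measurable_snd.prodMk (measurable_pi_iff.2 fun i => measurable_evalLp.comp
    (measurable_fst.prodMk ((measurable_pi_apply i).comp measurable_snd)))

/-- A dual measure represents the correlation measure by random functions. -/
theorem IsDual.map_sampleMap (hDf : volume D ≠ ∞) (hκ : IsRegular D κ) (hμ : IsDual p D κ.toFam μ)
    (k : ℕ) : (μ.prod (lam D k)).map (sampleMap N p D k) = lam D k ⊗ₘ κ k := by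
  have := hμ.prob
  have := isFiniteMeasure_lam hDf k
  have := hκ.markov k
  have hm := measurable_sampleMap (N := N) (p := p) (D := D) k
  obtain ⟨J, hJ⟩ : ∃ J, J = (μ.prod (lam D k)).map (sampleMap N p D k) := ⟨_, rfl⟩
  have hJf : IsFiniteMeasure J := hJ ▸ inferInstance
  have hfst : J.fst = lam D k := by
    rw [hJ, Measure.fst, Measure.map_map measurable_fst hm]
    exact (Measure.map_snd_prod (μ := μ) (ν := lam D k)).trans (by simp)
  have hdis : lam D k ⊗ₘ J.condKernel = J := by
    conv_lhs => rw [← hfst]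
    exact J.disintegrate J.condKernel
  rw [← hJ, ← hdis]
  refine Measure.compProd_congr ?_
  refine kernel_ae_eq_of_setIntegral_eq fun A hA f => ?_
  -- Duality tested on 1_A(x) f(ξ) identifies the conditional kernel of the sampled law with `κ k`.
  let g : (Fin k → X d) → C₀(Fin k → U N, ℝ) := A.indicator fun _ => f
  have hg : Integrable g (lam D k) := (integrable_const f).indicator hA
  have hgapp : ∀ x ξ, g x ξ = A.indicator (fun _ => f ξ) x := by
    intro x ξ
    by_cases hx : x ∈ A <;> simp [g, hx]
  have hdual := hμ.dual k g hg
  have hgm : Measurable fun z : (Fin k → X d) × (Fin k → U N) => g z.1 z.2 := by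
    simp only [hgapp]
    have : (fun z : (Fin k → X d) × (Fin k → U N) => A.indicator (fun _ => f z.2) z.1)
        = (Prod.fst ⁻¹' A).indicator fun z => f z.2 := rfl
    rw [this]
    exact (f.continuous.measurable.comp measurable_snd).indicator (measurable_fst hA)
  have hgb : ∀ x ξ, |g x ξ| ≤ ‖f‖ := by
    intro x ξ
    rw [hgapp]
    by_cases hx : x ∈ A
    · rw [indicator_of_mem hx]
      exact f.toBCF.norm_coe_le_norm ξ
    · rw [indicator_of_notMem hx, abs_zero]
      exact norm_nonneg f
  have hint : ∀ ζ : Kernel (Fin k → X d) (Fin k → U N),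
      ∫ x in A, ∫ ξ, f ξ ∂(ζ x) ∂(lam D k) = ∫ x, ∫ ξ, g x ξ ∂(ζ x) ∂(lam D k) := by
    intro ζ
    rw [← integral_indicator hA]
    refine integral_congr_ae (ae_of_all _ fun x => ?_)
    simp only [hgapp]
    by_cases hx : x ∈ A <;> simp [hx]
  have hintJ : ∀ ν : Measure ((Fin k → X d) × (Fin k → U N)), IsFiniteMeasure ν →
      Integrable (fun z => g z.1 z.2) ν := fun ν _ =>
    Integrable.of_bound hgm.aestronglyMeasurable ‖f‖ (ae_of_all _ fun z => hgb _ _)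
  rw [hint, hint]
  have e1 : ∫ x, ∫ ξ, g x ξ ∂(J.condKernel x) ∂(lam D k) = ∫ z, g z.1 z.2 ∂J := by
    conv_rhs => rw [← hdis]
    rw [Measure.integral_compProd (hintJ _ inferInstance)]
  have e2 : ∫ z, g z.1 z.2 ∂J = ∫ u, ∫ x, g x (fun i => evalLp p D (u, x i)) ∂(lam D k) ∂μ := by
    have hi : Integrable (fun q => g (sampleMap N p D k q).1 (sampleMap N p D k q).2)
        (μ.prod (lam D k)) := (hJ ▸ hintJ J hJf).comp_measurable hm
    rw [hJ, integral_map hm.aemeasurable hgm.aestronglyMeasurable, integral_prod _ hi]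
    rfl
  rw [e1, e2]
  refine Eq.trans ?_ hdual.symm
  refine integral_congr_ae (ae_of_all _ fun u => integral_congr_ae ?_)
  filter_upwards [evalLp_pi_ae_eq u k] with x hx
  simp only [hx]

/-- Expectations with respect to a dual measure. -/
lemma IsDual.lintegral_eq (hDf : volume D ≠ ∞) (hκ : IsRegular D κ) (hμ : IsDual p D κ.toFam μ)
    {k : ℕ} {H : (Fin k → X d) → (Fin k → U N) → ℝ≥0∞} (hH : Measurable (Function.uncurry H)) :
    ∫⁻ x, ∫⁻ ξ, H x ξ ∂(κ k x) ∂(lam D k)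
      = ∫⁻ u, ∫⁻ x, H x (fun i => evalLp p D (u, x i)) ∂(lam D k) ∂μ := by
  have := hμ.prob
  have := isFiniteMeasure_lam hDf k
  have := hκ.markov k
  have hm := measurable_sampleMap (N := N) (p := p) (D := D) k
  have h := Measure.lintegral_compProd (μ := lam D k) (κ := κ k) hH
  rw [← hμ.map_sampleMap hDf hκ k, lintegral_map hH hm] at h
  exact h.symm.trans (lintegral_prod _ (hH.comp hm).aemeasurable)

end JointLaw

/-! ### The support bound and dual measures -/

section SupportBound

/-- If f ≥ c·m with c > 1 on a set of positive measure, its k-th moment divided by m^k would grow at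
least like c^k. -/
lemma ae_le_of_lintegral_pow_le {α : Type*} [MeasurableSpace α] {μ : Measure α} {f : α → ℝ≥0∞}
    (hf : AEMeasurable f μ) {m : ℝ≥0∞} (hm0 : m ≠ 0) (hmt : m ≠ ∞)
    (h : ∀ k : ℕ, ∫⁻ x, f x ^ k ∂μ ≤ m ^ k) : ∀ᵐ x ∂μ, f x ≤ m := by
  have key : ∀ n : ℕ, ∀ᵐ x ∂μ, f x < (1 + ((n : ℝ≥0∞) + 1)⁻¹) * m := by
    intro n
    set c : ℝ≥0∞ := 1 + ((n : ℝ≥0∞) + 1)⁻¹ with hc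
    have hc1 : 1 < c := by
      rw [hc]
      exact ENNReal.lt_add_right ENNReal.one_ne_top (ENNReal.inv_ne_zero.2 (by finiteness))
    rw [ae_iff]
    simp only [not_lt]
    by_contra hne
    have hle : ∀ k : ℕ, c ^ k ≤ (μ {x | c * m ≤ f x})⁻¹ := by
      intro k
      have h1 : (c * m) ^ k * μ {x | c * m ≤ f x} ≤ m ^ k := by
        refine le_trans ?_ (h k)
        refine le_trans ?_ (mul_meas_ge_le_lintegral₀ (hf.pow_const k) ((c * m) ^ k))
        refine mul_le_mul' le_rfl (measure_mono fun x (hx : c * m ≤ f x) => ?_)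
        exact pow_le_pow_left' hx k
      rw [mul_pow, mul_right_comm] at h1
      have h2 : c ^ k * μ {x | c * m ≤ f x} ≤ 1 := by
        rw [← ENNReal.mul_le_mul_iff_left (pow_ne_zero k hm0) (ENNReal.pow_ne_top hmt), one_mul]
        exact h1
      exact ENNReal.le_inv_iff_mul_le.2 h2
    have htop : Tendsto (fun k : ℕ => c ^ k) atTop (𝓝 ∞) :=
      ENNReal.tendsto_pow_atTop_nhds_top_iff.2 hc1
    have := le_of_tendsto' htop hle
    rw [top_le_iff, ENNReal.inv_eq_top] at this
    exact hne this
  filter_upwards [ae_all_iff.2 key] with x hx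
  have hlim : Tendsto (fun n : ℕ => (1 + ((n : ℝ≥0∞) + 1)⁻¹) * m) atTop (𝓝 ((1 + 0) * m)) := by
    refine ENNReal.Tendsto.mul_const (tendsto_const_nhds.add ?_) (.inr hmt)
    have := (tendsto_add_atTop_iff_nat 1).2 ENNReal.tendsto_inv_nat_nhds_zero
    simpa using this
  rw [add_zero, one_mul] at hlim
  exact ge_of_tendsto' hlim fun n => (hx n).le

variable {p : ℝ} [Fact (1 ≤ p)] {D : Set (X d)} {κ : KerFam d N} {μ : Measure (LpSpace N p D)}

/-- For fixed u the integral over D^k of ∏|u(x_i)|^p factorises into k copies of ‖u‖^p. -/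
lemma IsDual.mom_eq (hDf : volume D ≠ ∞) (hκ : IsRegular D κ) (hμ : IsDual p D κ.toFam μ) (k : ℕ) :
    mom p D κ k = ∫⁻ u, (‖u‖ₑ ^ p) ^ k ∂μ := by
  rw [mom, hμ.lintegral_eq hDf hκ (H := fun _ ξ => ∏ i, ‖ξ i‖ₑ ^ p)
    ((measurable_prod_rpow p k).comp measurable_snd)]
  refine lintegral_congr fun u => ?_
  rw [lam_eq_pi, lintegral_pi_prod _ (fun _ x => ‖evalLp p D (u, x)‖ₑ ^ p)
    fun _ => (measurable_evalLp_section u).enorm.pow_const p]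
  simp [enorm_rpow_eq_evalLp]

theorem IsDual.supportBound_iff (hDo : IsOpen D) (hDn : D.Nonempty) (hDf : volume D ≠ ∞)
    (hκ : IsRegular D κ) (hμ : IsDual p D κ.toFam μ) {M : ℝ} (hM : 0 < M) :
    SupportBound p D M κ.toFam ↔ ∀ᵐ u ∂μ, ‖u‖ ≤ M := by
  have := hμ.prob
  have hp := exponent_pos p
  have hiff : ∀ u : LpSpace N p D, ‖u‖ₑ ^ p ≤ ENNReal.ofReal M ^ p ↔ ‖u‖ ≤ M := by
    intro u
    rw [ENNReal.rpow_le_rpow_iff hp, ← ofReal_norm, ENNReal.ofReal_le_ofReal_iff hM.le]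
  have hpow : ∀ k : ℕ, ENNReal.ofReal M ^ ((k : ℝ) * p) = (ENNReal.ofReal M ^ p) ^ k := fun k => by
    rw [mul_comm, ENNReal.rpow_mul, ENNReal.rpow_natCast]
  constructor
  · intro h
    have hmom := mom_le_of_supportBound hDo hDn hDf hκ hp hM h
    have hae := ae_le_of_lintegral_pow_le (μ := μ) (f := fun u => ‖u‖ₑ ^ p)
      (m := ENNReal.ofReal M ^ p) (measurable_enorm.pow_const p).aemeasurable (by simp [hM])
      (by simp [hp.le]) fun k => by rw [← hμ.mom_eq hDf hκ, ← hpow]; exact hmom k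
    filter_upwards [hae] with u hu using (hiff u).1 hu
  · intro h
    refine supportBound_of_mom_le hp fun k => ?_
    rw [hμ.mom_eq hDf hκ, hpow]
    calc ∫⁻ u, (‖u‖ₑ ^ p) ^ k ∂μ ≤ ∫⁻ _, (ENNReal.ofReal M ^ p) ^ k ∂μ := by
          refine lintegral_mono_ae ?_
          filter_upwards [h] with u hu
          exact pow_le_pow_left' ((hiff u).2 hu) k
      _ = _ := by simp

end SupportBound

/-! ### Reconstruction of a function from sampled values -/

section Reconstruction

/-- The reconstruction of a function from its values at finitely many points: the value at `y` is
the value at the first of the points in the ball around `y`, and zero if there is none. -/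
noncomputable def reconstruct (r : ℝ) :
    (m : ℕ) → (Fin m → X d) → (Fin m → U N) → X d → U N
  | 0, _, _, _ => 0
  | m + 1, x, ξ, y => open Classical in
      if dist (x 0) y < r then ξ 0 else reconstruct r m (x ∘ Fin.succ) (ξ ∘ Fin.succ) y

lemma measurable_reconstruct (r : ℝ) (m : ℕ) :
    Measurable fun q : ((Fin m → X d) × (Fin m → U N)) × X d => reconstruct r m q.1.1 q.1.2 q.2 := by
  induction m with
  | zero => exact measurable_const
  | succ m ih =>
    simp only [reconstruct]
    refine Measurable.ite (measurableSet_lt (Measurable.dist ?_ ?_) measurable_const) ?_ ?_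
    · exact (measurable_pi_apply 0).comp (measurable_fst.comp measurable_fst)
    · exact measurable_snd
    · exact (measurable_pi_apply 0).comp (measurable_snd.comp measurable_fst)
    · exact ih.comp (f := fun q : ((Fin (m + 1) → X d) × (Fin (m + 1) → U N)) × X d =>
          (((q.1.1 ∘ Fin.succ), (q.1.2 ∘ Fin.succ)), q.2))
        ((((measurable_comp_right _).comp (measurable_fst.comp measurable_fst)).prodMk
          ((measurable_comp_right _).comp (measurable_snd.comp measurable_fst))).prodMk
            measurable_snd)

lemma norm_reconstruct_sub_le (r : ℝ) (m : ℕ) (x : Fin m → X d) (ξ ζ : Fin m → U N) (y : X d) :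
    ‖reconstruct r m x ξ y - reconstruct r m x ζ y‖ ≤ ‖ξ - ζ‖ := by
  induction m with
  | zero => simp [reconstruct]
  | succ m ih =>
    simp only [reconstruct]
    split_ifs with h
    · exact norm_le_pi_norm (ξ - ζ) 0
    · refine (ih _ _ _).trans ((pi_norm_le_iff_of_nonneg (norm_nonneg _)).2 fun i => ?_)
      exact norm_le_pi_norm (ξ - ζ) i.succ

lemma norm_reconstruct_le (r : ℝ) (m : ℕ) (x : Fin m → X d) (ξ : Fin m → U N) (y : X d) :
    ‖reconstruct r m x ξ y‖ ≤ ‖ξ‖ := by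
  induction m with
  | zero => simp [reconstruct]
  | succ m ih =>
    simp only [reconstruct]
    split_ifs with h
    · exact norm_le_pi_norm ξ 0
    · refine (ih _ _).trans ((pi_norm_le_iff_of_nonneg (norm_nonneg _)).2 fun i => ?_)
      exact norm_le_pi_norm ξ i.succ

variable {p : ℝ} {D : Set (X d)}

lemma measurable_reconstruct_section (r : ℝ) (m : ℕ) (x : Fin m → X d) (ξ : Fin m → U N) :
    Measurable (reconstruct r m x ξ) :=
  (measurable_reconstruct r m).comp (g := fun q : ((Fin m → X d) × (Fin m → U N)) × X d =>
    reconstruct r m q.1.1 q.1.2 q.2) (f := fun y => ((x, ξ), y)) measurable_prodMk_left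

lemma memLp_reconstruct (p : ℝ) (hDf : volume D ≠ ∞) (r : ℝ) (m : ℕ) (x : Fin m → X d)
    (ξ : Fin m → U N) :
    MemLp (reconstruct r m x ξ) (ENNReal.ofReal p) (volume.restrict D) := by
  have : IsFiniteMeasure (volume.restrict D) := ⟨by simpa using hDf.lt_top⟩
  exact MemLp.of_bound (measurable_reconstruct_section r m x ξ).aestronglyMeasurable ‖ξ‖
    (ae_of_all _ fun y => norm_reconstruct_le r m x ξ y)

/-- The reconstruction as an element of `L^p`. -/
noncomputable def reconstructLp (p : ℝ) (hDf : volume D ≠ ∞) (r : ℝ) (m : ℕ) (x : Fin m → X d)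
    (ξ : Fin m → U N) : LpSpace N p D :=
  (memLp_reconstruct p hDf r m x ξ).toLp _

variable [Fact (1 ≤ p)]

lemma edist_reconstructLp_rpow (hDf : volume D ≠ ∞) (r : ℝ) (m : ℕ) (x : Fin m → X d)
    (ξ : Fin m → U N) (u : LpSpace N p D) :
    edist u (reconstructLp p hDf r m x ξ) ^ p
      = ∫⁻ y in D, ‖evalLp p D (u, y) - reconstruct r m x ξ y‖ₑ ^ p := by
  rw [edist_rpow_eq]
  refine lintegral_congr_ae ?_
  filter_upwards [(memLp_reconstruct p hDf r m x ξ).coeFn_toLp, evalLp_ae_eq u] with y hy hu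
  rw [reconstructLp, hy, hu]

lemma measurable_reconstructLp (hDf : volume D ≠ ∞) (r : ℝ) (m : ℕ) :
    Measurable fun q : (Fin m → X d) × (Fin m → U N) =>
      (reconstructLp p hDf r m q.1 q.2 : LpSpace N p D) := by
  refine measurable_of_measurable_dist fun u => ?_
  have hp := exponent_pos p
  have e : ∀ q : (Fin m → X d) × (Fin m → U N), dist (reconstructLp p hDf r m q.1 q.2) u =
      ((∫⁻ y in D, ‖evalLp p D (u, y) - reconstruct r m q.1 q.2 y‖ₑ ^ p) ^ p⁻¹).toReal := by
    intro q
    rw [← edist_reconstructLp_rpow, ← ENNReal.rpow_mul, mul_inv_cancel₀ hp.ne', ENNReal.rpow_one,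
      edist_comm, edist_dist, ENNReal.toReal_ofReal dist_nonneg]
  simp only [e]
  refine (Measurable.pow_const ?_ _).ennreal_toReal
  refine Measurable.lintegral_prod_right' (f := fun z : ((Fin m → X d) × (Fin m → U N)) × X d =>
    ‖evalLp p D (u, z.2) - reconstruct r m z.1.1 z.1.2 z.2‖ₑ ^ p) ?_
  exact ((((measurable_evalLp_section u).comp measurable_snd).sub
    (measurable_reconstruct r m)).enorm).pow_const p

lemma continuous_reconstructLp (hDf : volume D ≠ ∞) (r : ℝ) (m : ℕ) (x : Fin m → X d) :
    Continuous fun ξ : Fin m → U N => (reconstructLp p hDf r m x ξ : LpSpace N p D) := by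
  have : IsFiniteMeasure (volume.restrict D) := ⟨by simpa using hDf.lt_top⟩
  refine LipschitzWith.continuous (K := measureUnivNNReal (volume.restrict D) ^
    (ENNReal.ofReal p).toReal⁻¹) (LipschitzWith.of_dist_le_mul fun ξ ζ => ?_)
  rw [dist_eq_norm, dist_eq_norm]
  refine Lp.norm_le_of_ae_bound (norm_nonneg _) ?_
  filter_upwards [(memLp_reconstruct p hDf r m x ξ).coeFn_toLp,
    (memLp_reconstruct p hDf r m x ζ).coeFn_toLp,
    Lp.coeFn_sub (reconstructLp p hDf r m x ξ) (reconstructLp p hDf r m x ζ)] with y h1 h2 h3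
  rw [h3, Pi.sub_apply, reconstructLp, reconstructLp, h1, h2]
  exact norm_reconstruct_sub_le r m x ξ ζ y

/-- Through this a functional on L^p becomes an observable of finitely many points and values, to
which the strong convergence applies. -/
lemma memH_reconstruct (hDf : volume D ≠ ∞) (r : ℝ) (m : ℕ) (F : LpSpace N p D →ᵇ ℝ) :
    MemH p D m fun x ξ => F (reconstructLp p hDf r m x ξ) where
  cont := ae_of_all _ fun x => F.continuous.comp (continuous_reconstructLp hDf r m x)
  meas ξ := (F.continuous.measurable.comp ((measurable_reconstructLp hDf r m).comp
    measurable_prodMk_right)).aemeasurable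
  bound := by
    -- Constants are integrable since D has finite volume, and the term with S = ∅ alone already
    -- dominates.
    refine ⟨fun _ _ => ‖F‖, fun i _ => ⟨fun _ _ => norm_nonneg F, ?_⟩, fun x _ ξ => ?_⟩
    · have := isFiniteMeasure_lam hDf i
      exact integrable_const _
    · refine (F.norm_coe_le_norm _).trans ?_
      have h : ‖F‖ * ∏ i ∈ (∅ : Finset (Fin m)), ‖ξ i‖ ^ p ≤ ∑ S : Finset (Fin m),
          ‖F‖ * ∏ i ∈ S, ‖ξ i‖ ^ p :=
        Finset.single_le_sum (f := fun S => ‖F‖ * ∏ i ∈ S, ‖ξ i‖ ^ p)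
          (fun S _ => by positivity) (Finset.mem_univ ∅)
      simpa using h

end Reconstruction

/-! ### The reconstruction error -/

section ReconstructionError

variable {p : ℝ} {ρ : Measure (X d)} {w : X d → U N}

/-- The mean error at `y` of the reconstruction from `m` independent points. -/
noncomputable def reconstructErr (p r : ℝ) (ρ : Measure (X d)) (w : X d → U N) (m : ℕ) (y : X d) :
    ℝ≥0∞ :=
  ∫⁻ x, ‖w y - reconstruct r m x (fun i => w (x i)) y‖ₑ ^ p ∂(Measure.pi fun _ : Fin m => ρ)

lemma measurable_reconstruct_comp (p r : ℝ) (hw : Measurable w) (m : ℕ) :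
    Measurable fun q : (Fin m → X d) × X d =>
      ‖w q.2 - reconstruct r m q.1 (fun i => w (q.1 i)) q.2‖ₑ ^ p := by
  refine (((hw.comp measurable_snd).sub ?_).enorm).pow_const p
  exact (measurable_reconstruct r m).comp
    (f := fun q : (Fin m → X d) × X d => ((q.1, fun i => w (q.1 i)), q.2))
    ((measurable_fst.prodMk (measurable_pi_iff.2 fun i =>
      hw.comp ((measurable_pi_apply i).comp measurable_fst))).prodMk measurable_snd)

lemma measurable_reconstruct_comp_left (p r : ℝ) (hw : Measurable w) (m : ℕ) (y : X d) :
    Measurable fun x : Fin m → X d => ‖w y - reconstruct r m x (fun i => w (x i)) y‖ₑ ^ p :=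
  Measurable.comp (g := fun q : (Fin m → X d) × X d =>
      ‖w q.2 - reconstruct r m q.1 (fun i => w (q.1 i)) q.2‖ₑ ^ p) (f := fun x => (x, y))
    (measurable_reconstruct_comp p r hw m) (measurable_id.prodMk measurable_const)

lemma lintegral_pi_succ {Z : Type*} [MeasurableSpace Z] (ρ : Measure Z) [SigmaFinite ρ] {m : ℕ}
    {F : (Fin (m + 1) → Z) → ℝ≥0∞} (hF : Measurable F) :
    ∫⁻ x, F x ∂(Measure.pi fun _ : Fin (m + 1) => ρ)
      = ∫⁻ x₀, ∫⁻ x', F (Fin.cons x₀ x') ∂(Measure.pi fun _ : Fin m => ρ) ∂ρ := by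
  have hmp := (measurePreserving_piFinSuccAbove (fun _ : Fin (m + 1) => ρ) 0).symm
  have e : ∀ z : Z × (Fin m → Z), (MeasurableEquiv.piFinSuccAbove
      (fun _ : Fin (m + 1) => Z) 0).symm z = (Fin.cons z.1 z.2 : Fin (m + 1) → Z) := fun z => by
    simp [MeasurableEquiv.piFinSuccAbove, Fin.insertNthEquiv]
  have hmc : Measurable fun z : Z × (Fin m → Z) => F (Fin.cons z.1 z.2 : Fin (m + 1) → Z) := by
    have h := hF.comp hmp.measurable
    simp only [Function.comp_def, e] at h
    exact h
  rw [← hmp.lintegral_comp_emb (MeasurableEquiv.measurableEmbedding _)]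
  simp only [e]
  exact lintegral_prod (μ := ρ) (ν := Measure.pi fun _ : Fin m => ρ)
    (fun z => F (Fin.cons z.1 z.2 : Fin (m + 1) → Z)) hmc.aemeasurable

lemma reconstruct_cons (r : ℝ) (w : X d → U N) {m : ℕ} (x₀ : X d) (x : Fin m → X d) (y : X d) :
    reconstruct r (m + 1) (Fin.cons x₀ x : Fin (m + 1) → X d)
        (fun i => w ((Fin.cons x₀ x : Fin (m + 1) → X d) i)) y
      = open Classical in
        if x₀ ∈ Metric.ball y r then w x₀ else reconstruct r m x (fun i => w (x i)) y := by
  rw [reconstruct]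
  congr 1

/-- Condition on the first point. If it hits the ball around y its value is used; if it misses, the
procedure restarts with the remaining m points. -/
lemma reconstructErr_succ [IsProbabilityMeasure ρ] (p r : ℝ) (hw : Measurable w) (m : ℕ) (y : X d) :
    reconstructErr p r ρ w (m + 1) y
      = ∫⁻ x, (Metric.ball y r).indicator (fun x => ‖w y - w x‖ₑ ^ p) x ∂ρ
        + ρ (Metric.ball y r)ᶜ * reconstructErr p r ρ w m y := by
  have hb : MeasurableSet (Metric.ball y r) := Metric.isOpen_ball.measurableSet
  have hm := fun m => measurable_reconstruct_comp_left p r hw m y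
  have hdiff : Measurable fun x => ‖w y - w x‖ₑ ^ p := ((hw.const_sub _).enorm).pow_const p
  have e : ∀ x₀ : X d, ∫⁻ x' : Fin m → X d, ‖w y - reconstruct r (m + 1)
      (Fin.cons x₀ x' : Fin (m + 1) → X d) (fun i => w ((Fin.cons x₀ x' : Fin (m + 1) → X d) i)) y‖ₑ
        ^ p ∂(Measure.pi fun _ : Fin m => ρ) =
      (Metric.ball y r).indicator (fun x => ‖w y - w x‖ₑ ^ p) x₀ +
        (Metric.ball y r)ᶜ.indicator (fun _ => reconstructErr p r ρ w m y) x₀ := by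
    intro x₀
    simp only [reconstruct_cons]
    by_cases hx : x₀ ∈ Metric.ball y r
    · simp [hx]
    · simp only [hx, if_false, indicator_of_notMem hx, zero_add]
      rw [indicator_of_mem (by exact hx)]
      rfl
  rw [reconstructErr, lintegral_pi_succ ρ (hm (m + 1))]
  refine (lintegral_congr e).trans ?_
  rw [lintegral_add_left (hdiff.indicator hb), lintegral_indicator hb.compl, setLIntegral_const,
    mul_comm]

/-- With hit probability q and miss probability s = 1 − q, the recursion e_{m+1} = a + s·e_m from
e_0 = |w(y)|^p sums to at most a/q + s^m·e_0. -/
lemma reconstructErr_le [IsProbabilityMeasure ρ] (p r : ℝ) (hw : Measurable w) {y : X d}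
    (hy : ρ (Metric.ball y r) ≠ 0) (m : ℕ) :
    reconstructErr p r ρ w m y ≤ (ρ (Metric.ball y r))⁻¹ *
        ∫⁻ x, (Metric.ball y r).indicator (fun x => ‖w y - w x‖ₑ ^ p) x ∂ρ
      + ρ (Metric.ball y r)ᶜ ^ m * ‖w y‖ₑ ^ p := by
  have hb : MeasurableSet (Metric.ball y r) := Metric.isOpen_ball.measurableSet
  induction m with
  | zero => simp [reconstructErr, reconstruct]
  | succ m ih =>
    rw [reconstructErr_succ p r hw]
    set a := ∫⁻ x, (Metric.ball y r).indicator (fun x => ‖w y - w x‖ₑ ^ p) x ∂ρ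
    set q := ρ (Metric.ball y r) with hq
    set s := ρ (Metric.ball y r)ᶜ with hs
    have hqs : q + s = 1 := by rw [hq, hs, measure_add_measure_compl hb, measure_univ]
    have hqt : q ≠ ∞ := measure_ne_top _ _
    calc a + s * reconstructErr p r ρ w m y ≤ a + s * (q⁻¹ * a + s ^ m * ‖w y‖ₑ ^ p) := by gcongr
      _ = q * q⁻¹ * a + s * (q⁻¹ * a + s ^ m * ‖w y‖ₑ ^ p) := by
          rw [ENNReal.mul_inv_cancel hy hqt, one_mul]
      _ = (q + s) * (q⁻¹ * a) + s ^ (m + 1) * ‖w y‖ₑ ^ p := by ring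
      _ = _ := by rw [hqs, one_mul]

end ReconstructionError

section DualError

variable {p : ℝ} [Fact (1 ≤ p)] {D : Set (X d)} {κ : KerFam d N} {μ : Measure (LpSpace N p D)}

lemma unif_ball (r : ℝ) (y : X d) :
    unif D (Metric.ball y r) = (volume D)⁻¹ * volume (Metric.ball y r ∩ D) := by
  rw [unif, Measure.smul_apply, Measure.restrict_apply Metric.isOpen_ball.measurableSet, smul_eq_mul]

lemma inv_unif_mul_lintegral (hDo : IsOpen D) (hDn : D.Nonempty) (hDf : volume D ≠ ∞) (r : ℝ)
    (y : X d) (f : X d → ℝ≥0∞) (hf : Measurable f) :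
    (unif D (Metric.ball y r))⁻¹ * ∫⁻ x, (Metric.ball y r).indicator f x ∂(unif D)
      = ∫⁻ x in D, ballKer D r y x * f x := by
  have hb : MeasurableSet (Metric.ball y r) := Metric.isOpen_ball.measurableSet
  have hv0 := volume_ne_zero hDo hDn
  have e : ∀ x, ballKer D r y x * f x =
      (volume (Metric.ball y r ∩ D))⁻¹ * (Metric.ball y r).indicator f x := by
    intro x
    by_cases hx : x ∈ Metric.ball y r <;> simp only [ballKer, hx, indicator_of_mem,
      indicator_of_notMem, not_false_eq_true, zero_mul, mul_zero]
  simp only [e]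
  rw [lintegral_const_mul _ (hf.indicator hb), unif_ball, unif, lintegral_smul_measure, smul_eq_mul,
    ENNReal.mul_inv (.inl (ENNReal.inv_ne_zero.2 hDf)) (.inl (ENNReal.inv_ne_top.2 hv0)), inv_inv,
    mul_right_comm, ← mul_assoc, mul_right_comm, ENNReal.mul_inv_cancel hv0 hDf, one_mul, mul_comm]

/-- The probability that a uniformly distributed point misses the ball. -/
noncomputable def missProb (D : Set (X d)) (r : ℝ) (y : X d) : ℝ≥0∞ :=
  1 - (volume D)⁻¹ * volume (Metric.ball y r ∩ D)

lemma measurable_missProb (hDm : MeasurableSet D) (r : ℝ) : Measurable (missProb D r) :=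
  ((measurable_volume_ball hDm r).const_mul _).const_sub 1

lemma missProb_eq (hDo : IsOpen D) (hDn : D.Nonempty) (hDf : volume D ≠ ∞) (r : ℝ) (y : X d) :
    unif D (Metric.ball y r)ᶜ = missProb D r y := by
  have := isProbabilityMeasure_unif hDo hDn hDf
  rw [prob_compl_eq_one_sub Metric.isOpen_ball.measurableSet, unif_ball, missProb]

lemma inv_mul_volume_ball_ne_zero (hDo : IsOpen D) (hDf : volume D ≠ ∞) {r : ℝ} (hr : 0 < r)
    {y : X d} (hy : y ∈ D) : (volume D)⁻¹ * volume (Metric.ball y r ∩ D) ≠ 0 :=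
  mul_ne_zero (ENNReal.inv_ne_zero.2 hDf) ((Metric.isOpen_ball.inter hDo).measure_pos volume
    ⟨y, Metric.mem_ball_self hr, hy⟩).ne'

lemma missProb_lt_one (hDo : IsOpen D) (hDf : volume D ≠ ∞) {r : ℝ} (hr : 0 < r)
    {y : X d} (hy : y ∈ D) : missProb D r y < 1 :=
  ENNReal.sub_lt_self ENNReal.one_ne_top one_ne_zero (inv_mul_volume_ball_ne_zero hDo hDf hr hy)

lemma tendsto_lintegral_missProb (hDo : IsOpen D) (hDf : volume D ≠ ∞) {r : ℝ} (hr : 0 < r) :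
    Tendsto (fun m : ℕ => ∫⁻ y in D, missProb D r y ^ m) atTop (𝓝 0) := by
  rw [← lintegral_zero (μ := volume.restrict D)]
  refine tendsto_lintegral_of_dominated_convergence (fun _ => 1)
    (fun m => (measurable_missProb hDo.measurableSet r).pow_const m)
    (fun m => ae_of_all _ fun y => pow_le_one' tsub_le_self m) (by simpa using hDf) ?_
  filter_upwards [ae_restrict_mem hDo.measurableSet] with y hy
  exact ENNReal.tendsto_pow_atTop_nhds_zero_of_lt_one (missProb_lt_one hDo hDf hr hy)

/-- Given a hit, the point used is uniform on the ball within D, which produces the average defining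
ω_r. What remains is the event that all m points miss. -/
lemma lintegral_edist_reconstructLp_le (hDo : IsOpen D) (hDn : D.Nonempty) (hDf : volume D ≠ ∞)
    {r : ℝ} (hr : 0 < r) (m : ℕ) (u : LpSpace N p D) :
    ∫⁻ x, edist u (reconstructLp p hDf r m x fun i => evalLp p D (u, x i)) ^ p
        ∂(Measure.pi fun _ : Fin m => unif D)
      ≤ (∫⁻ y in D, ∫⁻ x in D, ballKer D r y x * ‖evalLp p D (u, y) - evalLp p D (u, x)‖ₑ ^ p)
        + ∫⁻ y in D, missProb D r y ^ m * ‖evalLp p D (u, y)‖ₑ ^ p := by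
  have := isProbabilityMeasure_unif hDo hDn hDf
  have hw : Measurable fun y => evalLp p D (u, y) := measurable_evalLp_section u
  have hm2 : Measurable fun y => missProb D r y ^ m * ‖evalLp p D (u, y)‖ₑ ^ p :=
    ((measurable_missProb hDo.measurableSet r).pow_const m).mul (hw.enorm.pow_const p)
  simp only [edist_reconstructLp_rpow]
  rw [lintegral_lintegral_swap (measurable_reconstruct_comp p r hw m).aemeasurable,
    ← lintegral_add_right _ hm2]
  refine setLIntegral_mono_ae' hDo.measurableSet (ae_of_all _ fun y hy => ?_)
  have hq : unif D (Metric.ball y r) ≠ 0 := by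
    rw [unif_ball]
    exact inv_mul_volume_ball_ne_zero hDo hDf hr hy
  have h := reconstructErr_le (ρ := unif D) p r hw hq m
  rw [inv_unif_mul_lintegral hDo hDn hDf r y (fun x => ‖evalLp p D (u, y) - evalLp p D (u, x)‖ₑ ^ p)
    ((hw.const_sub _).enorm.pow_const p), missProb_eq hDo hDn hDf] at h
  exact h

/-- Values above L are charged to the tail, where the miss probability is at most one; below L the
integrand is at most L^p times the miss probability, which does not involve u. -/
lemma IsDual.lintegral_missProb_le (hDo : IsOpen D) (hDf : volume D ≠ ∞) (hκ : IsRegular D κ)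
    (hμ : IsDual p D κ.toFam μ) (r : ℝ) (m : ℕ) (L : ℝ) :
    ∫⁻ u, (∫⁻ y in D, missProb D r y ^ m * ‖evalLp p D (u, y)‖ₑ ^ p) ∂μ
      ≤ tail p D L κ + ENNReal.ofReal L ^ p * ∫⁻ y in D, missProb D r y ^ m := by
  have hp := exponent_pos p
  have := hκ.markov 1
  have hs := (measurable_missProb hDo.measurableSet r).pow_const m
  have hs1 : Measurable fun x : Fin 1 → X d => missProb D r (x 0) ^ m :=
    hs.comp (measurable_pi_apply 0)
  have hn : Measurable fun ξ : Fin 1 → U N => ‖ξ 0‖ₑ ^ p :=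
    (measurable_pi_apply 0).enorm.pow_const p
  have htm : Measurable fun ξ : Fin 1 → U N => (tailNorm p L (ξ 0) : ℝ≥0∞) :=
    (measurable_tailNorm p L).coe_nnreal_ennreal.comp (measurable_pi_apply 0)
  have e := hμ.lintegral_eq hDf hκ (H := fun x ξ => missProb D r (x 0) ^ m * ‖ξ 0‖ₑ ^ p)
    ((hs1.comp measurable_fst).mul (hn.comp measurable_snd))
  simp only [lintegral_lam_one] at e
  rw [← e, ← lintegral_lam_one D fun x => missProb D r (x 0) ^ m,
    ← lintegral_lam_one D fun x => ∫⁻ ξ, missProb D r (x 0) ^ m * ‖ξ 0‖ₑ ^ p ∂(κ 1 x), tail,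
    ← lintegral_const_mul _ hs1, ← lintegral_add_right _ (hs1.const_mul _)]
  refine lintegral_mono fun x => ?_
  calc ∫⁻ ξ, missProb D r (x 0) ^ m * ‖ξ 0‖ₑ ^ p ∂(κ 1 x)
      ≤ ∫⁻ ξ, (tailNorm p L (ξ 0) + ENNReal.ofReal L ^ p * missProb D r (x 0) ^ m) ∂(κ 1 x) := by
        refine lintegral_mono fun ξ => ?_
        by_cases hξ : L < ‖ξ 0‖
        · rw [tailNorm, indicator_of_mem (by exact hξ), coe_powNorm hp.le]
          exact (mul_le_of_le_one_left' (pow_le_one' tsub_le_self m)).trans le_self_add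
        · refine le_trans ?_ le_add_self
          rw [mul_comm]
          gcongr
          rw [← ofReal_norm]
          exact ENNReal.ofReal_le_ofReal (not_lt.1 hξ)
    _ = _ := by
        rw [lintegral_add_right _ measurable_const, lintegral_const, measure_univ, mul_one]

lemma IsDual.lintegral_ballKer_eq (hDo : IsOpen D) (hDf : volume D ≠ ∞) (hκ : IsRegular D κ)
    (hμ : IsDual p D κ.toFam μ) (r : ℝ) :
    ∫⁻ u, (∫⁻ y in D, ∫⁻ x in D, ballKer D r y x *
      ‖evalLp p D (u, y) - evalLp p D (u, x)‖ₑ ^ p) ∂μ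
      = modCont p D r κ.toFam := by
  have := hκ.markov 2
  have hb := measurable_ballKer_two hDo.measurableSet r
  have hd := measurable_diff_rpow (N := N) p (0 : Fin 2) 1
  rw [modCont_eq_lintegral p hDo.measurableSet]
  have e := hμ.lintegral_eq hDf hκ (H := fun x ξ => ballKer D r (x 0) (x 1) * ‖ξ 0 - ξ 1‖ₑ ^ p)
    ((hb.comp measurable_fst).mul (hd.comp measurable_snd))
  simp only [lintegral_const_mul _ hd] at e
  rw [e]
  refine lintegral_congr fun u => ?_
  have hw := measurable_evalLp_section u
  refine (lintegral_lam_two D (F := fun x : Fin 2 → X d => ballKer D r (x 0) (x 1) *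
    ‖evalLp p D (u, x 0) - evalLp p D (u, x 1)‖ₑ ^ p) (hb.mul ?_)).symm
  exact (((hw.comp (measurable_pi_apply 0)).sub (hw.comp (measurable_pi_apply 1))).enorm).pow_const p

/-- The mean distance between a random function and its reconstruction. -/
theorem IsDual.lintegral_edist_reconstructLp_le (hDo : IsOpen D) (hDn : D.Nonempty)
    (hDf : volume D ≠ ∞) (hκ : IsRegular D κ) (hμ : IsDual p D κ.toFam μ) {r : ℝ} (hr : 0 < r)
    (m : ℕ) (L : ℝ) :
    ∫⁻ u, ∫⁻ x, edist u (reconstructLp p hDf r m x fun i => evalLp p D (u, x i)) ^ p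
        ∂(Measure.pi fun _ : Fin m => unif D) ∂μ
      ≤ modCont p D r κ.toFam +
        (tail p D L κ + ENNReal.ofReal L ^ p * ∫⁻ y in D, missProb D r y ^ m) := by
  refine (lintegral_mono fun u =>
    CorrelationMeasures.lintegral_edist_reconstructLp_le hDo hDn hDf hr m u).trans ?_
  have hm : Measurable fun u : LpSpace N p D =>
      ∫⁻ y in D, missProb D r y ^ m * ‖evalLp p D (u, y)‖ₑ ^ p :=
    Measurable.lintegral_prod_right' (f := fun q : LpSpace N p D × X d =>
      missProb D r q.2 ^ m * ‖evalLp p D q‖ₑ ^ p)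
      ((((measurable_missProb hDo.measurableSet r).pow_const m).comp measurable_snd).mul
        (measurable_evalLp.enorm.pow_const p))
  rw [lintegral_add_right _ hm, hμ.lintegral_ballKer_eq hDo hDf hκ]
  gcongr
  exact hμ.lintegral_missProb_le hDo hDf hκ r m L

end DualError

/-! ### Pairings and weak convergence of dual measures -/

section Pairing

variable {p : ℝ} {D : Set (X d)} {κ : KerFam d N} {k : ℕ}
  {g : (Fin k → X d) → (Fin k → U N) → ℝ}

/-- Joint measurability of g is not given. Measurability in x is obtained as a limit over Bochner
integrable truncations. -/
lemma MemH.integrable_integral (hp : 0 < p) (h : MemH p D k g) (hDo : IsOpen D) (hDn : D.Nonempty)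
    (hDf : volume D ≠ ∞) (hκ : IsRegular D κ) (hmom : ∀ k, mom p D κ k ≠ ∞) :
    Integrable (fun x => ∫ ξ, g x ξ ∂(κ k x)) (lam D k) := by
  have := hκ.markov k
  obtain ⟨Φ, hΦ⟩ := h.exists_growthBound hp.le
  choose G hG hGg using fun n : ℕ =>
    h.exists_cutoff hp.le hΦ hDo hDn hDf (L := (n : ℝ)) (by positivity)
  refine ⟨aestronglyMeasurable_of_tendsto_ae atTop (f := fun n x => ∫ ξ, G n x ξ ∂(κ k x))
    (fun n => aestronglyMeasurable_integral_zeroAtInfty (hG n).1 (κ k)) ?_,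
    lt_of_le_of_lt (lintegral_mono fun x => enorm_integral_le_lintegral_enorm _)
      (hΦ.lpairing_ne_top hDo hDn hκ hmom).lt_top⟩
  filter_upwards [ae_all_iff.2 hGg, h.ae_integrable hΦ hDo hDn hκ hmom] with x hx hi
  refine tendsto_integral_of_dominated_convergence (fun ξ => ‖g x ξ‖)
    (fun n => (G n x).continuous.aestronglyMeasurable) hi.norm
    (fun n => ae_of_all _ fun ξ => ?_) (ae_of_all _ fun ξ => ?_)
  · rw [hx, norm_mul]
    exact mul_le_of_le_one_left (norm_nonneg _) (abs_cutoff_le _ _)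
  · refine tendsto_const_nhds.congr' ?_
    filter_upwards [eventually_ge_atTop ⌈‖ξ‖⌉₊] with n hn
    rw [hx, cutoff_eq_one (Nat.ceil_le.1 hn), one_mul]

end Pairing

section Duals

variable {p : ℝ} [Fact (1 ≤ p)] {D : Set (X d)} {κ : KerFam d N} {μ : Measure (LpSpace N p D)}

lemma IsDual.map_sampleMap_unif (hDo : IsOpen D) (hDn : D.Nonempty) (hDf : volume D ≠ ∞)
    (hκ : IsRegular D κ) (hμ : IsDual p D κ.toFam μ) (m : ℕ) :
    (μ.prod (Measure.pi fun _ : Fin m => unif D)).map (sampleMap N p D m)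
      = (Measure.pi fun _ : Fin m => unif D) ⊗ₘ κ m := by
  have := hμ.prob
  have := isFiniteMeasure_lam hDf m
  have := hκ.markov m
  rw [pi_unif hDo hDn, Measure.compProd_smul_left, Measure.prod_smul_right, Measure.map_smul,
    hμ.map_sampleMap hDf hκ m]

/-- A random function is close in law to the reconstruction from its values at many points. -/
lemma IsDual.enorm_integral_sub_le (hDo : IsOpen D) (hDn : D.Nonempty) (hDf : volume D ≠ ∞)
    (hκ : IsRegular D κ) (hμ : IsDual p D κ.toFam μ) (F : LpSpace N p D →ᵇ ℝ) {ε C : ℝ≥0∞}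
    (hF : ∀ u v, ‖F u - F v‖ₑ ≤ ε + C * edist u v ^ p) {r : ℝ} (hr : 0 < r) (m : ℕ) (L : ℝ) :
    ‖(∫ u, F u ∂μ) - ∫ x, ∫ ξ, F (reconstructLp p hDf r m x ξ) ∂(κ m x)
        ∂(Measure.pi fun _ : Fin m => unif D)‖ₑ
      ≤ ε + C * (modCont p D r κ.toFam +
        (tail p D L κ + ENNReal.ofReal L ^ p * ∫⁻ y in D, missProb D r y ^ m)) := by
  have := hμ.prob
  have := hκ.markov m
  have := isProbabilityMeasure_unif hDo hDn hDf
  obtain ⟨P, hP⟩ : ∃ P, P = Measure.pi fun _ : Fin m => unif D := ⟨_, rfl⟩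
  have hPp : IsProbabilityMeasure P := hP ▸ inferInstance
  have hs := measurable_sampleMap (N := N) (p := p) (D := D) m
  have hrec := measurable_reconstructLp (N := N) (p := p) hDf r m
  have hR : Measurable fun q : LpSpace N p D × (Fin m → X d) =>
      (reconstructLp p hDf r m q.2 fun i => evalLp p D (q.1, q.2 i) : LpSpace N p D) :=
    hrec.comp hs
  have hFm : Measurable F := F.continuous.measurable
  have hFrec : Measurable fun z : (Fin m → X d) × (Fin m → U N) =>
    F (reconstructLp p hDf r m z.1 z.2) := hFm.comp hrec
  have e1 : ∫ x, ∫ ξ, F (reconstructLp p hDf r m x ξ) ∂(κ m x) ∂P = ∫ q, F (reconstructLp p hDf r m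
      q.2 fun i => evalLp p D (q.1, q.2 i)) ∂(μ.prod P) := by
    rw [← Measure.integral_compProd (f := fun z => F (reconstructLp p hDf r m z.1 z.2))
      (Integrable.of_bound hFrec.aestronglyMeasurable ‖F‖
        (ae_of_all _ fun z => F.norm_coe_le_norm _)), hP,
      ← hμ.map_sampleMap_unif hDo hDn hDf hκ m,
      integral_map hs.aemeasurable hFrec.aestronglyMeasurable]
    rfl
  have e2 : ∫ u, F u ∂μ = ∫ q, F q.1 ∂(μ.prod P) := by
    rw [integral_fun_fst, probReal_univ, one_smul]
  have hi1 : Integrable (fun q => F q.1) (μ.prod P) :=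
    Integrable.of_bound (hFm.comp measurable_fst).aestronglyMeasurable ‖F‖
      (ae_of_all _ fun z => F.norm_coe_le_norm _)
  have hi2 : Integrable (fun q => F (reconstructLp p hDf r m q.2 fun i => evalLp p D (q.1, q.2 i)))
      (μ.prod P) :=
    Integrable.of_bound (hFm.comp hR).aestronglyMeasurable ‖F‖
      (ae_of_all _ fun z => F.norm_coe_le_norm _)
  have hd : Measurable fun q : LpSpace N p D × (Fin m → X d) => edist q.1 (reconstructLp p hDf r m
      q.2 fun i => evalLp p D (q.1, q.2 i)) ^ p := (measurable_fst.edist hR).pow_const p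
  have hle := hμ.lintegral_edist_reconstructLp_le hDo hDn hDf hκ hr m L
  rw [← hP] at hle ⊢
  rw [e1, e2, ← integral_sub hi1 hi2]
  refine (enorm_integral_le_lintegral_enorm _).trans ((lintegral_mono fun q => hF _ _).trans ?_)
  rw [lintegral_add_left measurable_const, lintegral_const, measure_univ, mul_one,
    lintegral_const_mul _ hd, lintegral_prod _ hd.aemeasurable]
  gcongr

end Duals

section DualConvergence

variable {p : ℝ} [Fact (1 ≤ p)] {D : Set (X d)} {κ : ℕ → KerFam d N} {κ₀ : KerFam d N}
  {μ : ℕ → Measure (LpSpace N p D)} {μ₀ : Measure (LpSpace N p D)}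

theorem MemH.tendsto_pairing (hDo : IsOpen D) (hDn : D.Nonempty) (hDb : Bornology.IsBounded D)
    (hκ : ∀ n, IsRegular D (κ n)) (hκ₀ : IsRegular D κ₀)
    (hst : ∀ k, StableTendsto (lam D k) (fun n => κ n k) (κ₀ k))
    (hdc : ∀ δ ≠ 0, ∃ r > 0, (∀ᶠ n in atTop, modCont p D r (κ n).toFam ≤ δ) ∧
      modCont p D r κ₀.toFam ≤ δ)
    (hmom : ∀ k, ∃ A ≠ ∞, ∀ n, mom p D (κ n) k ≤ A) (hmom₀ : ∀ k, mom p D κ₀ k ≠ ∞)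
    {k : ℕ} {g : (Fin k → X d) → (Fin k → U N) → ℝ} (hg : MemH p D k g) :
    Tendsto (fun n => pairing D (κ n).toFam g) atTop (𝓝 (pairing D κ₀.toFam g)) := by
  have hp := exponent_pos p
  have hDf := hDb.measure_lt_top (μ := volume).ne
  have hmomn : ∀ n k, mom p D (κ n) k ≠ ∞ := fun n k =>
    let ⟨_, hA, h⟩ := hmom k; ne_top_of_le_ne_top hA (h n)
  exact tendsto_integral_of_L1 _ (hg.integrable_integral hp hDo hDn hDf hκ₀ hmom₀).1
    (Eventually.of_forall fun n => hg.integrable_integral hp hDo hDn hDf (hκ n) (hmomn n))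
    (hg.tendsto_lintegral hDo hDn hDb hp hκ hκ₀ hst hdc hmom hmom₀)

/-- Dual measures converge weakly. -/
theorem IsDual.tendsto_integral (hDo : IsOpen D) (hDn : D.Nonempty) (hDb : Bornology.IsBounded D)
    (hκ : ∀ n, IsRegular D (κ n)) (hκ₀ : IsRegular D κ₀)
    (hst : ∀ k, StableTendsto (lam D k) (fun n => κ n k) (κ₀ k))
    (hdc : ∀ δ ≠ 0, ∃ r > 0, (∀ᶠ n in atTop, modCont p D r (κ n).toFam ≤ δ) ∧
      modCont p D r κ₀.toFam ≤ δ)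
    (hmom : ∀ k, ∃ A ≠ ∞, ∀ n, mom p D (κ n) k ≤ A) (hmom₀ : ∀ k, mom p D κ₀ k ≠ ∞)
    (hμ : ∀ n, IsDual p D (κ n).toFam (μ n)) (hμ₀ : IsDual p D κ₀.toFam μ₀)
    (F : LpSpace N p D →ᵇ ℝ) :
    Tendsto (fun n => ∫ u, F u ∂(μ n)) atTop (𝓝 (∫ u, F u ∂μ₀)) := by
  have hp := exponent_pos p
  have hDf := hDb.measure_lt_top (μ := volume).ne
  have := fun n => (hμ n).prob
  have := hμ₀.prob
  -- Bounded Lipschitz functions determine weak convergence, so uniformly continuous F suffice; for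
  -- these the oscillation is bounded by ε + C·dist^p.
  have key : ∀ F : LpSpace N p D →ᵇ ℝ, UniformContinuous F →
      Tendsto (fun n => ∫ u, F u ∂(μ n)) atTop (𝓝 (∫ u, F u ∂μ₀)) := by
    intro F hF
    refine tendsto_of_forall_approx fun ε hε => ?_
    have hε2 : ENNReal.ofReal (ε / 2) ≠ 0 := by simpa using hε
    obtain ⟨C, hC, hFC⟩ := exists_enorm_sub_le hF F.norm_coe_le_norm hp hε2
    obtain ⟨δ, hδ, hδε⟩ := exists_mul_le hC hε2
    have hδ3 : δ / 3 ≠ 0 := ENNReal.div_ne_zero.2 ⟨hδ, by simp⟩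
    -- The radius r is taken from the modulus, L from the tails, and m last, so that L^p times the
    -- integrated miss probability is small. The same r, L and m serve the limit and almost all n.
    obtain ⟨r, hr, hrn, hr0⟩ := hdc _ hδ3
    have ht := eventually_tail_le hDo hDb hκ hp hmom
      (fun δ hδ => let ⟨r, hr, h, _⟩ := hdc δ hδ; ⟨r, hr, h⟩) hδ3
    have ht₀ := eventually_tail_le (κ := fun _ => κ₀) hDo hDb (fun _ => hκ₀) hp
      (fun k => ⟨_, hmom₀ k, fun _ => le_rfl⟩)
      (fun δ hδ => let ⟨r, hr, _, h⟩ := hdc δ hδ; ⟨r, hr, Eventually.of_forall fun _ => h⟩) hδ3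
    obtain ⟨L, hL, hL₀⟩ := (ht.and ht₀).exists
    have hLt : ENNReal.ofReal L ^ p ≠ ∞ := ENNReal.rpow_ne_top_of_nonneg hp.le ENNReal.ofReal_ne_top
    have hmiss := ENNReal.Tendsto.const_mul (a := ENNReal.ofReal L ^ p)
      (tendsto_lintegral_missProb hDo hDf hr) (.inr hLt)
    rw [mul_zero] at hmiss
    obtain ⟨m, hm⟩ := (ENNReal.tendsto_nhds_zero.1 hmiss _ (pos_iff_ne_zero.2 hδ3)).exists
    have herr : ∀ (ζ : KerFam d N) (μ' : Measure (LpSpace N p D)), IsRegular D ζ →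
        IsDual p D ζ.toFam μ' → modCont p D r ζ.toFam ≤ δ / 3 → tail p D L ζ ≤ δ / 3 →
        |(∫ u, F u ∂μ') - ∫ x, ∫ ξ, F (reconstructLp p hDf r m x ξ) ∂(ζ m x)
          ∂(Measure.pi fun _ : Fin m => unif D)| ≤ ε := by
      intro ζ μ' hζ hμ' h1 h2
      have h := (hμ'.enorm_integral_sub_le hDo hDn hDf hζ F hFC hr m L).trans
        (add_le_add le_rfl ((mul_le_mul_right (add_le_add h1 (add_le_add h2 hm)) C)))
      rw [← add_assoc, ENNReal.add_thirds] at h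
      have h' := h.trans (add_le_add le_rfl ((mul_comm C δ).trans_le hδε))
      rw [← ENNReal.ofReal_add (by positivity) (by positivity), add_halves, ← ofReal_norm,
        ENNReal.ofReal_le_ofReal_iff hε.le] at h'
      exact h'
    refine ⟨fun n => ∫ x, ∫ ξ, F (reconstructLp p hDf r m x ξ) ∂(κ n m x)
          ∂(Measure.pi fun _ : Fin m => unif D), _, ?_, herr κ₀ μ₀ hκ₀ hμ₀ hr0
            hL₀.exists.choose_spec, ?_⟩
    · filter_upwards [hrn, hL] with n h1 h2
      exact herr _ _ (hκ n) (hμ n) h1 h2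
    -- Up to the factor |D|^{-m} the reconstructed expectation is a pairing with an observable of
    -- class `MemH`.
    · simp only [pi_unif hDo hDn, integral_smul_measure]
      exact ((memH_reconstruct hDf r m F).tendsto_pairing hDo hDn hDb hκ hκ₀ hst hdc hmom
        hmom₀).const_smul _
  let μ' : ℕ → ProbabilityMeasure (LpSpace N p D) := fun n => ⟨μ n, (hμ n).prob⟩
  let μ₀' : ProbabilityMeasure (LpSpace N p D) := ⟨μ₀, hμ₀.prob⟩
  have hw : Tendsto μ' atTop (𝓝 μ₀') := by
    rw [tendsto_iff_forall_lipschitz_integral_tendsto]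
    rintro f ⟨B, hB⟩ ⟨K, hK⟩
    exact key ⟨⟨f, hK.continuous⟩, B, hB⟩ hK.uniformContinuous
  exact ProbabilityMeasure.tendsto_iff_forall_integral_tendsto.1 hw F

end DualConvergence

/-! ### Passage to the limit and proof of the theorem -/

section Assembly

variable {p : ℝ} {D : Set (X d)} {κ : ℕ → KerFam d N} {κ₀ : KerFam d N}

/-- The asymptotic diagonal continuity at a fixed radius. -/
lemma exists_eventually_modCont_le (hD : MeasurableSet D) (hp : 0 ≤ p)
    (hκ : ∀ n, IsRegular D (κ n)) (hκ₀ : IsRegular D κ₀)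
    (h : StableTendsto (lam D 2) (fun n => κ n 2) (κ₀ 2))
    (hdc : Tendsto (fun r => limsup (fun n => modCont p D r (κ n).toFam) atTop) (𝓝[>] 0) (𝓝 0))
    {δ : ℝ≥0∞} (hδ : δ ≠ 0) :
    ∃ r > 0, (∀ᶠ n in atTop, modCont p D r (κ n).toFam ≤ δ) ∧ modCont p D r κ₀.toFam ≤ δ := by
  have h0 := tendsto_modCont_of_stable hD hp hκ hκ₀ h hdc
  obtain ⟨r, ⟨h1, h2⟩, hr⟩ := ((hdc.eventually_lt_const (pos_iff_ne_zero.2 hδ)).and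
    (h0.eventually_le_const (pos_iff_ne_zero.2 hδ))).and self_mem_nhdsWithin |>.exists
  exact ⟨r, hr, (eventually_lt_of_limsup_lt h1).mono fun n hn => hn.le, h2⟩

/-- The limsup over k cannot be exchanged with the limit along the sequence. The equivalent bounds
M^{kp} on the individual moments can, by lower semicontinuity. -/
lemma supportBound_of_stable (hDo : IsOpen D) (hDn : D.Nonempty) (hDf : volume D ≠ ∞) (hp : 0 < p)
    (hκ : ∀ n, IsRegular D (κ n)) (hκ₀ : IsRegular D κ₀)
    (h : ∀ k, StableTendsto (lam D k) (fun n => κ n k) (κ₀ k)) {M : ℝ} (hM : 0 < M)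
    (hs : ∀ n, SupportBound p D M (κ n).toFam) : SupportBound p D M κ₀.toFam := by
  refine supportBound_of_mom_le hp fun k => ?_
  refine (lpairing_prod_le_liminf hp.le hκ hκ₀ (h k)).trans ?_
  refine liminf_le_of_le (by isBoundedDefault) fun b hb => ?_
  obtain ⟨n, hn⟩ := hb.exists
  exact hn.trans (mom_le_of_supportBound hDo hDn hDf (hκ n) hp hM (hs n) k)

end Assembly

end CorrelationMeasures

theorem theorem2p5 {d N : ℕ} (p : ℝ) [Fact (1 ≤ p)] (D : Set (X d)) (hDo : IsOpen D)
    (hDc : IsConnected D) (ν : ℕ → MeasFamily d N) (hν : ∀ n, IsCorrelationMeasure p D (ν n))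
    (c : ℝ) (hc : 0 < c)
    (hbound : ⨆ n, lpairing D (ν n) (k := 1) (fun _ ξ => ‖ξ 0‖ₑ ^ p) ≤ ENNReal.ofReal (c ^ p))
    (hdc : Tendsto (fun r => limsup (fun n => modCont p D r (ν n)) atTop) (𝓝[>] 0) (𝓝 0)) :
    ∃ (s : ℕ → ℕ) (ν₀ : MeasFamily d N), StrictMono s ∧ IsCorrelationMeasure p D ν₀ ∧
      -- weak* convergence
      (∀ k (g : (Fin k → X d) → C₀(Fin k → U N, ℝ)), IntegrableOn g (prodDom D k) →
        Tendsto (fun j => pairing D (ν (s j)) (fun x ξ => g x ξ)) atTop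
          (𝓝 (pairing D ν₀ (fun x ξ => g x ξ)))) ∧
      -- the bound on the moment
      lpairing D ν₀ (k := 1) (fun _ ξ => ‖ξ 0‖ₑ ^ p) ≤ ENNReal.ofReal (c ^ p) ∧
      -- lower semicontinuity of the modulus of continuity
      (∀ r : ℝ, 0 < r → modCont p D r ν₀ ≤ liminf (fun j => modCont p D r (ν (s j))) atTop) ∧
      -- lower semicontinuity for nonnegative product observables
      (∀ k (φ : (Fin k → X d) → ℝ) (κ : (Fin k → U N) → ℝ),
        LocallyIntegrableOn φ (prodDom D k) → (∀ x ∈ prodDom D k, 0 ≤ φ x) →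
        Continuous κ → (∀ ξ, 0 ≤ κ ξ) →
        lpairing D ν₀ (fun x ξ => ENNReal.ofReal (φ x * κ ξ)) ≤
          liminf (fun j => lpairing D (ν (s j)) (fun x ξ => ENNReal.ofReal (φ x * κ ξ))) atTop) ∧
      -- bounded domain and uniformly bounded support
      (Bornology.IsBounded D → ∀ M : ℝ, 0 < M →
        -- the two formulations of the support bound are equivalent
        (∀ n (μ : Measure (LpSpace N p D)), IsDual p D (ν n) μ →
          (SupportBound p D M (ν n) ↔ ∀ᵐ u ∂μ, ‖u‖ ≤ M)) ∧
        ((∀ n, SupportBound p D M (ν n)) →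
          -- all observables are well defined and finite, and they converge strongly
          (∀ m (g : (Fin (m + 1) → X d) → (Fin (m + 1) → U N) → ℝ), MemH1 p D m g →
            (∀ n, lpairing D (ν n) (fun x ξ => ‖g x ξ‖ₑ) < ∞) ∧
            lpairing D ν₀ (fun x ξ => ‖g x ξ‖ₑ) < ∞ ∧
            Tendsto (fun j => ∫⁻ x in prodDom D (m + 1),
              ‖(∫ ξ, g x ξ ∂(ν (s j) (m + 1) x)) - ∫ ξ, g x ξ ∂(ν₀ (m + 1) x)‖ₑ)
              atTop (𝓝 0)) ∧
          -- in particular, the correlation measures converge weakly in the bounded class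
          (IsBoundedCorrelationMeasure p D ν₀ ∧
            ∀ m (g : (Fin (m + 1) → X d) → (Fin (m + 1) → U N) → ℝ), MemH1 p D m g →
              Tendsto (fun j => pairing D (ν (s j)) g) atTop (𝓝 (pairing D ν₀ g))) ∧
          -- and so do the dual probability measures
          (∀ (μ : ℕ → Measure (LpSpace N p D)) (μ₀ : Measure (LpSpace N p D)),
            (∀ n, IsDual p D (ν n) (μ n)) → IsDual p D ν₀ μ₀ →
            ∀ F : LpSpace N p D →ᵇ ℝ,
              Tendsto (fun j => ∫ u, F u ∂(μ (s j))) atTop (𝓝 (∫ u, F u ∂μ₀))))) := by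
  have hp := exponent_pos p
  have hDn := hDc.nonempty
  -- All quantities in the statement depend on the families only up to null sets, so the argument is
  -- carried out for kernels and transferred back.
  choose κ hκ hκν using fun n => (hν n).exists_regular hDo hDn
  have hfam : ∀ n k, ∀ᵐ x ∂lam D k, ν n k x = (κ n).toFam k x := fun n k =>
    (hκν n k).mono fun x hx => hx.symm
  have hA : ∀ n, lpairing D (κ n).toFam (k := 1) (fun _ ξ => ‖ξ 0‖ₑ ^ p) ≤ ENNReal.ofReal (c ^ p) :=
    fun n => (lpairing_congr (hfam n 1) _).symm.trans_le ((le_iSup (fun n =>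
      lpairing D (ν n) (k := 1) (fun _ ξ => ‖ξ 0‖ₑ ^ p)) n).trans hbound)
  obtain ⟨s, κ₀, hs, hκ₀, hst⟩ := exists_stable_subseq hDo hDn hκ hp ENNReal.ofReal_ne_top hA
  have hκs : ∀ j, IsRegular D (κ (s j)) := fun j => hκ (s j)
  have hdcs : Tendsto (fun r => limsup (fun j => modCont p D r (κ (s j)).toFam) atTop)
      (𝓝[>] 0) (𝓝 0) := by
    refine tendsto_of_tendsto_of_tendsto_of_le_of_le tendsto_const_nhds hdc (fun _ => bot_le)
      fun r => ?_
    simp only [← modCont_congr (hfam _ 2)]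
    exact limsup_le_limsup_of_le (u := fun n => modCont p D r (ν n)) hs.tendsto_atTop
  have hmom1 := lpairing_norm_le_of_stable hp.le hκs hκ₀ (hst 1) fun j => hA (s j)
  have hcm : IsCorrelationMeasure p D κ₀.toFam :=
    hκ₀.isCorrelationMeasure (hmom1.trans_lt ENNReal.ofReal_lt_top)
      (tendsto_modCont_of_stable hDo.measurableSet hp.le hκs hκ₀ (hst 2) hdcs)
  refine ⟨s, κ₀.toFam, hs, hcm, fun k g hg => ?_, hmom1, fun r _ => ?_,
    fun k φ f hφ hφ0 hf hf0 => ?_, fun hDb M hM => ⟨fun n μ hμ => ?_, fun hsupp => ?_⟩⟩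
  · have := fun j => (hκs j).markov k
    have := hκ₀.markov k
    simp only [pairing_congr (hfam _ k)]
    exact (hst k).tendsto_zeroAtInfty hg
  · simp only [modCont_congr (hfam _ 2)]
    exact modCont_le_liminf hDo.measurableSet hp.le hκs hκ₀ (hst 2) r
  · simp only [lpairing_congr (hfam _ k)]
    exact lpairing_product_le_liminf hDo.measurableSet hκs hκ₀ (hst k)
      hφ.aestronglyMeasurable.aemeasurable hφ0 hf hf0
  · rw [supportBound_congr (hfam n)]
    exact (hμ.congr (hfam n)).supportBound_iff hDo hDn hDb.measure_lt_top.ne (hκ n) hM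
  · have hDf := hDb.measure_lt_top (μ := volume).ne
    have hsκ : ∀ n, SupportBound p D M (κ n).toFam := fun n =>
      (supportBound_congr (hfam n)).1 (hsupp n)
    have hs₀ := supportBound_of_stable hDo hDn hDf hp hκs hκ₀ hst hM fun j => hsκ (s j)
    have hle : ∀ n k, mom p D (κ n) k ≤ ENNReal.ofReal M ^ ((k : ℝ) * p) := fun n =>
      mom_le_of_supportBound hDo hDn hDf (hκ n) hp hM (hsκ n)
    have hfin : ∀ k : ℕ, ENNReal.ofReal M ^ ((k : ℝ) * p) ≠ ∞ := fun k =>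
      ENNReal.rpow_ne_top_of_nonneg (by positivity) ENNReal.ofReal_ne_top
    have hmomn : ∀ n k, mom p D (κ n) k ≠ ∞ := fun n k => ne_top_of_le_ne_top (hfin k) (hle n k)
    have hmom₀ : ∀ k, mom p D κ₀ k ≠ ∞ := fun k =>
      ne_top_of_le_ne_top (hfin k) (mom_le_of_supportBound hDo hDn hDf hκ₀ hp hM hs₀ k)
    have hmom : ∀ k, ∃ A ≠ ∞, ∀ j, mom p D (κ (s j)) k ≤ A := fun k =>
      ⟨_, hfin k, fun j => hle (s j) k⟩
    have hdiag := fun δ hδ =>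
      exists_eventually_modCont_le (δ := δ) hDo.measurableSet hp.le hκs hκ₀ (hst 2) hdcs hδ
    refine ⟨fun m g hg => ⟨fun n => ?_, ?_, ?_⟩, ⟨⟨hcm, M, hM, hs₀⟩, fun m g hg => ?_⟩,
      fun μ μ₀ hμ hμ₀ F => ?_⟩
    · obtain ⟨Φ, hΦ⟩ := hg.memH.exists_growthBound hp.le
      rw [lpairing_congr (hfam n _)]
      exact (hΦ.lpairing_ne_top hDo hDn (hκ n) (hmomn n)).lt_top
    · obtain ⟨Φ, hΦ⟩ := hg.memH.exists_growthBound hp.le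
      exact (hΦ.lpairing_ne_top hDo hDn hκ₀ hmom₀).lt_top
    · refine (hg.memH.tendsto_lintegral hDo hDn hDb hp hκs hκ₀ hst hdiag hmom hmom₀).congr
        fun j => lintegral_congr_ae ?_
      filter_upwards [hfam (s j) (m + 1)] with x hx
      rw [hx]
      rfl
    · simp only [pairing_congr (hfam _ (m + 1))]
      exact hg.memH.tendsto_pairing hDo hDn hDb hκs hκ₀ hst hdiag hmom hmom₀
    · exact IsDual.tendsto_integral hDo hDn hDb hκs hκ₀ hst hdiag hmom hmom₀
        (fun j => (hμ (s j)).congr (hfam (s j))) hμ₀ F
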